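/- For a prime $p$ and $\epsilon>0$, let $n_p(\epsilon)$ be the least positive integer such that the following holds: for every $n\ge n_p(\epsilon)$ and every subset $A\subseteq\mathbb{F}_p^n$, writing $\alpha=|A|/p^n$, there is a nonzero $d\in\mathbb{F}_p^n$ such that the density of three-term arithmetic progressions with common difference $d$ in $A$, that is, $p^{-n}\,|\{x\in\mathbb{F}_p^n : x,\ x+d,\ x+2d\in A\}|$, is at least $\alpha^3-\epsilon$. Let $T_p(0)=1$ and $T_p(h+1)=p^{T_p(h)}$, so that $T_p(h)$ is the exponential tower of $p$'s of height $h$. There are absolute constants $c,C>0$ such that for every odd prime $p$ and every real $\epsilon$ with $0<\epsilon\le 2^{-161}p^{-8}$, the integer $n_p(\epsilon)$ exists and there are nonnegative integers $h_1,h_2$, both in the interval $[\,c\log_2(1/\epsilon),\ C\log_2(1/\epsilon)\,]$, with $$T_p(h_1)\ \le\ n_p(\epsilon)\ \le\ T_p(h_2).$$ -/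

import Mathlib

/-- The density `|A| / p ^ n` of a subset `A` of `𝔽_p ^ n`. -/
noncomputable def setDensity (p n : ℕ) (A : Finset (Fin n → ZMod p)) : ℝ :=
  (A.card : ℝ) / (p : ℝ) ^ n

/-- The density of three-term arithmetic progressions with common difference `d` in `A`: the
fraction of the points `x` of `𝔽_p ^ n` for which `x`, `x + d` and `x + 2 d` all lie in `A`. -/
noncomputable def apDensity (p n : ℕ) (A : Finset (Fin n → ZMod p)) (d : Fin n → ZMod p) : ℝ :=
  ((A.filter (fun x => x + d ∈ A ∧ x + 2 • d ∈ A)).card : ℝ) / (p : ℝ) ^ n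

/-- Every subset `A` of `𝔽_p ^ n`, of density `α` say, has a nonzero common difference `d` for
which the density of three-term arithmetic progressions in `A` is at least `α ^ 3 - ε`. -/
def HasPopularDifferences (p : ℕ) (ε : ℝ) (n : ℕ) : Prop :=
  ∀ A : Finset (Fin n → ZMod p), ∃ d : Fin n → ZMod p, d ≠ 0 ∧
    setDensity p n A ^ 3 - ε ≤ apDensity p n A d

/-- The positive integers `N` such that the popular difference property holds in every
dimension `n ≥ N`. -/
def admissibleDimensions (p : ℕ) (ε : ℝ) : Set ℕ :=
  {N : ℕ | 0 < N ∧ ∀ n : ℕ, N ≤ n → HasPopularDifferences p ε n}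

/-- `n_p(ε)`, the least admissible dimension. -/
noncomputable def popularDim (p : ℕ) (ε : ℝ) : ℕ :=
  sInf (admissibleDimensions p ε)

/-- The exponential tower of `p`'s of height `h`: `1`, `p`, `p ^ p`, `p ^ (p ^ p)`, ... -/
def expTower (p : ℕ) : ℕ → ℕ
  | 0 => 1
  | h + 1 => p ^ expTower p h

section Auxiliary

open Finset
open scoped Classical

/-! Upper bound. For a subspace H of V let b(H) be the mean cube of the averages of the indicator of
A over the cosets of H, so that b(V) = α³ and b ≤ 1. Let K ≤ H annihilate the large Fourier
coefficients of the indicator on every coset of H. Progressions with difference in H are then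
counted, up to a small error, by the K-averages, and Schur's inequality bounds that count below by 2
b(H) - b(K) (`exists_meanCube_increment`). If every nonzero difference fell short of α³ - ε, then
b(K) - α³ would be at least about twice b(H) - α³ plus a multiple of ε. Since the excess doubles,
about log₂(1/ε) steps contradict b ≤ 1. Each step makes the codimension exponentially larger, which
gives a tower of logarithmic height.

Lower bound. One builds nonnegative functions of mean at least 1 whose progression density is below
1 by some ε for every nonzero difference. To pass from V to V × W, with W a space of polynomials
over a finite field K, multiply f over each point x of a small set X by a mean-one weight on 𝔽_p
composed with a functional v x on W. The weight vanishes on an interval and has few progressions.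
For a difference (a, e) with a ≠ 0, the weights average to 1 wherever the functionals along x, x +
a, x + 2a are independent, so the old deficit survives (`apSumAt_perturb_le`). For (0, e) with e ≠
0, the values v x e are nearly equidistributed over X, so the fibres over X lose a constant
proportion of their progressions; this beats the excess δ of the mean cube over 1 once X has density
a large multiple of δ (`apSumAt_perturb_vertical_le`).

A step multiplies δ by a constant, nearly preserves ε, and makes the dimension exponentially larger.
Starting from δ = 9/q and ε = 2/q⁸ (`gapFunction_cone`), about log q steps are possible. Perturbing
all remaining fibres at the end leaves a multiple of an indicator function, hence a set without a
popular difference. -/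

theorem two_ne_zero_zmod {p : ℕ} [Fact p.Prime] (hp : Odd p) : (2 : ZMod p) ≠ 0 := by
  intro h
  have h' : ((2 : ℕ) : ZMod p) = 0 := by exact_mod_cast h
  rw [ZMod.natCast_eq_zero_iff] at h'
  have := Nat.le_of_dvd (by norm_num) h'
  have := (Fact.out : p.Prime).two_le
  have : p = 2 := by omega
  subst this
  exact absurd hp (by decide)

/-! ### Fourier analysis of three-term progressions -/

section Fourier

variable {p : ℕ} [Fact p.Prime] {G : Type*} [AddCommGroup G] [Module (ZMod p) G] [Fintype G]

instance dualFinite : Finite (Module.Dual (ZMod p) G) := DFunLike.finite _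

noncomputable instance dualFintype : Fintype (Module.Dual (ZMod p) G) := Fintype.ofFinite _

theorem card_dual : Fintype.card (Module.Dual (ZMod p) G) = Fintype.card G := by
  rw [Module.card_eq_pow_finrank (K := ZMod p), Module.card_eq_pow_finrank (K := ZMod p) (V := G),
    Subspace.dual_finrank_eq]

/-- Orthogonality of the characters of a finite vector space over `𝔽_p`. -/
theorem sum_dual_character (a : G) :
    ∑ l : Module.Dual (ZMod p) G, (ZMod.stdAddChar (l a) : ℂ)
      = if a = 0 then (Fintype.card G : ℂ) else 0 := by
  classical
  let χ : AddChar (Module.Dual (ZMod p) G) ℂ :=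
    (ZMod.stdAddChar (N := p)).compAddMonoidHom
      (AddMonoidHom.mk' (fun l : Module.Dual (ZMod p) G => l a) (fun _ _ => rfl))
  have h := AddChar.sum_eq_ite χ
  have hχ : χ = 0 ↔ a = 0 := by
    constructor
    · intro h0
      rw [← Module.forall_dual_apply_eq_zero_iff (ZMod p)]
      intro l
      apply ZMod.injective_stdAddChar
      rw [AddChar.map_zero_eq_one]
      exact DFunLike.congr_fun h0 l
    · intro h0
      ext l
      change (ZMod.stdAddChar (l a) : ℂ) = 1
      simp [h0]
  simp only [hχ, card_dual] at h
  exact h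

/-- The (unnormalised) Fourier coefficient of `g` at the functional `l`. -/
noncomputable def fourierSum (g : G → ℝ) (l : Module.Dual (ZMod p) G) : ℂ :=
  ∑ x, (g x : ℂ) * ZMod.stdAddChar (l x)

/-- The weighted number of three-term progressions. -/
def apSum (g : G → ℝ) : ℝ := ∑ x, ∑ d, g x * g (x + d) * g (x + 2 • d)

/-- Orthogonality in `l` leaves only the triples with x - 2y + z = 0, which are parametrised by y =
x + d, z = x + 2d. -/
theorem sum_fourierSum_triple (g : G → ℝ) :
    ∑ l : Module.Dual (ZMod p) G,
        fourierSum g l * fourierSum g ((-2 : ZMod p) • l) * fourierSum g l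
      = (Fintype.card G : ℂ) * (apSum g : ℂ) := by
  classical
  have h1 : ∀ l : Module.Dual (ZMod p) G,
      fourierSum g l * fourierSum g ((-2 : ZMod p) • l) * fourierSum g l
      = ∑ x, ∑ y, ∑ z, (g x * g y * g z : ℂ) * ZMod.stdAddChar (l (x - 2 • y + z)) := by
    intro l
    unfold fourierSum
    rw [Finset.sum_mul_sum, Finset.sum_mul]
    refine Finset.sum_congr rfl fun x _ => ?_
    rw [Finset.sum_mul]
    refine Finset.sum_congr rfl fun y _ => ?_
    rw [Finset.mul_sum]
    refine Finset.sum_congr rfl fun z _ => ?_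
    have : l (x - 2 • y + z) = l x + ((-2 : ZMod p) • l) y + l z := by
      simp [two_smul]; ring
    rw [this, AddChar.map_add_eq_mul, AddChar.map_add_eq_mul]
    ring
  simp_rw [h1]
  rw [Finset.sum_comm]
  unfold apSum
  push_cast
  rw [Finset.mul_sum]
  refine Finset.sum_congr rfl fun x _ => ?_
  rw [Finset.sum_comm, Finset.mul_sum]
  rw [← Equiv.sum_comp (Equiv.addLeft x)]
  refine Finset.sum_congr rfl fun d _ => ?_
  rw [Finset.sum_comm]
  simp_rw [← Finset.mul_sum, sum_dual_character]
  rw [Finset.sum_eq_single (x + 2 • d)]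
  · have : x - 2 • (Equiv.addLeft x) d + (x + 2 • d) = 0 := by
      simp [two_smul]; abel
    rw [if_pos this]
    simp
    ring
  · intro z _ hz
    rw [if_neg, mul_zero]
    intro h0
    apply hz
    simp only [Equiv.coe_addLeft, two_smul] at h0 ⊢
    have : z = (x - (x + d + (x + d)) + z) + (x + (d + d)) := by abel
    rw [this, h0, zero_add]
  · simp

theorem sum_fourierSum_sq (g : G → ℝ) :
    ∑ l : Module.Dual (ZMod p) G, ‖fourierSum g l‖ ^ 2
      = (Fintype.card G : ℝ) * ∑ x, g x ^ 2 := by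
  classical
  have h1 : ∀ l : Module.Dual (ZMod p) G, ((‖fourierSum g l‖ ^ 2 : ℝ) : ℂ)
      = ∑ x, ∑ y, (g x * g y : ℂ) * ZMod.stdAddChar (l (x - y)) := by
    intro l
    rw [← Complex.normSq_eq_norm_sq, ← Complex.mul_conj]
    unfold fourierSum
    rw [map_sum, Finset.sum_mul_sum]
    refine Finset.sum_congr rfl fun x _ => Finset.sum_congr rfl fun y _ => ?_
    rw [map_mul, ← AddChar.map_neg_eq_conj, Complex.conj_ofReal, map_sub, sub_eq_add_neg,
      AddChar.map_add_eq_mul]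
    ring
  have h2 : ((∑ l : Module.Dual (ZMod p) G, ‖fourierSum g l‖ ^ 2 : ℝ) : ℂ)
      = (((Fintype.card G : ℝ) * ∑ x, g x ^ 2 : ℝ) : ℂ) := by
    push_cast
    simp_rw [← Complex.ofReal_pow, h1]
    rw [Finset.sum_comm, Finset.mul_sum]
    refine Finset.sum_congr rfl fun x _ => ?_
    rw [Finset.sum_comm]
    simp_rw [← Finset.mul_sum, sum_dual_character, sub_eq_zero]
    simp
    ring
  exact_mod_cast h2

/-- The functionals at which `g` has a large Fourier coefficient. -/
noncomputable def largeSpectrum (η : ℝ) (g : G → ℝ) : Finset (Module.Dual (ZMod p) G) := by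
  classical
  exact univ.filter fun l => η * Fintype.card G < ‖fourierSum g l‖

theorem card_largeSpectrum_le {η : ℝ} (hη : 0 < η) {g : G → ℝ} (h0 : ∀ x, 0 ≤ g x)
    (h1 : ∀ x, g x ≤ 1) : ((largeSpectrum (p := p) η g).card : ℝ) ≤ 1 / η ^ 2 := by
  classical
  have hG : (0 : ℝ) < Fintype.card G := by exact_mod_cast Fintype.card_pos
  have ha : ∑ x, g x ^ 2 ≤ (Fintype.card G : ℝ) := by
    calc ∑ x, g x ^ 2 ≤ ∑ _x : G, (1 : ℝ) :=
          Finset.sum_le_sum fun x _ => pow_le_one₀ (h0 x) (h1 x)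
      _ = _ := by simp
  have hb : ((largeSpectrum (p := p) η g).card : ℝ) * (η * Fintype.card G) ^ 2
      ≤ (Fintype.card G : ℝ) * ∑ x, g x ^ 2 := by
    rw [← sum_fourierSum_sq (p := p), ← nsmul_eq_mul, ← Finset.sum_const]
    refine (Finset.sum_le_sum ?_).trans
      (Finset.sum_le_sum_of_subset_of_nonneg (Finset.subset_univ _) fun _ _ _ => by positivity)
    intro l hl
    have : η * Fintype.card G < ‖fourierSum g l‖ := by simpa [largeSpectrum] using hl
    gcongr
  rw [le_div_iff₀ (by positivity)]
  have hc : ((largeSpectrum (p := p) η g).card : ℝ) * η ^ 2 * (Fintype.card G : ℝ) ^ 2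
      ≤ 1 * (Fintype.card G : ℝ) ^ 2 := by nlinarith
  exact le_of_mul_le_mul_right hc (by positivity)

theorem fourierSum_translate (g : G → ℝ) (a : G) (l : Module.Dual (ZMod p) G) :
    fourierSum (fun x => g (x + a)) l = ZMod.stdAddChar (-l a) * fourierSum g l := by
  unfold fourierSum
  rw [← Equiv.sum_comp (Equiv.addRight a) (fun x => (g x : ℂ) * ZMod.stdAddChar (l x)),
    Finset.mul_sum]
  refine Finset.sum_congr rfl fun x _ => ?_
  simp only [Equiv.coe_addRight, map_add]
  have : (ZMod.stdAddChar (l x) : ℂ)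
      = ZMod.stdAddChar (-l a) * ZMod.stdAddChar (l x + l a) := by
    rw [← AddChar.map_add_eq_mul]; congr 1; ring
  rw [this]; ring

/-- Translation multiplies Fourier coefficients by numbers of modulus one. Hence the large spectrum
on a coset does not depend on the chosen base point. -/
theorem largeSpectrum_translate (η : ℝ) (g : G → ℝ) (a : G) :
    largeSpectrum (p := p) η (fun x => g (x + a)) = largeSpectrum η g := by
  classical
  ext l
  simp [largeSpectrum, fourierSum_translate]

/-- The average of `g` over the coset `x + K`. -/
noncomputable def cosetAverage (K : Submodule (ZMod p) G) (g : G → ℝ) (x : G) : ℝ :=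
  (∑ h : K, g (x + h)) / Fintype.card K

theorem fourierSum_cosetAverage (K : Submodule (ZMod p) G) (g : G → ℝ)
    (l : Module.Dual (ZMod p) G) :
    fourierSum (cosetAverage K g) l = if ∀ h ∈ K, l h = 0 then fourierSum g l else 0 := by
  classical
  have hK : (Fintype.card K : ℂ) ≠ 0 := by exact_mod_cast Fintype.card_ne_zero
  have h1 : fourierSum (cosetAverage K g) l
      = (∑ h : K, ZMod.stdAddChar (-l h)) * fourierSum g l / Fintype.card K := by
    rw [Finset.sum_mul]
    simp_rw [← fourierSum_translate]
    unfold fourierSum cosetAverage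
    rw [Finset.sum_comm, Finset.sum_div]
    refine Finset.sum_congr rfl fun x _ => ?_
    push_cast
    rw [← Finset.sum_mul]
    ring
  let χ : AddChar K ℂ := (ZMod.stdAddChar (N := p)).compAddMonoidHom
      (AddMonoidHom.mk' (fun h : K => -l h) (fun a b => by simp [add_comm]))
  have h2 : ∑ h : K, (ZMod.stdAddChar (-l h) : ℂ) = if χ = 0 then (Fintype.card K : ℂ) else 0 :=
    AddChar.sum_eq_ite χ
  have h3 : χ = 0 ↔ ∀ h ∈ K, l h = 0 := by
    constructor
    · intro h0 h hh
      have : (ZMod.stdAddChar (-l h) : ℂ) = ZMod.stdAddChar (0 : ZMod p) := by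
        rw [AddChar.map_zero_eq_one]
        exact DFunLike.congr_fun h0 (⟨h, hh⟩ : K)
      simpa using ZMod.injective_stdAddChar this
    · intro h0
      ext h
      change (ZMod.stdAddChar (-l h) : ℂ) = 1
      simp [h0 h h.2]
  rw [h1, h2]
  simp only [h3]
  split_ifs
  · field_simp
  · simp

/-- Averaging over `K` keeps exactly the coefficients at functionals vanishing on `K`. For any other
`l`, the functional -2l does not vanish on `K` either, since p is odd, so the middle factor is
small; Parseval bounds the other two factors. -/
theorem abs_apSum_sub_le (hp : Odd p) (K : Submodule (ZMod p) G) {η : ℝ} (hη : 0 ≤ η)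
    {g : G → ℝ} (h0 : ∀ x, 0 ≤ g x) (h1 : ∀ x, g x ≤ 1)
    (hK : ∀ l ∈ largeSpectrum (p := p) η g, ∀ h ∈ K, l h = 0) :
    |apSum g - apSum (cosetAverage K g)| ≤ η * (Fintype.card G : ℝ) ^ 2 := by
  classical
  have hG : (0 : ℝ) < Fintype.card G := by exact_mod_cast Fintype.card_pos
  have h2 : (2 : ZMod p) ≠ 0 := two_ne_zero_zmod hp
  have key : (Fintype.card G : ℂ) * ((apSum g - apSum (cosetAverage K g) : ℝ) : ℂ)
      = ∑ l : Module.Dual (ZMod p) G, if ∀ h ∈ K, l h = 0 then 0 else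
        fourierSum g l * fourierSum g ((-2 : ZMod p) • l) * fourierSum g l := by
    push_cast
    rw [mul_sub, ← sum_fourierSum_triple (p := p), ← sum_fourierSum_triple (p := p), ← Finset.sum_sub_distrib]
    refine Finset.sum_congr rfl fun l _ => ?_
    simp only [fourierSum_cosetAverage]
    split_ifs with ha hb hb <;> simp at *
    obtain ⟨h, hh, hne⟩ := hb
    exact absurd (ha h hh) (by simp_all)
  have ha : ∑ x, g x ^ 2 ≤ (Fintype.card G : ℝ) := by
    calc ∑ x, g x ^ 2 ≤ ∑ _x : G, (1 : ℝ) :=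
          Finset.sum_le_sum fun x _ => pow_le_one₀ (h0 x) (h1 x)
      _ = _ := by simp
  have hn : (Fintype.card G : ℝ) * |apSum g - apSum (cosetAverage K g)|
      ≤ η * Fintype.card G * (Fintype.card G * ∑ x, g x ^ 2) := by
    have := congrArg norm key
    rw [norm_mul, Complex.norm_natCast, Complex.norm_real, Real.norm_eq_abs] at this
    rw [this, ← sum_fourierSum_sq (p := p), Finset.mul_sum]
    refine (norm_sum_le _ _).trans (Finset.sum_le_sum fun l _ => ?_)
    split_ifs with hl
    · simp; positivity
    · push Not at hl
      obtain ⟨h, hh, hne⟩ := hl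
      have hb : ‖fourierSum g ((-2 : ZMod p) • l)‖ ≤ η * Fintype.card G := by
        by_contra hlt
        push Not at hlt
        have hmem : (-2 : ZMod p) • l ∈ largeSpectrum (p := p) η g := by
          simp [largeSpectrum, hlt]
        have := hK _ hmem h hh
        simp [h2, hne] at this
      rw [norm_mul, norm_mul]
      calc ‖fourierSum g l‖ * ‖fourierSum g ((-2 : ZMod p) • l)‖ * ‖fourierSum g l‖
          = ‖fourierSum g ((-2 : ZMod p) • l)‖ * ‖fourierSum g l‖ ^ 2 := by ring
        _ ≤ _ := by gcongr
  have : (Fintype.card G : ℝ) * |apSum g - apSum (cosetAverage K g)|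
      ≤ (Fintype.card G : ℝ) * (η * (Fintype.card G : ℝ) ^ 2) := by
    refine hn.trans ?_
    have : η * Fintype.card G * (Fintype.card G * ∑ x, g x ^ 2)
      ≤ η * Fintype.card G * (Fintype.card G * (Fintype.card G : ℝ)) := by gcongr
    refine this.trans (le_of_eq ?_)
    ring
  exact le_of_mul_le_mul_left this hG

end Fourier

/-! ### Schur's inequality and a lower bound for progression counts -/

section Schur

variable {p : ℕ} [Fact p.Prime] {G : Type*} [AddCommGroup G] [Module (ZMod p) G] [Fintype G]

theorem schur_inequality {a b c : ℝ} (ha : 0 ≤ a) (hb : 0 ≤ b) (hc : 0 ≤ c) :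
    a ^ 2 * b + a ^ 2 * c + b ^ 2 * a + b ^ 2 * c + c ^ 2 * a + c ^ 2 * b
      ≤ a ^ 3 + b ^ 3 + c ^ 3 + 3 * (a * b * c) := by
  rcases le_total a b with h1 | h1 <;> rcases le_total b c with h2 | h2 <;>
    rcases le_total a c with h3 | h3 <;>
    nlinarith [mul_nonneg (sub_nonneg.2 h1) (sub_nonneg.2 h2),
      mul_nonneg (sub_nonneg.2 h1) (sub_nonneg.2 h3),
      mul_nonneg (sub_nonneg.2 h2) (sub_nonneg.2 h3), mul_nonneg ha (sq_nonneg (a - b)),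
      mul_nonneg hb (sq_nonneg (a - b)), mul_nonneg hc (sq_nonneg (a - b)),
      mul_nonneg ha (mul_nonneg (sub_nonneg.2 h1) (sub_nonneg.2 h3)),
      mul_nonneg hc (mul_nonneg (sub_nonneg.2 h2) (sub_nonneg.2 h3)),
      mul_nonneg hb (mul_nonneg (sub_nonneg.2 h1) (sub_nonneg.2 h2)),
      mul_nonneg (sub_nonneg.2 h1) (sq_nonneg (a - b)),
      mul_nonneg (sub_nonneg.2 h2) (sq_nonneg (b - c)),
      mul_nonneg (sub_nonneg.2 h3) (sq_nonneg (a - c)),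
      mul_nonneg (sub_nonneg.2 h1) (sq_nonneg (b - c)),
      mul_nonneg (sub_nonneg.2 h2) (sq_nonneg (a - b))]


theorem sum_sum_add (F F' : G → ℝ) :
    ∑ x, ∑ d, F x * F' (x + d) = (∑ x, F x) * ∑ x, F' x := by
  rw [Finset.sum_mul]
  refine Finset.sum_congr rfl fun x _ => ?_
  rw [← Finset.mul_sum, ← Equiv.sum_comp (Equiv.addLeft x) F']
  rfl


omit [Fintype G] in
theorem two_nsmul_eq (d : G) : 2 • d = (2 : ZMod p) • d := by
  rw [two_smul, two_smul]

theorem sum_two_nsmul (hp : Odd p) (F : G → ℝ) : ∑ d, F (2 • d) = ∑ d, F d := by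
  have h2 := two_ne_zero_zmod hp
  refine Fintype.sum_bijective (fun d : G => 2 • d) ?_ _ _ fun _ => rfl
  rw [← Finite.injective_iff_bijective]
  intro a b hab
  simp only [two_nsmul_eq (p := p)] at hab
  exact smul_right_injective G h2 hab

theorem sum_sum_two_nsmul (hp : Odd p) (F F' : G → ℝ) :
    ∑ x, ∑ d, F x * F' (x + 2 • d) = (∑ x, F x) * ∑ x, F' x := by
  rw [← sum_sum_add]
  exact Finset.sum_congr rfl fun x _ => sum_two_nsmul hp (fun d => F x * F' (x + d))


theorem sum_sum_add_two_nsmul (F F' : G → ℝ) :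
    ∑ x, ∑ d, F (x + d) * F' (x + 2 • d) = (∑ x, F x) * ∑ x, F' x := by
  rw [← sum_sum_add, Finset.sum_comm, Finset.sum_comm (f := fun x d => F x * F' (x + d))]
  refine Finset.sum_congr rfl fun d _ => ?_
  rw [← Equiv.sum_comp (Equiv.addRight d) (fun x => F x * F' (x + d))]
  refine Finset.sum_congr rfl fun x _ => ?_
  simp [two_smul, add_assoc]

/-- Sum Schur's inequality over the triples g(x), g(x + d), g(x + 2d). As p is odd, any two of the
three points are jointly uniform, so every mixed term equals (∑ g²)(∑ g), and Cauchy–Schwarz turns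
this into the cube of ∑ g. -/
theorem two_mul_cube_le_apSum (hp : Odd p) {g : G → ℝ} (h0 : ∀ x, 0 ≤ g x) :
    2 * (∑ x, g x) ^ 3 / Fintype.card G - Fintype.card G * ∑ x, g x ^ 3 ≤ apSum g := by
  have hG : (0 : ℝ) < Fintype.card G := by exact_mod_cast Fintype.card_pos
  have e01 : ∀ F F' : G → ℝ, ∑ x, ∑ d, F x * F' (x + d) = (∑ x, F x) * ∑ x, F' x := sum_sum_add
  have e02 : ∀ F F' : G → ℝ, ∑ x, ∑ d, F x * F' (x + 2 • d) = (∑ x, F x) * ∑ x, F' x :=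
    sum_sum_two_nsmul hp
  have e12 : ∀ F F' : G → ℝ,
      ∑ x, ∑ d, F (x + d) * F' (x + 2 • d) = (∑ x, F x) * ∑ x, F' x := sum_sum_add_two_nsmul
  have c0 : ∑ x, ∑ _d : G, g x ^ 3 = Fintype.card G * ∑ x, g x ^ 3 := by
    simp [Finset.mul_sum]
  have c1 : ∑ x, ∑ d, g (x + d) ^ 3 = Fintype.card G * ∑ x, g x ^ 3 := by
    have := e01 (fun _ => 1) (fun x => g x ^ 3)
    simpa using this
  have c2 : ∑ x, ∑ d, g (x + 2 • d) ^ 3 = Fintype.card G * ∑ x, g x ^ 3 := by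
    have := e02 (fun _ => 1) (fun x => g x ^ 3)
    simpa using this
  have hs : ∑ x : G, ∑ d : G, (g x ^ 2 * g (x + d) + g x ^ 2 * g (x + 2 • d)
        + g (x + d) ^ 2 * g x + g (x + d) ^ 2 * g (x + 2 • d)
        + g (x + 2 • d) ^ 2 * g x + g (x + 2 • d) ^ 2 * g (x + d))
      ≤ ∑ x : G, ∑ d : G, (g x ^ 3 + g (x + d) ^ 3 + g (x + 2 • d) ^ 3
        + 3 * (g x * g (x + d) * g (x + 2 • d))) :=
    Finset.sum_le_sum fun x _ => Finset.sum_le_sum fun d _ =>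
      schur_inequality (h0 _) (h0 _) (h0 _)
  simp only [Finset.sum_add_distrib, ← Finset.mul_sum] at hs
  rw [c0, c1, c2] at hs
  have i1 := e01 (fun x => g x ^ 2) g
  have i2 := e02 (fun x => g x ^ 2) g
  have i3 := e01 g (fun x => g x ^ 2)
  have i4 := e12 (fun x => g x ^ 2) g
  have i5 := e02 g (fun x => g x ^ 2)
  have i6 := e12 g (fun x => g x ^ 2)
  simp only [mul_comm (g _) (g _ ^ 2)] at i3 i5 i6
  simp only [← Finset.mul_sum] at i1 i2 i3 i4 i5 i6
  have hs' : 6 * ((∑ x, g x ^ 2) * ∑ x, g x) ≤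
      3 * (Fintype.card G * ∑ x, g x ^ 3) + 3 * apSum g := by
    unfold apSum
    linarith
  have hcs : (∑ x, g x) ^ 2 ≤ Fintype.card G * ∑ x, g x ^ 2 := by
    simpa using sq_sum_le_card_mul_sum_sq (s := univ) (f := g)
  have hS : 0 ≤ ∑ x, g x := Finset.sum_nonneg fun x _ => h0 x
  have : 2 * (∑ x, g x) ^ 3 / Fintype.card G ≤ 2 * ((∑ x, g x ^ 2) * ∑ x, g x) := by
    rw [div_le_iff₀ hG]
    nlinarith [mul_le_mul_of_nonneg_right hcs hS]
  linarith

end Schur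

/-! ### The mean-cube increment -/

section Increment

variable {p : ℕ} [Fact p.Prime] {H V : Type*} [AddCommGroup H] [Module (ZMod p) H] [Fintype H]
  [AddCommGroup V] [Module (ZMod p) V] [Fintype V]

/-- The mean of the cubes of the averages of `f` over the cosets of the image of `i`. -/
noncomputable def meanCube (i : H →ₗ[ZMod p] V) (f : V → ℝ) : ℝ :=
  (∑ x, ((∑ h, f (x + i h)) / Fintype.card H) ^ 3) / Fintype.card V

theorem finrank_le_finrank_ker_add_card (S : Finset (Module.Dual (ZMod p) H)) :
    ∃ K : Submodule (ZMod p) H, (∀ l ∈ S, ∀ h ∈ K, l h = 0) ∧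
      Module.finrank (ZMod p) H ≤ Module.finrank (ZMod p) K + S.card := by
  let L : H →ₗ[ZMod p] (S → ZMod p) := LinearMap.pi fun l => l.1
  refine ⟨LinearMap.ker L, ?_, ?_⟩
  · intro l hl h hh
    exact congrFun (LinearMap.mem_ker.1 hh) ⟨l, hl⟩
  · rw [← LinearMap.finrank_range_add_finrank_ker L, add_comm]
    have := Submodule.finrank_le (LinearMap.range L)
    rw [Module.finrank_fintype_fun_eq_card, Fintype.card_coe] at this
    omega

theorem sum_cosetAverage (K : Submodule (ZMod p) H) (g : H → ℝ) :
    ∑ x, cosetAverage K g x = ∑ x, g x := by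
  have hK : (Fintype.card K : ℝ) ≠ 0 := by exact_mod_cast Fintype.card_ne_zero
  unfold cosetAverage
  rw [← Finset.sum_div, Finset.sum_comm]
  have : ∀ k : K, ∑ x, g (x + k) = ∑ x, g x := fun k => Equiv.sum_comp (Equiv.addRight (k : H)) g
  simp_rw [this]
  simp [hK]

theorem sum_sum_translate (i : H →ₗ[ZMod p] V) (F : V → ℝ) :
    ∑ x, ∑ h, F (x + i h) = Fintype.card H * ∑ x, F x := by
  rw [Finset.sum_comm]
  have : ∀ h : H, ∑ x, F (x + i h) = ∑ x, F x := fun h => Equiv.sum_comp (Equiv.addRight (i h)) F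
  simp_rw [this]
  simp

/-- `K` is the common annihilator of the large spectra on all cosets of the image of `i`. There are
`p ^ (dim V - dim H)` cosets, each contributing at most `M` functionals, which gives the
codimension. The inequality is the Schur bound for the `K`-averages, averaged over all cosets. -/
theorem exists_meanCube_increment (hp : Odd p) (i : H →ₗ[ZMod p] V)
    (hi : Function.Injective i) {f : V → ℝ} (h0 : ∀ x, 0 ≤ f x) (h1 : ∀ x, f x ≤ 1)
    {η : ℝ} (hη : 0 < η) {M : ℕ} (hM : 1 / η ^ 2 < M + 1) :
    ∃ K : Submodule (ZMod p) H,
      Module.finrank (ZMod p) H ≤ Module.finrank (ZMod p) K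
        + p ^ (Module.finrank (ZMod p) V - Module.finrank (ZMod p) H) * M ∧
      2 * meanCube i f - meanCube (i ∘ₗ K.subtype) f - η
        ≤ (∑ d, ∑ x, f x * f (x + i d) * f (x + 2 • i d))
          / (Fintype.card H * Fintype.card V) := by
  have hH : (0 : ℝ) < Fintype.card H := by exact_mod_cast Fintype.card_pos
  have hV : (0 : ℝ) < Fintype.card V := by exact_mod_cast Fintype.card_pos
  let g : V → H → ℝ := fun x h => f (x + i h)
  let Q := V ⧸ LinearMap.range i
  -- One representative per coset suffices, by translation invariance of the large spectrum.
  let S : Finset (Module.Dual (ZMod p) H) :=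
    (univ : Finset Q).biUnion fun q => largeSpectrum η (g (Quotient.out q))
  have hSle : S.card ≤ p ^ (Module.finrank (ZMod p) V - Module.finrank (ZMod p) H) * M := by
    have hcard : (univ : Finset Q).card
        = p ^ (Module.finrank (ZMod p) V - Module.finrank (ZMod p) H) := by
      rw [Finset.card_univ, Module.card_eq_pow_finrank (K := ZMod p), ZMod.card]
      congr 1
      have := Submodule.finrank_quotient_add_finrank (LinearMap.range i)
      rw [LinearMap.finrank_range_of_inj hi] at this
      change Module.finrank (ZMod p) (V ⧸ LinearMap.range i) = _
      omega
    rw [← hcard]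
    refine Finset.card_biUnion_le_card_mul _ _ _ fun q _ => ?_
    have := card_largeSpectrum_le (p := p) hη (g := g (Quotient.out q)) (fun _ => h0 _)
      (fun _ => h1 _)
    have : ((largeSpectrum (p := p) η (g (Quotient.out q))).card : ℝ) < (M + 1 : ℕ) := by
      push_cast; linarith
    have := Nat.cast_lt.1 this
    omega
  obtain ⟨K, hKS, hKf⟩ := finrank_le_finrank_ker_add_card S
  refine ⟨K, hKf.trans (by omega), ?_⟩
  have hK0 : (0 : ℝ) < Fintype.card K := by exact_mod_cast Fintype.card_pos
  have hspec : ∀ x : V, ∀ l ∈ largeSpectrum (p := p) η (g x), ∀ h ∈ K, l h = 0 := by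
    intro x l hl
    refine hKS l ?_
    have hmem : -(Quotient.out (Submodule.Quotient.mk x : Q)) + x ∈ LinearMap.range i := by
      rw [← Submodule.Quotient.mk_eq_zero]
      rw [Submodule.Quotient.mk_add, Submodule.Quotient.mk_neg]
      have : (Submodule.Quotient.mk (Quotient.out (Submodule.Quotient.mk x : Q)) : Q)
        = Submodule.Quotient.mk x := Quotient.out_eq _
      rw [this]; simp
    obtain ⟨a, ha⟩ := hmem
    have hx : g x = fun h => g (Quotient.out (Submodule.Quotient.mk x : Q)) (h + a) := by
      funext h
      simp only [g, map_add, ha]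
      congr 1
      abel
    rw [hx, largeSpectrum_translate] at hl
    exact Finset.mem_biUnion.2 ⟨_, Finset.mem_univ _, hl⟩
  have hpt : ∀ x : V, 2 * (∑ h, g x h) ^ 3 / Fintype.card H
      - Fintype.card H * ∑ h, cosetAverage K (g x) h ^ 3 - η * (Fintype.card H : ℝ) ^ 2
      ≤ apSum (g x) := by
    intro x
    have a1 := abs_apSum_sub_le hp K hη.le (g := g x) (fun _ => h0 _) (fun _ => h1 _) (hspec x)
    have a2 := two_mul_cube_le_apSum hp (g := cosetAverage K (g x)) (fun h =>
      div_nonneg (Finset.sum_nonneg fun _ _ => h0 _) hK0.le)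
    rw [sum_cosetAverage] at a2
    have := (abs_le.1 a1).1
    linarith
  have hsum := Finset.sum_le_sum fun x (_ : x ∈ (univ : Finset V)) => hpt x
  have e1 : ∑ x, apSum (g x)
      = Fintype.card H * ∑ d, ∑ x, f x * f (x + i d) * f (x + 2 • i d) := by
    unfold apSum
    rw [Finset.sum_comm]
    have : ∀ h : H, ∑ x, ∑ d, g x h * g x (h + d) * g x (h + 2 • d)
        = ∑ d, ∑ x, f x * f (x + i d) * f (x + 2 • i d) := by
      intro h
      rw [Finset.sum_comm]
      refine Finset.sum_congr rfl fun d _ => ?_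
      rw [← Equiv.sum_comp (Equiv.addRight (i h)) (fun x => f x * f (x + i d) * f (x + 2 • i d))]
      refine Finset.sum_congr rfl fun x _ => ?_
      simp [g, add_assoc]
    simp_rw [this]
    simp
  have e2 : ∑ x, ∑ h, cosetAverage K (g x) h ^ 3
      = Fintype.card H * ∑ x, ((∑ k : K, f (x + i k)) / Fintype.card K) ^ 3 := by
    rw [← sum_sum_translate i]
    refine Finset.sum_congr rfl fun x _ => Finset.sum_congr rfl fun h _ => ?_
    simp [cosetAverage, g, add_assoc]
  rw [Finset.sum_sub_distrib, Finset.sum_sub_distrib, e1, ← Finset.mul_sum, e2] at hsum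
  have e3 : ∑ x, 2 * (∑ h, g x h) ^ 3 / (Fintype.card H : ℝ)
      = 2 * (Fintype.card H : ℝ) ^ 2 * ∑ x, ((∑ h, f (x + i h)) / Fintype.card H) ^ 3 := by
    rw [Finset.mul_sum]
    refine Finset.sum_congr rfl fun x _ => ?_
    simp only [g]
    field_simp
  rw [e3] at hsum
  unfold meanCube
  simp only [LinearMap.comp_apply, Submodule.subtype_apply]
  set A := ∑ x, ((∑ h, f (x + i h)) / (Fintype.card H : ℝ)) ^ 3
  set B := ∑ x, ((∑ k : K, f (x + i k)) / (Fintype.card K : ℝ)) ^ 3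
  set T := ∑ d, ∑ x, f x * f (x + i d) * f (x + 2 • i d)
  simp only [Finset.sum_const, Finset.card_univ, nsmul_eq_mul] at hsum
  rw [le_div_iff₀ (by positivity)]
  have : (Fintype.card H : ℝ) * ((2 * (A / Fintype.card V) - B / Fintype.card V - η)
      * (Fintype.card H * Fintype.card V)) ≤ Fintype.card H * T := by
    refine le_trans (le_of_eq ?_) hsum
    field_simp
  exact le_of_mul_le_mul_left this hH

end Increment

/-! ### Upper bound: iterating the increment -/

section Iteration

/-- The codimensions that occur when passing repeatedly to the kernel of the large spectrum. -/
def codimBound (p M : ℕ) : ℕ → ℕ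
  | 0 => 0
  | k + 1 => codimBound p M k + p ^ codimBound p M k * M

theorem codimBound_le_succ (p M k : ℕ) : codimBound p M k ≤ codimBound p M (k + 1) :=
  Nat.le_add_right _ _

variable {p : ℕ} [Fact p.Prime] {V : Type*} [AddCommGroup V] [Module (ZMod p) V] [Fintype V]

/-- Only d = 0 escapes the hypothesis. Its count is at most |V| ≤ (B + 2)|V|, whence the constant 2
when `B` may be as low as -1. -/
theorem sum_progressions_le {H : Type*} [AddCommGroup H] [Module (ZMod p) H] [Fintype H]
    (i : H →ₗ[ZMod p] V) (hi : Function.Injective i) {f : V → ℝ} (h0 : ∀ x, 0 ≤ f x)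
    (h1 : ∀ x, f x ≤ 1) {B : ℝ} (hB : -1 ≤ B)
    (hf : ∀ d : V, d ≠ 0 → ∑ x, f x * f (x + d) * f (x + 2 • d) ≤ B * Fintype.card V) :
    (∑ d, ∑ x, f x * f (x + i d) * f (x + 2 • i d)) / (Fintype.card H * Fintype.card V)
      ≤ B + 2 / Fintype.card H := by
  have hH : (0 : ℝ) < Fintype.card H := by exact_mod_cast Fintype.card_pos
  have hV : (0 : ℝ) < Fintype.card V := by exact_mod_cast Fintype.card_pos
  have hb : ∀ d : H, ∑ x, f x * f (x + i d) * f (x + 2 • i d)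
      ≤ B * Fintype.card V + if d = 0 then 2 * (Fintype.card V : ℝ) else 0 := by
    intro d
    split_ifs with hd
    · have : ∑ x, f x * f (x + i d) * f (x + 2 • i d) ≤ ∑ _x : V, (1 : ℝ) :=
        Finset.sum_le_sum fun x _ => mul_le_one₀ (mul_le_one₀ (h1 _) (h0 _) (h1 _)) (h0 _) (h1 _)
      simp only [sum_const, card_univ, nsmul_eq_mul, mul_one] at this
      nlinarith
    · rw [add_zero]
      exact hf _ fun h => hd (hi (by simpa using h))
  have := Finset.sum_le_sum fun d (_ : d ∈ (univ : Finset H)) => hb d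
  rw [Finset.sum_add_distrib, Finset.sum_ite_eq' univ (0 : H)] at this
  simp only [sum_const, card_univ, nsmul_eq_mul, mem_univ, if_true] at this
  rw [div_le_iff₀ (by positivity)]
  refine this.trans (le_of_eq ?_)
  field_simp

theorem meanCube_le_one {H : Type*} [AddCommGroup H] [Module (ZMod p) H] [Fintype H]
    (i : H →ₗ[ZMod p] V) {f : V → ℝ} (h0 : ∀ x, 0 ≤ f x) (h1 : ∀ x, f x ≤ 1) :
    meanCube i f ≤ 1 := by
  have hH : (0 : ℝ) < Fintype.card H := by exact_mod_cast Fintype.card_pos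
  have hV : (0 : ℝ) < Fintype.card V := by exact_mod_cast Fintype.card_pos
  unfold meanCube
  rw [div_le_one hV]
  calc _ ≤ ∑ _x : V, (1 : ℝ) := Finset.sum_le_sum fun x _ => by
        refine pow_le_one₀ (div_nonneg (Finset.sum_nonneg fun _ _ => h0 _) hH.le) ?_
        rw [div_le_one hH]
        calc _ ≤ ∑ _h : H, (1 : ℝ) := Finset.sum_le_sum fun h _ => h1 _
          _ = _ := by simp
    _ = _ := by simp

/-- Let e be the excess of the mean cube over α³. The increment with η = ε/4, together with 2/|H| ≤
ε/4 (ensured by `t`), gives e' ≥ 2e + ε/2, so e + ε/2 at least doubles at each step, starting from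
ε/2. -/
theorem exists_subspace_large_meanCube {V : Type} [AddCommGroup V] [Module (ZMod p) V] [Fintype V]
    (hp : Odd p) {f : V → ℝ} (h0 : ∀ x, 0 ≤ f x)
    (h1 : ∀ x, f x ≤ 1) {ε : ℝ} (hε : 0 < ε) (hε1 : ε ≤ 1) {t M : ℕ} (ht : 8 / ε ≤ (p : ℝ) ^ t)
    (hM : 16 / ε ^ 2 < M + 1)
    (hf : ∀ d : V, d ≠ 0 → ∑ x, f x * f (x + d) * f (x + 2 • d)
      ≤ (((∑ x, f x) / Fintype.card V) ^ 3 - ε) * Fintype.card V) (k : ℕ)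
    (hk : codimBound p M k + t ≤ Module.finrank (ZMod p) V) :
    ∃ (H : Type) (_ : AddCommGroup H) (_ : Module (ZMod p) H) (_ : Fintype H)
      (i : H →ₗ[ZMod p] V), Function.Injective i ∧
      Module.finrank (ZMod p) V ≤ Module.finrank (ZMod p) H + codimBound p M k ∧
      2 ^ k * (ε / 2) ≤ meanCube i f - ((∑ x, f x) / Fintype.card V) ^ 3 + ε / 2 := by
  have hV : (0 : ℝ) < Fintype.card V := by exact_mod_cast Fintype.card_pos
  induction k with
  | zero =>
    refine ⟨V, inferInstance, inferInstance, inferInstance, LinearMap.id, fun _ _ h => h, ?_, ?_⟩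
    · omega
    · have : ∀ x, ∑ h, f (x + h) = ∑ h, f h := fun x => Equiv.sum_comp (Equiv.addLeft x) f
      simp only [meanCube, LinearMap.id_apply, this, sum_const, card_univ, nsmul_eq_mul]
      rw [mul_div_cancel_left₀ _ hV.ne']
      simp
  | succ k ih =>
    obtain ⟨H, _, _, _, i, hi, hdim, hmean⟩ :=
      ih (le_trans (by have := codimBound_le_succ p M k; omega) hk)
    obtain ⟨K, hKdim, hK⟩ := exists_meanCube_increment hp i hi h0 h1 (η := ε / 4) (by positivity)
      (M := M) (by refine lt_of_eq_of_lt ?_ hM; field_simp; norm_num)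
    refine ⟨K, inferInstance, inferInstance, inferInstance, i ∘ₗ K.subtype,
      hi.comp Subtype.val_injective, ?_, ?_⟩
    · have h2 : p ^ (Module.finrank (ZMod p) V - Module.finrank (ZMod p) H)
          ≤ p ^ codimBound p M k :=
        Nat.pow_le_pow_right (Fact.out : p.Prime).pos (by omega)
      have := Nat.mul_le_mul_right M h2
      simp only [codimBound]
      omega
    · have hA : 0 ≤ ((∑ x, f x) / Fintype.card V) ^ 3 :=
        pow_nonneg (div_nonneg (Finset.sum_nonneg fun _ _ => h0 _) hV.le) _
      have h3 := sum_progressions_le i hi h0 h1 (by linarith) hf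
      have h4 : 2 / (Fintype.card H : ℝ) ≤ ε / 4 := by
        have hH : (0 : ℝ) < Fintype.card H := by exact_mod_cast Fintype.card_pos
        have hle : (p : ℝ) ^ t ≤ Fintype.card H := by
          rw [Module.card_eq_pow_finrank (K := ZMod p), ZMod.card]
          have : t ≤ Module.finrank (ZMod p) H := by
            have := codimBound_le_succ p M k
            omega
          exact_mod_cast Nat.pow_le_pow_right (Fact.out : p.Prime).pos this
        rw [div_le_iff₀ hH]
        have := ht.trans hle
        rw [div_le_iff₀ hε] at this
        linarith
      rw [pow_succ]
      linarith

theorem card_fun_zmod (n : ℕ) : Fintype.card (Fin n → ZMod p) = p ^ n := by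
  simp [ZMod.card]

theorem hasPopularDifferences_of_codimBound_le (hp : Odd p) {ε : ℝ} (hε : 0 < ε) (hε1 : ε ≤ 1)
    {k t M n : ℕ} (hk : 8 ≤ 2 ^ k * ε) (ht : 8 / ε ≤ (p : ℝ) ^ t) (hM : 16 / ε ^ 2 < M + 1)
    (hn : codimBound p M k + t ≤ n) : HasPopularDifferences p ε n := by
  intro A
  by_contra hcon
  push Not at hcon
  let f : (Fin n → ZMod p) → ℝ := fun x => if x ∈ A then 1 else 0
  have h0 : ∀ x, 0 ≤ f x := fun x => by simp only [f]; split_ifs <;> norm_num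
  have h1 : ∀ x, f x ≤ 1 := fun x => by simp only [f]; split_ifs <;> norm_num
  have hpn : (0 : ℝ) < (p : ℝ) ^ n := by
    have := (Fact.out : p.Prime).pos
    positivity
  have hcard : (Fintype.card (Fin n → ZMod p) : ℝ) = (p : ℝ) ^ n := by
    rw [card_fun_zmod]; push_cast; rfl
  have hdens : (∑ x, f x) / Fintype.card (Fin n → ZMod p) = setDensity p n A := by
    rw [hcard]
    simp [f, setDensity]
  have hap : ∀ d, ∑ x, f x * f (x + d) * f (x + 2 • d) = apDensity p n A d * (p : ℝ) ^ n := by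
    intro d
    unfold apDensity
    rw [div_mul_cancel₀ _ hpn.ne', Finset.card_filter, ← Finset.sum_filter_add_sum_filter_not univ (· ∈ A)]
    push_cast
    have e1 : ∑ x with x ∉ A, f x * f (x + d) * f (x + 2 • d) = 0 :=
      Finset.sum_eq_zero fun x hx => by simp [f, (Finset.mem_filter.1 hx).2]
    rw [e1, add_zero, Finset.filter_mem_eq_inter, Finset.univ_inter]
    refine Finset.sum_congr rfl fun x hx => ?_
    simp only [f, hx, if_true, one_mul, ite_and]
    split_ifs <;> simp
  obtain ⟨H, _, _, _, i, hi, -, hmean⟩ := exists_subspace_large_meanCube hp h0 h1 hε hε1 ht hM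
    (fun d hd => by rw [hdens, hap, hcard]; exact
      mul_le_mul_of_nonneg_right (hcon d hd).le hpn.le) k (by simpa using hn)
  have hA : 0 ≤ ((∑ x, f x) / Fintype.card (Fin n → ZMod p)) ^ 3 :=
    pow_nonneg (div_nonneg (Finset.sum_nonneg fun _ _ => h0 _) (by positivity)) _
  -- After `k` steps the left side of `hmean` is at least 4, while its right side is at most 1 +
  -- ε/2.
  have := meanCube_le_one i h0 h1
  linarith

end Iteration

/-! ### Comparison of the codimensions with towers -/

section Tower

theorem expTower_succ (p h : ℕ) : expTower p (h + 1) = p ^ expTower p h := rfl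

theorem expTower_mono {p : ℕ} (hp : 2 ≤ p) : Monotone (expTower p) :=
  monotone_nat_of_le_succ fun h => by
    rw [expTower_succ]
    exact (Nat.lt_pow_self hp).le

theorem two_mul_le_two_pow {a : ℕ} (ha : 1 ≤ a) : 2 * a ≤ 2 ^ a := by
  induction a, ha using Nat.le_induction with
  | base => norm_num
  | succ a ha ih =>
    rw [pow_succ]
    omega

theorem one_le_expTower {p : ℕ} (hp : 2 ≤ p) (h : ℕ) : 1 ≤ expTower p h :=
  expTower_mono hp (Nat.zero_le h)

theorem two_mul_expTower_le {p : ℕ} (hp : 2 ≤ p) (h : ℕ) :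
    2 * expTower p h ≤ expTower p (h + 1) :=
  (two_mul_le_two_pow (one_le_expTower hp h)).trans (Nat.pow_le_pow_left hp _)

theorem two_pow_le_expTower {p : ℕ} (hp : 2 ≤ p) (h : ℕ) : 2 ^ h ≤ expTower p h := by
  induction h with
  | zero => simp [expTower]
  | succ h ih =>
    have := two_mul_expTower_le hp h
    rw [pow_succ]
    omega

/-- Two tower levels per step: one for the exponential, one for the factor `M + 1` and the added
term. -/
theorem codimBound_le_expTower {p M j : ℕ} (hp : 2 ≤ p) (hM : M + 1 ≤ expTower p j) (k : ℕ) :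
    codimBound p M k ≤ expTower p (j + 2 * k) := by
  induction k with
  | zero => simp [codimBound]
  | succ k ih =>
    have hM' : M + 1 ≤ expTower p (j + 2 * k) := hM.trans (expTower_mono hp (by omega))
    rw [codimBound]
    calc codimBound p M k + p ^ codimBound p M k * M
        ≤ p ^ codimBound p M k + p ^ codimBound p M k * M :=
          Nat.add_le_add_right (Nat.lt_pow_self hp).le _
      _ = p ^ codimBound p M k * (M + 1) := by ring
      _ ≤ p ^ expTower p (j + 2 * k) * p ^ expTower p (j + 2 * k) := by
          refine Nat.mul_le_mul (Nat.pow_le_pow_right (by omega) ih) ?_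
          exact hM'.trans (Nat.lt_pow_self hp).le
      _ = p ^ (2 * expTower p (j + 2 * k)) := by rw [← pow_add, ← two_mul]
      _ ≤ p ^ expTower p (j + 2 * k + 1) :=
          Nat.pow_le_pow_right (by omega) (two_mul_expTower_le hp _)

/-- Height 2k accommodates `M + 1`, since 16/ε² is at most of order 4^k. The `k` steps cost 2k
further levels, and the last level absorbs t = k. -/
theorem hasPopularDifferences_of_expTower_le {p : ℕ} (hp : p.Prime) (hodd : Odd p) {ε : ℝ}
    (hε : 0 < ε) (hε1 : ε ≤ 1) {k n : ℕ} (hk : 8 ≤ 2 ^ k * ε)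
    (hn : expTower p (6 * k + 1) ≤ n) : HasPopularDifferences p ε n := by
  have : Fact p.Prime := ⟨hp⟩
  have h2 := hp.two_le
  have hpow : 8 / ε ≤ (2 : ℝ) ^ k := by rwa [div_le_iff₀ hε]
  have hp2 : (2 : ℝ) ^ k ≤ (p : ℝ) ^ k := by gcongr; exact_mod_cast h2
  have hM : (⌊16 / ε ^ 2⌋₊ : ℕ) + 1 ≤ expTower p (2 * k) := by
    refine le_trans ?_ (two_pow_le_expTower h2 _)
    have h3 : ((⌊16 / ε ^ 2⌋₊ : ℕ) : ℝ) ≤ 16 / ε ^ 2 := Nat.floor_le (by positivity)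
    have h4 : (1 : ℝ) ≤ 1 / ε ^ 2 := by
      rw [le_div_iff₀ (by positivity)]
      nlinarith
    have h5 : 64 / ε ^ 2 ≤ (2 : ℝ) ^ (2 * k) := by
      calc 64 / ε ^ 2 = (8 / ε) ^ 2 := by ring
        _ ≤ (2 ^ k) ^ 2 := by gcongr
        _ = _ := by ring
    have h6 : (16 : ℝ) / ε ^ 2 = 16 * (1 / ε ^ 2) := by ring
    have h7 : (64 : ℝ) / ε ^ 2 = 64 * (1 / ε ^ 2) := by ring
    have : (((⌊16 / ε ^ 2⌋₊ : ℕ) + 1 : ℕ) : ℝ) ≤ ((2 ^ (2 * k) : ℕ) : ℝ) := by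
      push_cast
      linarith
    exact_mod_cast this
  refine hasPopularDifferences_of_codimBound_le hodd hε hε1 hk (hpow.trans hp2)
    (Nat.lt_floor_add_one _) (le_trans ?_ hn)
  have h3 := codimBound_le_expTower h2 hM k
  have h4 := two_mul_expTower_le h2 (6 * k)
  have h5 : expTower p (2 * k + 2 * k) ≤ expTower p (6 * k) := expTower_mono h2 (by omega)
  have h6 : k ≤ expTower p (6 * k) :=
    (Nat.lt_two_pow_self).le.trans ((two_pow_le_expTower h2 k).trans (expTower_mono h2 (by omega)))
  omega

end Tower

/-! ### A mean-one weight on 𝔽_p with few progressions -/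

section Weight

/-- The interval `{1, …, ⌊p/3⌋}` of `𝔽_p`. -/
def thirdInterval (p : ℕ) [NeZero p] : Finset (ZMod p) :=
  univ.filter fun t => 1 ≤ t.val ∧ t.val ≤ p / 3

/-- The normalised indicator function of the complement of `thirdInterval p`. -/
noncomputable def gapWeight (p : ℕ) [NeZero p] (t : ZMod p) : ℝ :=
  if t ∈ thirdInterval p then 0 else p / (p - (p / 3 : ℕ))

variable {p : ℕ} [Fact p.Prime]

/-- Splitting the interval into a even and b odd numbers gives a² + b² such pairs, and 2(a² + b²) ≥
(a + b)². -/
theorem card_pairs_same_parity (L : ℕ) :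
    L ^ 2 ≤ 2 * (((Icc 1 L) ×ˢ (Icc 1 L)).filter fun x => x.1 % 2 = x.2 % 2).card := by
  have h : (((Icc 1 L) ×ˢ (Icc 1 L)).filter fun x => x.1 % 2 = x.2 % 2)
      = ((Icc 1 L).filter (· % 2 = 0) ×ˢ (Icc 1 L).filter (· % 2 = 0)) ∪
        ((Icc 1 L).filter (¬ · % 2 = 0) ×ˢ (Icc 1 L).filter (¬ · % 2 = 0)) := by
    ext ⟨a, b⟩
    simp only [mem_filter, mem_product, mem_union]
    constructor
    · rintro ⟨⟨ha, hb⟩, h⟩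
      by_cases h0 : a % 2 = 0
      · exact Or.inl ⟨⟨ha, h0⟩, hb, by omega⟩
      · exact Or.inr ⟨⟨ha, h0⟩, hb, by omega⟩
    · rintro (⟨⟨ha, h1⟩, hb, h2⟩ | ⟨⟨ha, h1⟩, hb, h2⟩)
      · exact ⟨⟨ha, hb⟩, by omega⟩
      · exact ⟨⟨ha, hb⟩, by omega⟩
  have hd : Disjoint ((Icc 1 L).filter (· % 2 = 0) ×ˢ (Icc 1 L).filter (· % 2 = 0))
      ((Icc 1 L).filter (¬ · % 2 = 0) ×ˢ (Icc 1 L).filter (¬ · % 2 = 0)) := by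
    rw [Finset.disjoint_left]
    rintro ⟨a, b⟩ h1 h2
    simp only [mem_product, mem_filter] at h1 h2
    exact h2.1.2 h1.1.2
  rw [h, card_union_of_disjoint hd, card_product, card_product]
  have hs := Finset.card_filter_add_card_filter_not (s := Icc 1 L) (fun x => x % 2 = 0)
  rw [Nat.card_Icc, Nat.add_sub_cancel] at hs
  generalize ((Icc 1 L).filter (· % 2 = 0)).card = a at *
  generalize ((Icc 1 L).filter (¬ · % 2 = 0)).card = b at *
  subst hs
  zify
  nlinarith [sq_nonneg ((a : ℤ) - b)]

theorem cast_mem_thirdInterval {i : ℕ} (h : i ∈ Icc 1 (p / 3)) :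
    (i : ZMod p) ∈ thirdInterval p := by
  have hp := (Fact.out : p.Prime).two_le
  rw [mem_Icc] at h
  simp only [thirdInterval, mem_filter, mem_univ, true_and]
  rw [ZMod.val_natCast, Nat.mod_eq_of_lt (by omega)]
  exact h

theorem cast_injOn_Icc {i j : ℕ} (hi : i ∈ Icc 1 (p / 3)) (hj : j ∈ Icc 1 (p / 3))
    (h : (i : ZMod p) = j) : i = j := by
  have hp := (Fact.out : p.Prime).two_le
  rw [mem_Icc] at hi hj
  have := congrArg ZMod.val h
  rwa [ZMod.val_natCast, ZMod.val_natCast, Nat.mod_eq_of_lt (by omega),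
    Nat.mod_eq_of_lt (by omega)] at this

theorem card_thirdInterval : (thirdInterval p).card = p / 3 := by
  have h : thirdInterval p = (Icc 1 (p / 3)).image (Nat.cast : ℕ → ZMod p) := by
    ext t
    rw [mem_image]
    constructor
    · intro ht
      simp only [thirdInterval, mem_filter, mem_univ, true_and] at ht
      exact ⟨t.val, mem_Icc.2 ht, ZMod.natCast_zmod_val t⟩
    · rintro ⟨i, hi, rfl⟩
      exact cast_mem_thirdInterval hi
  rw [h, card_image_of_injOn fun i hi j hj => cast_injOn_Icc hi hj, Nat.card_Icc,
    Nat.add_sub_cancel]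

/-- Two endpoints of equal parity have an integer midpoint in the interval, and so determine a
progression inside it. -/
theorem sq_le_card_progressions :
    (p / 3) ^ 2 ≤ 2 * ((univ : Finset (ZMod p × ZMod p)).filter fun x =>
      x.1 ∈ thirdInterval p ∧ x.1 + x.2 ∈ thirdInterval p ∧
        x.1 + 2 • x.2 ∈ thirdInterval p).card := by
  refine (card_pairs_same_parity _).trans (Nat.mul_le_mul_left _ ?_)
  have key : ∀ x ∈ ((Icc 1 (p / 3)) ×ˢ (Icc 1 (p / 3))).filter (fun x => x.1 % 2 = x.2 % 2),
      (x.1 : ZMod p) + 2 • ((((x.1 + x.2) / 2 : ℕ) : ZMod p) - x.1) = x.2 := by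
    rintro ⟨i, j⟩ hx
    simp only [mem_filter] at hx
    have h2 : 2 * ((i + j) / 2) = i + j := by omega
    have h3 : (2 : ZMod p) * (((i + j) / 2 : ℕ) : ZMod p) = i + j := by
      exact_mod_cast congrArg (Nat.cast : ℕ → ZMod p) h2
    rw [nsmul_eq_mul]
    push_cast at h3 ⊢
    linear_combination h3
  refine Finset.card_le_card_of_injOn
    (fun x => ((x.1 : ZMod p), (((x.1 + x.2) / 2 : ℕ) : ZMod p) - x.1)) ?_ ?_
  · rintro ⟨i, j⟩ hx
    have hk := key _ hx
    simp only [coe_filter, mem_product, Set.mem_ofPred_eq, mem_Icc] at hx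
    simp only [coe_filter, mem_univ, true_and, Set.mem_ofPred_eq]
    refine ⟨cast_mem_thirdInterval (mem_Icc.2 (by omega)), ?_, ?_⟩
    · rw [add_sub_cancel]
      exact cast_mem_thirdInterval (mem_Icc.2 (by omega))
    · simp only at hk
      rw [hk]
      exact cast_mem_thirdInterval (mem_Icc.2 (by omega))
  · intro x hx y hy hxy
    have hkx := key x hx
    have hky := key y hy
    simp only [coe_filter, mem_product, Set.mem_ofPred_eq] at hx hy
    simp only [Prod.mk.injEq] at hxy
    rw [hxy.2, hxy.1, hky] at hkx
    exact Prod.ext (cast_injOn_Icc hx.1.1 hy.1.1 hxy.1) (cast_injOn_Icc hx.1.2 hy.1.2 hkx.symm)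

/-- The common nonzero value of `gapWeight p`. -/
noncomputable def gapHeight (p : ℕ) : ℝ := p / (p - (p / 3 : ℕ))

/-- The bound p ≤ 5⌊p/3⌋ is attained at p = 5; it says that the interval has density at least 1/5,
and it decides the constant 1/150 below. -/
theorem gapHeight_bounds (hp : Odd p) :
    1 ≤ gapHeight p ∧ gapHeight p ≤ 3 / 2 ∧ 0 < (p : ℝ) - (p / 3 : ℕ) ∧
      (p : ℝ) ≤ 5 * (p / 3 : ℕ) ∧ 3 * ((p / 3 : ℕ) : ℝ) ≤ p := by
  have hp2 := (Fact.out : p.Prime).two_le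
  have hp3 : 3 ≤ p := by
    rcases hp with ⟨k, hk⟩
    omega
  have h1 : 3 * ((p / 3 : ℕ) : ℝ) ≤ p := by exact_mod_cast (by omega : 3 * (p / 3) ≤ p)
  have h2 : (p : ℝ) ≤ 5 * (p / 3 : ℕ) := by
    exact_mod_cast (by rcases hp with ⟨k, hk⟩; omega : p ≤ 5 * (p / 3))
  have h3 : (3 : ℝ) ≤ p := by exact_mod_cast hp3
  have h4 : 0 < (p : ℝ) - (p / 3 : ℕ) := by linarith
  refine ⟨?_, ?_, h4, h2, h1⟩
  · rw [gapHeight, le_div_iff₀ h4]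
    have : (0 : ℝ) ≤ (p / 3 : ℕ) := by positivity
    linarith
  · rw [gapHeight, div_le_iff₀ h4]
    linarith

theorem gapWeight_eq (t : ZMod p) :
    gapWeight p t = gapHeight p * (1 - if t ∈ thirdInterval p then 1 else 0) := by
  unfold gapWeight gapHeight
  split_ifs <;> simp

theorem gapWeight_zero : gapWeight p 0 = gapHeight p := by
  simp [gapWeight_eq, thirdInterval]

theorem gapWeight_eq_or (t : ZMod p) : gapWeight p t = 0 ∨ gapWeight p t = gapHeight p := by
  unfold gapWeight gapHeight
  split_ifs <;> simp

theorem gapWeight_nonneg (hp : Odd p) (t : ZMod p) : 0 ≤ gapWeight p t := by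
  have := (gapHeight_bounds hp).1
  rcases gapWeight_eq_or t with h | h <;> rw [h]
  linarith

theorem gapWeight_le (hp : Odd p) (t : ZMod p) : gapWeight p t ≤ 3 / 2 := by
  have := (gapHeight_bounds hp).2.1
  rcases gapWeight_eq_or t with h | h <;> rw [h]
  · norm_num
  · exact this

theorem sum_indicator_thirdInterval :
    ∑ t : ZMod p, (if t ∈ thirdInterval p then (1 : ℝ) else 0) = (p / 3 : ℕ) := by
  rw [Finset.sum_boole, Finset.filter_mem_eq_inter, Finset.univ_inter, card_thirdInterval]

theorem sum_gapWeight (hp : Odd p) : ∑ t, gapWeight p t = p := by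
  obtain ⟨-, -, h, -, -⟩ := gapHeight_bounds hp
  simp_rw [gapWeight_eq, ← Finset.mul_sum, Finset.sum_sub_distrib, sum_indicator_thirdInterval]
  simp only [sum_const, card_univ, ZMod.card, nsmul_eq_mul, mul_one]
  rw [gapHeight, div_mul_cancel₀ _ h.ne']

/-- Let β be the density of the interval and Λ its progression density. Inclusion–exclusion shows
that the normalised complement has progression density 1 + (β³ - Λ)/(1 - β)³. Since Λ ≥ β²/2 and 1/5
≤ β ≤ 1/3, the deficit is at least β²/6 ≥ 1/150. -/
theorem apSum_gapWeight_le (hp : Odd p) : apSum (gapWeight p) ≤ (1 - 1 / 150) * (p : ℝ) ^ 2 := by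
  obtain ⟨h1, -, h, h5, h3⟩ := gapHeight_bounds hp
  let b : ZMod p → ℝ := fun t => if t ∈ thirdInterval p then 1 else 0
  have hb : ∑ t, b t = (p / 3 : ℕ) := sum_indicator_thirdInterval
  have e01 := sum_sum_add b b
  have e02 := sum_sum_two_nsmul (p := p) hp b b
  have e12 := sum_sum_add_two_nsmul b b
  have c0 : ∑ x, ∑ _d : ZMod p, b x = p * ∑ x, b x := by
    simp [Finset.mul_sum, ZMod.card]
  have c1 : ∑ x, ∑ d, b (x + d) = p * ∑ x, b x := by
    have := sum_sum_add (fun _ => 1) b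
    simpa [ZMod.card] using this
  have c2 : ∑ x, ∑ d, b (x + 2 • d) = p * ∑ x, b x := by
    have := sum_sum_two_nsmul (p := p) hp (fun _ => 1) b
    simpa [ZMod.card] using this
  have hB : ((p / 3 : ℕ) : ℝ) ^ 2 ≤ 2 * apSum b := by
    have e : apSum b = (((univ : Finset (ZMod p × ZMod p)).filter fun x =>
        x.1 ∈ thirdInterval p ∧ x.1 + x.2 ∈ thirdInterval p ∧
          x.1 + 2 • x.2 ∈ thirdInterval p).card : ℝ) := by
      rw [Finset.card_filter, Fintype.sum_prod_type]
      push_cast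
      unfold apSum
      refine Finset.sum_congr rfl fun x _ => Finset.sum_congr rfl fun d _ => ?_
      simp only [b, ite_and]
      split_ifs <;> simp
    rw [e]
    exact_mod_cast sq_le_card_progressions
  have e : apSum (gapWeight p) = gapHeight p ^ 3 * ((p : ℝ) ^ 2 - 3 * (p * (p / 3 : ℕ))
      + 3 * ((p / 3 : ℕ) * (p / 3 : ℕ)) - apSum b) := by
    have : ∀ x d : ZMod p, gapWeight p x * gapWeight p (x + d) * gapWeight p (x + 2 • d)
        = gapHeight p ^ 3 * (1 - b x - b (x + d) - b (x + 2 • d) + b x * b (x + d)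
          + b x * b (x + 2 • d) + b (x + d) * b (x + 2 • d)
          - b x * b (x + d) * b (x + 2 • d)) := by
      intro x d
      simp only [gapWeight_eq, b]
      ring
    unfold apSum
    have h0 : ∑ _x : ZMod p, ∑ _d : ZMod p, (1 : ℝ) = (p : ℝ) ^ 2 := by
      simp [ZMod.card, sq]
    simp_rw [this, ← Finset.mul_sum]
    simp only [Finset.sum_sub_distrib, Finset.sum_add_distrib]
    rw [h0, c0, c1, c2, e01, e02, e12, hb]
    ring
  rw [e]
  set L : ℝ := ((p / 3 : ℕ) : ℝ)
  set κ := gapHeight p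
  have hκ : κ * (p - L) = p := by simp only [κ, gapHeight]; exact div_mul_cancel₀ _ h.ne'
  have hκ3 : 1 ≤ κ ^ 3 := one_le_pow₀ h1
  have hp0 : (0 : ℝ) < p := by exact_mod_cast (Fact.out : p.Prime).pos
  have hL : 0 ≤ L := by positivity
  have hneg : L ^ 3 - p * apSum b ≤ -(p * L ^ 2 / 6) := by
    nlinarith [mul_le_mul_of_nonneg_left hB hp0.le, mul_le_mul_of_nonneg_right h3 (sq_nonneg L)]
  have h6 : κ ^ 3 * (L ^ 3 - p * apSum b) ≤ -(p * L ^ 2 / 6) := by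
    have : 0 ≤ p * L ^ 2 / 6 := by positivity
    nlinarith
  have h7 : (p : ℝ) ^ 2 ≤ 25 * L ^ 2 := by nlinarith
  have h8 : κ ^ 3 * (p - L) ^ 3 = (p : ℝ) ^ 3 := by rw [← mul_pow, hκ]
  refine le_of_mul_le_mul_left ?_ hp0
  nlinarith [mul_le_mul_of_nonneg_left h7 hp0.le]

end Weight

/-! ### Equidistribution of linear functionals -/

section Fibers

theorem card_mul_sum_comp_surjective {A B : Type*} [AddCommGroup A] [Fintype A] [AddCommGroup B]
    [Fintype B] {L : A →+ B} (hL : Function.Surjective L) (F : B → ℝ) :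
    (Fintype.card B : ℝ) * ∑ a, F (L a) = Fintype.card A * ∑ b, F b := by
  have h : ∀ b : B, ∑ a, F (L a + b) = ∑ a, F (L a) := by
    intro b
    obtain ⟨a, rfl⟩ := hL b
    simp_rw [← map_add]
    exact Equiv.sum_comp (Equiv.addRight a) fun x => F (L x)
  calc (Fintype.card B : ℝ) * ∑ a, F (L a) = ∑ b : B, ∑ a, F (L a + b) := by
        simp_rw [h]
        simp
    _ = ∑ a : A, ∑ b, F (L a + b) := Finset.sum_comm
    _ = _ := by
        have : ∀ a, ∑ b, F (L a + b) = ∑ b, F b := fun a => Equiv.sum_comp (Equiv.addLeft (L a)) F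
        simp_rw [this]
        simp

variable {p : ℕ} [Fact p.Prime] {W : Type*} [AddCommGroup W] [Module (ZMod p) W] [Fintype W]

theorem sum_comp_functional {l : Module.Dual (ZMod p) W} (hl : l ≠ 0) (F : ZMod p → ℝ) :
    ∑ w, F (l w) = Fintype.card W * ((∑ t, F t) / p) := by
  have hp : (p : ℝ) ≠ 0 := by exact_mod_cast (Fact.out : p.Prime).ne_zero
  have := card_mul_sum_comp_surjective (L := l.toAddMonoidHom)
    (LinearMap.surjective_of_ne_zero hl) F
  rw [ZMod.card] at this
  field_simp
  rw [mul_comm]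
  exact this

-- A nonzero functional vanishing on the range would be a linear relation among the `l j`.
omit [Fintype W] in
theorem surjective_pi_of_linearIndependent {ι : Type*} [Fintype ι]
    {l : ι → Module.Dual (ZMod p) W} (hl : LinearIndependent (ZMod p) l) :
    Function.Surjective (LinearMap.pi l : W →ₗ[ZMod p] ι → ZMod p) := by
  rw [← LinearMap.range_eq_top]
  by_contra h
  obtain ⟨φ, hφ, hle⟩ := Submodule.exists_le_ker_of_lt_top _ (lt_top_iff_ne_top.2 h)
  apply hφ
  have hsum : ∑ j, φ (Pi.single j 1) • l j = 0 := by
    ext w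
    have h1 : φ (LinearMap.pi l w) = 0 := hle (LinearMap.mem_range_self _ w)
    rw [LinearMap.pi_apply_eq_sum_univ φ] at h1
    simp only [LinearMap.sum_apply, LinearMap.smul_apply, LinearMap.zero_apply]
    rw [← h1]
    refine Finset.sum_congr rfl fun j _ => ?_
    have : (Pi.single j 1 : ι → ZMod p) = fun k => if j = k then 1 else 0 := by
      ext k
      simp [Pi.single_apply, eq_comm]
    rw [this, smul_eq_mul, smul_eq_mul, mul_comm]
    rfl
  have h0 := Fintype.linearIndependent_iff.1 hl _ hsum
  ext j
  simpa using h0 j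

theorem sum_prod_functionals {ι : Type*} [Fintype ι] {l : ι → Module.Dual (ZMod p) W}
    (hl : LinearIndependent (ZMod p) l) (F : ι → ZMod p → ℝ) :
    ∑ w, ∏ j, F j (l j w) = Fintype.card W * ∏ j, ((∑ t, F j t) / p) := by
  have hp : (p : ℝ) ≠ 0 := by exact_mod_cast (Fact.out : p.Prime).ne_zero
  have h := card_mul_sum_comp_surjective
    (L := (LinearMap.pi l : W →ₗ[ZMod p] ι → ZMod p).toAddMonoidHom)
    (surjective_pi_of_linearIndependent hl) (fun z => ∏ j, F j (z j))
  have h2 : ∑ z : ι → ZMod p, ∏ j, F j (z j) = ∏ j, ∑ t, F j t := by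
    rw [Finset.prod_univ_sum, Fintype.piFinset_univ]
  rw [h2] at h
  have hc : (Fintype.card (ι → ZMod p) : ℝ) = (p : ℝ) ^ Fintype.card ι := by
    simp [ZMod.card]
  rw [hc] at h
  rw [Finset.prod_div_distrib, Finset.prod_const, Finset.card_univ]
  have : (p : ℝ) ^ Fintype.card ι ≠ 0 := pow_ne_zero _ hp
  field_simp
  rw [mul_comm]
  exact h

end Fibers

/-! ### Perturbing a function along the fibres of V × W -/

section Extension

variable {p : ℕ} [Fact p.Prime] {V W : Type*} [AddCommGroup V] [Fintype V]
  [AddCommGroup W] [Module (ZMod p) W] [Fintype W]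

theorem sum_gapWeight_add_div (hp : Odd p) (s : ZMod p) :
    (∑ t, gapWeight p (t + s)) / p = 1 := by
  have hp0 : (p : ℝ) ≠ 0 := by exact_mod_cast (Fact.out : p.Prime).ne_zero
  have : ∑ t, gapWeight p (t + s) = ∑ t, gapWeight p t :=
    Equiv.sum_comp (Equiv.addRight s) (gapWeight p)
  rw [this, sum_gapWeight hp, div_self hp0]

/-- The number of three-term progressions with common difference `d`, weighted by `f`. -/
def apSumAt {V : Type*} [AddCommGroup V] [Fintype V] (f : V → ℝ) (d : V) : ℝ :=
  ∑ x, f x * f (x + d) * f (x + 2 • d)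

/-- The function on `V × W` obtained from `f` by multiplying it, on the fibre of each point `x` of
`X`, by a gap weight in the direction of the functional `v x`. -/
noncomputable def perturb (f : V → ℝ) (X : Finset V) (v : V → Module.Dual (ZMod p) W)
    (x : V × W) : ℝ :=
  f x.1 * if x.1 ∈ X then gapWeight p (v x.1 x.2) else 1

/-- The functionals attached to the points of `X` on the progression `x, x + a, x + 2a` are
linearly independent. -/
def IndepAlong (X : Finset V) (v : V → Module.Dual (ZMod p) W) (a x : V) : Prop :=
  LinearIndependent (ZMod p)
    fun j : {j : Fin 3 // x + (j : ℕ) • a ∈ X} => v (x + (j : ℕ) • a)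

variable {f : V → ℝ} {X : Finset V} {v : V → Module.Dual (ZMod p) W} {c : ℝ}

omit [AddCommGroup V] [Fintype V] [Fintype W] in
theorem perturb_nonneg (hp : Odd p) (h0 : ∀ x, 0 ≤ f x) (x : V × W) : 0 ≤ perturb f X v x := by
  unfold perturb
  refine mul_nonneg (h0 _) ?_
  split_ifs
  · exact gapWeight_nonneg hp _
  · norm_num

omit [AddCommGroup V] [Fintype V] [Fintype W] in
theorem perturb_le_two (hp : Odd p) (h2 : ∀ x, f x ≤ 2) (hc0 : 0 ≤ c) (hc : c ≤ 4 / 3)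
    (hX : ∀ x ∈ X, f x = c) (x : V × W) : perturb f X v x ≤ 2 := by
  unfold perturb
  split_ifs with h
  · rw [hX _ h]
    have := gapWeight_le hp (v x.1 x.2)
    have := gapWeight_nonneg hp (v x.1 x.2)
    nlinarith
  · simpa using h2 _

-- Over a point with `v x ≠ 0` the weight has mean exactly 1. Over a point with `v x = 0` it is the
-- constant `gapHeight p ≥ 1`, which is why only an inequality is maintained.
omit [AddCommGroup V] in
theorem card_le_sum_perturb (hp : Odd p) (h0 : ∀ x, 0 ≤ f x)
    (h : (Fintype.card V : ℝ) ≤ ∑ x, f x) :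
    (Fintype.card (V × W) : ℝ) ≤ ∑ x, perturb f X v x := by
  have hp0 : (p : ℝ) ≠ 0 := by exact_mod_cast (Fact.out : p.Prime).ne_zero
  rw [Fintype.sum_prod_type]
  have hx : ∀ x : V, f x * Fintype.card W ≤ ∑ w, perturb f X v (x, w) := by
    intro x
    simp only [perturb]
    rw [← Finset.mul_sum]
    refine mul_le_mul_of_nonneg_left ?_ (h0 x)
    split_ifs with hxX
    · by_cases hv : v x = 0
      · simp only [hv, LinearMap.zero_apply, gapWeight_zero, sum_const, card_univ, nsmul_eq_mul]
        exact le_mul_of_one_le_right (by positivity) (gapHeight_bounds hp).1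
      · rw [sum_comp_functional hv, sum_gapWeight hp, div_self hp0, mul_one]
    · simp
  rw [Fintype.card_prod]
  push_cast
  calc (Fintype.card V : ℝ) * Fintype.card W ≤ (∑ x, f x) * Fintype.card W := by gcongr
    _ = ∑ x, f x * Fintype.card W := Finset.sum_mul _ _ _
    _ ≤ _ := Finset.sum_le_sum fun x _ => hx x

omit [AddCommGroup V] in
theorem sum_perturb_cube_le (hp : Odd p) (h0 : ∀ x, 0 ≤ f x) (h2 : ∀ x, f x ≤ 2) (hc0 : 0 ≤ c)
    (hc : c ≤ 4 / 3) (hX : ∀ x ∈ X, f x = c) :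
    ∑ x, perturb f X v x ^ 3 ≤ (∑ x, f x ^ 3 + 8 * X.card) * Fintype.card W := by
  rw [Fintype.sum_prod_type, add_mul, Finset.sum_mul]
  have h8 : 8 * (X.card : ℝ) * Fintype.card W
      = ∑ x : V, if x ∈ X then 8 * (Fintype.card W : ℝ) else 0 := by
    rw [Finset.sum_ite_mem, Finset.univ_inter]
    simp
    ring
  rw [h8, ← Finset.sum_add_distrib]
  refine Finset.sum_le_sum fun x _ => ?_
  have hW : ∀ z : ℝ, z * Fintype.card W = ∑ _w : W, z := fun z => by simp [mul_comm]
  split_ifs with h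
  · have : ∑ w : W, perturb f X v (x, w) ^ 3 ≤ ∑ _w : W, (8 : ℝ) := by
      refine Finset.sum_le_sum fun w _ => ?_
      have := pow_le_pow_left₀ (perturb_nonneg hp h0 (x, w))
        (perturb_le_two (v := v) hp h2 hc0 hc hX (x, w)) 3
      norm_num at this
      exact this
    rw [← hW] at this
    have : 0 ≤ f x ^ 3 * Fintype.card W := mul_nonneg (pow_nonneg (h0 x) 3) (by positivity)
    linarith
  · rw [add_zero, hW]
    simp [perturb, h]

/-- Where the functionals are independent, the shifted weights are independent of mean 1 whatever
`e` is, so the fibre contributes what it did before. Elsewhere the trivial bound 2³ is used. -/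
theorem apSumAt_perturb_le (hp : Odd p) (h0 : ∀ x, 0 ≤ f x) (h2 : ∀ x, f x ≤ 2) (hc0 : 0 ≤ c)
    (hc : c ≤ 4 / 3) (hX : ∀ x ∈ X, f x = c) (a : V) (e : W) :
    apSumAt (perturb f X v) (a, e)
      ≤ (apSumAt f a + 8 * (univ.filter fun x => ¬ IndepAlong X v a x).card)
        * Fintype.card W := by
  have hp0 : (p : ℝ) ≠ 0 := by exact_mod_cast (Fact.out : p.Prime).ne_zero
  unfold apSumAt
  rw [Fintype.sum_prod_type, add_mul, Finset.sum_mul]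
  have h8 : 8 * ((univ.filter fun x => ¬ IndepAlong X v a x).card : ℝ) * Fintype.card W
      = ∑ x : V, if ¬ IndepAlong X v a x then 8 * (Fintype.card W : ℝ) else 0 := by
    rw [← Finset.sum_filter]
    simp
    ring
  rw [h8, ← Finset.sum_add_distrib]
  refine Finset.sum_le_sum fun x _ => ?_
  have hW : ∀ z : ℝ, z * Fintype.card W = ∑ _w : W, z := fun z => by simp [mul_comm]
  have hfnn : 0 ≤ f x * f (x + a) * f (x + 2 • a) :=
    mul_nonneg (mul_nonneg (h0 _) (h0 _)) (h0 _)
  by_cases h : ¬ IndepAlong X v a x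
  · rw [if_pos h]
    have hb : ∑ w : W, perturb f X v (x, w) * perturb f X v ((x, w) + (a, e))
        * perturb f X v ((x, w) + 2 • (a, e)) ≤ ∑ _w : W, (8 : ℝ) := by
      refine Finset.sum_le_sum fun w _ => ?_
      have n := perturb_nonneg (X := X) (v := v) hp h0
      have u := perturb_le_two (v := v) hp h2 hc0 hc hX
      calc _ ≤ (2 : ℝ) * 2 * 2 := by
            gcongr
            · exact n _
            · exact n _
            · exact u _
            · exact u _
            · exact u _
        _ = 8 := by norm_num
    rw [← hW] at hb
    have : 0 ≤ f x * f (x + a) * f (x + 2 • a) * Fintype.card W := mul_nonneg hfnn (by positivity)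
    linarith
  · rw [if_neg h, add_zero]
    rw [not_not] at h
    have hterm : ∀ w : W, perturb f X v (x, w) * perturb f X v ((x, w) + (a, e))
        * perturb f X v ((x, w) + 2 • (a, e)) = f x * f (x + a) * f (x + 2 • a) *
          ∏ j : {j : Fin 3 // x + (j : ℕ) • a ∈ X},
            gapWeight p (v (x + (j : ℕ) • a) w + v (x + (j : ℕ) • a) ((j : ℕ) • e)) := by
      intro w
      have hprod : ∏ j : {j : Fin 3 // x + (j : ℕ) • a ∈ X},
            gapWeight p (v (x + (j : ℕ) • a) w + v (x + (j : ℕ) • a) ((j : ℕ) • e))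
          = ∏ j : Fin 3, if x + (j : ℕ) • a ∈ X then
              gapWeight p (v (x + (j : ℕ) • a) w + v (x + (j : ℕ) • a) ((j : ℕ) • e)) else 1 := by
        rw [← Finset.prod_filter]
        exact (Finset.prod_subtype (univ.filter fun j : Fin 3 => x + (j : ℕ) • a ∈ X)
          (fun j => by simp) (fun j => gapWeight p (v (x + (j : ℕ) • a) w
            + v (x + (j : ℕ) • a) ((j : ℕ) • e)))).symm
      rw [hprod, Fin.prod_univ_three]
      simp only [perturb, Prod.mk_add_mk, Prod.smul_mk, Fin.val_zero, Fin.val_one, Fin.val_two,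
        zero_smul, one_smul, add_zero, map_add, map_zero]
      ring
    simp_rw [hterm]
    rw [← Finset.mul_sum]
    refine mul_le_mul_of_nonneg_left (le_of_eq ?_) hfnn
    rw [sum_prod_functionals h (fun j t =>
      gapWeight p (t + v (x + (j : ℕ) • a) ((j : ℕ) • e)))]
    rw [Finset.prod_congr rfl fun j _ => sum_gapWeight_add_div hp _, Finset.prod_const_one,
      mul_one]

/-- The density of progressions of `gapWeight p` with common difference `t`. -/
noncomputable def gapCorrelation (p : ℕ) [NeZero p] (t : ZMod p) : ℝ :=
  (∑ s, gapWeight p s * gapWeight p (s + t) * gapWeight p (s + 2 • t)) / p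

theorem gapWeight_mul_le (hp : Odd p) (s t u : ZMod p) :
    gapWeight p s * gapWeight p t * gapWeight p u ≤ 4 := by
  calc _ ≤ (3 / 2 : ℝ) * (3 / 2) * (3 / 2) := by
        gcongr
        · exact gapWeight_nonneg hp _
        · exact gapWeight_nonneg hp _
        all_goals exact gapWeight_le hp _
    _ ≤ 4 := by norm_num

theorem gapCorrelation_nonneg (hp : Odd p) (t : ZMod p) : 0 ≤ gapCorrelation p t :=
  div_nonneg (Finset.sum_nonneg fun _ _ => mul_nonneg (mul_nonneg (gapWeight_nonneg hp _)
    (gapWeight_nonneg hp _)) (gapWeight_nonneg hp _)) (by positivity)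

theorem gapCorrelation_le (hp : Odd p) (t : ZMod p) : gapCorrelation p t ≤ 4 := by
  have hp0 : (0 : ℝ) < p := by exact_mod_cast (Fact.out : p.Prime).pos
  unfold gapCorrelation
  rw [div_le_iff₀ hp0]
  calc _ ≤ ∑ _s : ZMod p, (4 : ℝ) := Finset.sum_le_sum fun s _ => gapWeight_mul_le hp _ _ _
    _ = _ := by simp [ZMod.card, mul_comm]

theorem sum_gapCorrelation_div_le (hp : Odd p) :
    (∑ t, gapCorrelation p t) / p ≤ 1 - 1 / 150 := by
  have hp0 : (0 : ℝ) < p := by exact_mod_cast (Fact.out : p.Prime).pos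
  have := apSum_gapWeight_le hp
  unfold apSum at this
  rw [Finset.sum_comm] at this
  unfold gapCorrelation
  rw [← Finset.sum_div, div_div, div_le_iff₀ (by positivity), ← sq]
  exact this

theorem sum_gapWeight_fiber (l : Module.Dual (ZMod p) W) (hl : l ≠ 0) (t : ZMod p) :
    ∑ w, gapWeight p (l w) * gapWeight p (l w + t) * gapWeight p (l w + 2 • t)
      = Fintype.card W * gapCorrelation p t :=
  sum_comp_functional hl fun s => gapWeight p s * gapWeight p (s + t) * gapWeight p (s + 2 • t)

/-- A vertical progression stays in one fibre, so without perturbation it would count f³. Over `X`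
this is multiplied by the correlation of the weight at `v x e`, or by at most 4 when `v x = 0`. The
hypothesis `he` is the resulting gain, and c ≥ 1 can only enlarge it. -/
theorem apSumAt_perturb_vertical_le (hp : Odd p) (hc : 1 ≤ c)
    (hX : ∀ x ∈ X, f x = c) {e : W} {g : ℝ} (hg : 0 ≤ g)
    (he : ∑ x ∈ X, gapCorrelation p (v x e) + 4 * (X.filter fun x => v x = 0).card
      ≤ X.card - g) :
    apSumAt (perturb f X v) (0, e) ≤ (∑ x, f x ^ 3 - g) * Fintype.card W := by
  have hx : ∀ x : V, ∑ w : W, perturb f X v (x, w) * perturb f X v ((x, w) + (0, e))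
      * perturb f X v ((x, w) + 2 • (0, e)) ≤ (f x ^ 3 + if x ∈ X then c ^ 3 *
        (gapCorrelation p (v x e) + (if v x = 0 then 4 else 0) - 1) else 0) * Fintype.card W := by
    intro x
    have e1 : ∀ w : W, perturb f X v (x, w) * perturb f X v ((x, w) + (0, e))
        * perturb f X v ((x, w) + 2 • (0, e)) = f x ^ 3 * if x ∈ X then gapWeight p (v x w)
          * gapWeight p (v x w + v x e) * gapWeight p (v x w + 2 • v x e) else 1 := by
      intro w
      simp only [perturb, Prod.mk_add_mk, Prod.smul_mk, smul_zero, add_zero, map_add, map_nsmul]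
      split_ifs <;> ring
    simp_rw [e1]
    rw [← Finset.mul_sum]
    split_ifs with h hv
    · rw [hX x h]
      have : ∑ w : W, gapWeight p (v x w) * gapWeight p (v x w + v x e)
          * gapWeight p (v x w + 2 • v x e) ≤ (gapCorrelation p (v x e) + 4) * Fintype.card W := by
        calc _ ≤ ∑ _w : W, (4 : ℝ) := Finset.sum_le_sum fun w _ => gapWeight_mul_le hp _ _ _
          _ = 4 * Fintype.card W := by simp [mul_comm]
          _ ≤ _ := by
            have := gapCorrelation_nonneg hp (v x e)
            gcongr
            linarith
      calc _ ≤ c ^ 3 * ((gapCorrelation p (v x e) + 4) * Fintype.card W) := by gcongr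
        _ = _ := by ring
    · rw [hX x h, sum_gapWeight_fiber _ hv]
      refine le_of_eq ?_
      ring
    · simp
  unfold apSumAt
  rw [Fintype.sum_prod_type]
  refine (Finset.sum_le_sum fun x _ => hx x).trans ?_
  rw [← Finset.sum_mul, Finset.sum_add_distrib, Finset.sum_ite_mem, Finset.univ_inter,
    ← Finset.mul_sum, Finset.sum_sub_distrib, Finset.sum_add_distrib, ← Finset.sum_filter]
  simp only [sum_const, nsmul_eq_mul, mul_one]
  have hc3 : 1 ≤ c ^ 3 := one_le_pow₀ hc
  refine mul_le_mul_of_nonneg_right ?_ (by positivity)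
  nlinarith

end Extension

/-! ### Evaluation functionals on polynomials -/

section Evaluation

variable {p : ℕ} [Fact p.Prime] {K : Type*} [Field K] [Fintype K] [Algebra (ZMod p) K]

/-- Evaluation at `y` of the polynomial of degree less than `n` with given coefficients. -/
noncomputable def evalAt (n : ℕ) (y : K) : (Fin n → K) →ₗ[K] K :=
  (Polynomial.leval y) ∘ₗ Polynomial.ofFn n

theorem card_roots_evalAt_le {n : ℕ} {w : Fin n → K} (hw : w ≠ 0) :
    (univ.filter fun y => evalAt n y w = 0).card ≤ n := by
  have h0 : Polynomial.ofFn n w ≠ 0 := fun h =>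
    hw (Polynomial.injective_ofFn n (by rw [h, Polynomial.ofFn_zero]))
  have hn : 1 ≤ n := by
    rcases Nat.eq_zero_or_pos n with rfl | h
    · exact absurd (Subsingleton.elim w 0) hw
    · exact h
  have hd := Polynomial.ofFn_natDegree_lt hn w
  refine le_trans ?_ ((Polynomial.card_roots' (Polynomial.ofFn n w)).trans hd.le)
  refine le_trans (Finset.card_le_card ?_) (Multiset.toFinset_card_le _)
  intro y hy
  rw [Multiset.mem_toFinset, Polynomial.mem_roots h0]
  exact (mem_filter.1 hy).2

omit [Fintype K] in
theorem exists_evalAt_eq {ι : Type*} [Fintype ι] {n : ℕ} (hn : Fintype.card ι ≤ n) {y : ι → K}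
    (hy : Function.Injective y) (r : ι → K) : ∃ w : Fin n → K, ∀ j, evalAt n (y j) w = r j := by
  let P := Lagrange.interpolate univ y r
  rcases Nat.eq_zero_or_pos n with rfl | hpos
  · have : IsEmpty ι := Fintype.card_eq_zero_iff.1 (by omega)
    exact ⟨0, fun j => this.elim j⟩
  have hd : P.natDegree < n := by
    have h1 : P.degree < (univ : Finset ι).card := Lagrange.degree_interpolate_lt r hy.injOn
    have h2 : P.degree < n := lt_of_lt_of_le h1 (by exact_mod_cast hn)
    by_cases hP : P = 0
    · simpa [hP] using hpos
    · exact (Polynomial.natDegree_lt_iff_degree_lt hP).2 h2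
  refine ⟨Polynomial.toFn n P, fun j => ?_⟩
  have : Polynomial.ofFn n (Polynomial.toFn n P) = P :=
    Polynomial.ofFn_comp_toFn_eq_id_of_natDegree_lt hd
  simp only [evalAt, LinearMap.comp_apply, this]
  exact Lagrange.eval_interpolate_at_node r hy.injOn (mem_univ j)

/-- The functional `w ↦ τ (a * w(y))` on the space of polynomials of degree less than `n`. -/
noncomputable def evalFunctional (τ : Module.Dual (ZMod p) K) (n : ℕ) (a y : K) :
    Module.Dual (ZMod p) (Fin n → K) :=
  τ ∘ₗ LinearMap.mulLeft (ZMod p) a ∘ₗ (evalAt n y).restrictScalars (ZMod p)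

variable {τ : Module.Dual (ZMod p) K} {n : ℕ}

omit [Fintype K] in
theorem evalFunctional_apply (a y : K) (w : Fin n → K) :
    evalFunctional τ n a y w = τ (a * evalAt n y w) := rfl

omit [Fintype K] in
theorem smul_evalFunctional (c : ZMod p) (a y : K) :
    c • evalFunctional τ n a y = evalFunctional τ n (c • a) y := by
  ext w
  simp [evalFunctional_apply]

omit [Fintype K] in
theorem sum_evalFunctional {ι : Type*} (s : Finset ι) (a : ι → K) (y : K) :
    ∑ j ∈ s, evalFunctional τ n (a j) y = evalFunctional τ n (∑ j ∈ s, a j) y := by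
  ext w
  simp [evalFunctional_apply, Finset.sum_mul]

omit [Fintype K] in
theorem exists_dual_apply_mul_ne_zero (hτ : τ ≠ 0) {a : K} (ha : a ≠ 0) : ∃ r, τ (a * r) ≠ 0 := by
  by_contra h
  push Not at h
  apply hτ
  ext r
  simpa [mul_div_cancel₀, ha] using h (a⁻¹ * r)

-- Interpolation provides a polynomial vanishing at all the points but one, with a prescribed value
-- there; this isolates a single coefficient.
omit [Fintype K] in
theorem eq_zero_of_sum_evalFunctional_eq_zero (hτ : τ ≠ 0) {ι : Type*} [Fintype ι]
    (hn : Fintype.card ι ≤ n) {y : ι → K} (hy : Function.Injective y) {a : ι → K}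
    (h : ∑ j, evalFunctional τ n (a j) (y j) = 0) (j : ι) : a j = 0 := by
  by_contra ha
  obtain ⟨r, hr⟩ := exists_dual_apply_mul_ne_zero hτ ha
  obtain ⟨w, hw⟩ := exists_evalAt_eq hn hy (Pi.single j r)
  have h1 := LinearMap.congr_fun h w
  rw [LinearMap.sum_apply, Finset.sum_eq_single j] at h1
  · rw [evalFunctional_apply, hw, Pi.single_eq_same] at h1
    exact hr h1
  · intro i _ hij
    rw [evalFunctional_apply, hw, Pi.single_eq_of_ne hij, mul_zero, map_zero]
  · simp

omit [Fintype K] in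
theorem evalFunctional_eq_zero_iff (hτ : τ ≠ 0) (hn : 1 ≤ n) (a y : K) :
    evalFunctional τ n a y = 0 ↔ a = 0 := by
  constructor
  · intro h
    exact eq_zero_of_sum_evalFunctional_eq_zero (ι := Unit) (y := fun _ => y) (a := fun _ => a)
      hτ (by simpa using hn) (fun _ _ _ => rfl) (by simpa using h) ()
  · rintro rfl
    ext w
    simp [evalFunctional_apply]

/-- Affine functions of one variable in `K` are equidistributed under `τ`. -/
theorem sum_comp_affine (hτ : τ ≠ 0) (s : K) {e : K} (he : e ≠ 0) (F : ZMod p → ℝ) :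
    ∑ m, F (τ (s + m * e)) = Fintype.card K * ((∑ t, F t) / p) := by
  rw [← sum_comp_functional hτ F]
  refine Fintype.sum_bijective (fun m => s + m * e) ?_ _ _ fun _ => rfl
  rw [← Finite.injective_iff_bijective]
  intro a b hab
  exact mul_right_cancel₀ he (add_left_cancel hab)

end Evaluation

/-! ### Functionals on U × K³ that are mostly independent along progressions -/

section Independence

variable {p : ℕ} [Fact p.Prime] {V W : Type*} [AddCommGroup V] [Fintype V]
  [AddCommGroup W] [Module (ZMod p) W]

omit [Fintype V] in
theorem indepAlong_of_forall {X : Finset V} {v : V → Module.Dual (ZMod p) W} {a x : V}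
    (h : ∀ c : Fin 3 → ZMod p, (∀ j : Fin 3, x + (j : ℕ) • a ∉ X → c j = 0) →
      ∑ j : Fin 3, c j • v (x + (j : ℕ) • a) = 0 → c = 0) : IndepAlong X v a x := by
  unfold IndepAlong
  rw [Fintype.linearIndependent_iff]
  intro c hc j
  let c' : Fin 3 → ZMod p := fun j => if hj : x + (j : ℕ) • a ∈ X then c ⟨j, hj⟩ else 0
  have h0 : c' = 0 := by
    refine h c' (fun j hj => by simp [c', hj]) ?_
    rw [← hc, ← Finset.sum_filter_add_sum_filter_not univ (fun j : Fin 3 => x + (j : ℕ) • a ∈ X),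
      Finset.sum_eq_zero (s := univ.filter fun j : Fin 3 => ¬ x + (j : ℕ) • a ∈ X), add_zero]
    · rw [Finset.sum_subtype (univ.filter fun j : Fin 3 => x + (j : ℕ) • a ∈ X)
        (p := fun j : Fin 3 => x + (j : ℕ) • a ∈ X) (fun j => by simp)]
      refine Finset.sum_congr rfl fun j _ => ?_
      simp [c', j.2]
    · intro j hj
      simp [c', (mem_filter.1 hj).2]
  have := congrFun h0 j
  simpa [c', j.2] using this

end Independence

section Counting

variable {U K : Type*} [Fintype U] [Fintype K]

theorem card_filter_le_of_unique_middle (P : U × K × K × K → Prop)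
    (h : ∀ u a b b' c, P (u, a, b, c) → P (u, a, b', c) → b = b') :
    (univ.filter P).card ≤ Fintype.card U * Fintype.card K ^ 2 := by
  have : Fintype.card U * Fintype.card K ^ 2 = (univ : Finset (U × K × K)).card := by
    simp [Fintype.card_prod, sq]
  rw [this]
  refine Finset.card_le_card_of_injOn (fun x => (x.1, x.2.1, x.2.2.2)) (by simp) ?_
  rintro ⟨u, a, b, c⟩ hx ⟨u', a', b', c'⟩ hx' heq
  simp only [Prod.mk.injEq] at heq
  obtain ⟨rfl, rfl, rfl⟩ := heq
  have := h _ _ _ _ _ (mem_filter.1 hx).2 (mem_filter.1 hx').2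
  rw [this]

theorem card_filter_le_of_unique_last (P : U × K × K × K → Prop)
    (h : ∀ u a b c c', P (u, a, b, c) → P (u, a, b, c') → c = c') :
    (univ.filter P).card ≤ Fintype.card U * Fintype.card K ^ 2 := by
  have : Fintype.card U * Fintype.card K ^ 2 = (univ : Finset (U × K × K)).card := by
    simp [Fintype.card_prod, sq]
  rw [this]
  refine Finset.card_le_card_of_injOn (fun x => (x.1, x.2.1, x.2.2.1)) (by simp) ?_
  rintro ⟨u, a, b, c⟩ hx ⟨u', a', b', c'⟩ hx' heq
  simp only [Prod.mk.injEq] at heq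
  obtain ⟨rfl, rfl, rfl⟩ := heq
  have := h _ _ _ _ _ (mem_filter.1 hx).2 (mem_filter.1 hx').2
  rw [this]

end Counting

section Hash

variable {p : ℕ} [Fact p.Prime] {U K : Type*} [AddCommGroup U] [Module (ZMod p) U] [Fintype U]
  [Field K] [Fintype K] [Algebra (ZMod p) K]

/-- The evaluation point attached to a point of `U × K³`. -/
def hashPoint (θ : U →ₗ[ZMod p] K) (x : U × K × K × K) : K :=
  x.2.1 + x.2.2.1 * θ x.1 + x.2.2.2 ^ 2

/-- The multiplier attached to a point of `U × K³`. -/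
def hashScale (x : U × K × K × K) : K := x.2.2.2 + x.2.2.1 ^ 2

/-- The functional attached to a point of `U × K³`. -/
noncomputable def hashFunctional (τ : Module.Dual (ZMod p) K) (θ : U →ₗ[ZMod p] K) (n : ℕ)
    (x : U × K × K × K) : Module.Dual (ZMod p) (Fin n → K) :=
  evalFunctional τ n (hashScale x) (hashPoint θ x)

variable {τ : Module.Dual (ZMod p) K} {θ : U →ₗ[ZMod p] K} {n : ℕ}

omit [Fintype K] in
theorem two_ne_zero_of_algebra (hp : Odd p) : (2 : K) ≠ 0 := by
  have h : algebraMap (ZMod p) K 2 ≠ 0 := by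
    rw [Ne, map_eq_zero]
    exact two_ne_zero_zmod hp
  rwa [map_ofNat] at h

theorem injective_fin_three {α : Type*} {y : Fin 3 → α} (h01 : y 0 ≠ y 1) (h12 : y 1 ≠ y 2)
    (h20 : y 2 ≠ y 0) : Function.Injective y := by
  intro i j hij
  fin_cases i <;> fin_cases j <;> simp_all

omit [Fintype U] [Fintype K] in
theorem indepAlong_hash_of_injective (hτ : τ ≠ 0) (hn : 3 ≤ n) {X : Finset (U × K × K × K)}
    {d x : U × K × K × K}
    (hy : Function.Injective fun j : Fin 3 => hashPoint θ (x + (j : ℕ) • d))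
    (hs : ∀ j : Fin 3, hashScale (x + (j : ℕ) • d) ≠ 0) :
    IndepAlong X (hashFunctional τ θ n) d x := by
  refine indepAlong_of_forall fun c _ hc => ?_
  simp only [hashFunctional, smul_evalFunctional] at hc
  ext j
  have := eq_zero_of_sum_evalFunctional_eq_zero hτ (by simpa using hn) hy hc j
  rcases smul_eq_zero.1 this with h | h
  · exact h
  · exact absurd h (hs j)

omit [Fintype U] [Fintype K] in
theorem indepAlong_hash_of_const (hτ : τ ≠ 0) (hn : 1 ≤ n) {X : Finset (U × K × K × K)}
    {d x : U × K × K × K} {y : K} (hy : ∀ j : Fin 3, hashPoint θ (x + (j : ℕ) • d) = y)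
    (hs : ∀ c : Fin 3 → ZMod p, c ≠ 0 → ∑ j, c j • hashScale (x + (j : ℕ) • d) ≠ 0) :
    IndepAlong X (hashFunctional τ θ n) d x := by
  refine indepAlong_of_forall fun c _ hc => ?_
  simp only [hashFunctional, smul_evalFunctional, hy] at hc
  rw [sum_evalFunctional, evalFunctional_eq_zero_iff hτ hn] at hc
  by_contra h
  exact hs c h hc

theorem card_filter_le_of_forall_exists {ι α : Type*} [Fintype ι] [Fintype α] {P : α → Prop}
    [DecidablePred P]
    {E : ι → α → Prop} {B : ℕ}
    (hE : ∀ i, ∀ s : Finset α, (∀ x ∈ s, E i x) → s.card ≤ B)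
    (h : ∀ x, P x → ∃ i, E i x) : (univ.filter P).card ≤ Fintype.card ι * B := by
  calc (univ.filter P).card ≤ ((univ : Finset ι).biUnion fun i => univ.filter (E i)).card := by
        refine Finset.card_le_card fun x hx => ?_
        obtain ⟨i, hi⟩ := h x (mem_filter.1 hx).2
        exact mem_biUnion.2 ⟨i, mem_univ _, mem_filter.2 ⟨mem_univ _, hi⟩⟩
    _ ≤ _ := Finset.card_biUnion_le_card_mul _ _ _ fun i _ => hE i _ fun x hx => (mem_filter.1 hx).2

theorem card_hashScale_eq_zero_le (d : U × K × K × K) (j : ℕ) :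
    (univ.filter fun x : U × K × K × K => hashScale (x + j • d) = 0).card
      ≤ Fintype.card U * Fintype.card K ^ 2 := by
  refine card_filter_le_of_unique_last _ fun u a b c c' h h' => ?_
  simp only [hashScale, Prod.snd_add, Prod.fst_add] at h h'
  linear_combination h - h'

/-- A coincidence is an affine equation. If `d` moves `U`, the term b θ(u) makes its coefficient of
b nonzero; if `d` moves only K³ with nonzero last coordinate, the square c² makes its coefficient of
c nonzero. One coordinate is therefore determined by the others. -/
theorem card_hashPoint_eq_le (hp : Odd p) (hθ : Function.Injective θ) {d : U × K × K × K}
    (hd : d.1 ≠ 0 ∨ d.2.2.2 ≠ 0) {i j : ℕ} (hij : (i : K) ≠ j) :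
    (univ.filter fun x : U × K × K × K =>
      hashPoint θ (x + i • d) = hashPoint θ (x + j • d)).card
      ≤ Fintype.card U * Fintype.card K ^ 2 := by
  obtain ⟨du, d1, d2, d3⟩ := d
  have h2 : (2 : K) ≠ 0 := two_ne_zero_of_algebra hp
  have hij' := sub_ne_zero.2 hij
  by_cases hdu : du = 0
  · have hd3 : d3 ≠ 0 := by simpa [hdu] using hd
    refine card_filter_le_of_unique_last _ fun u a b c c' h h' => ?_
    simp only [hashPoint, Prod.snd_add, Prod.fst_add, Prod.smul_fst, Prod.smul_snd, map_add,
      map_nsmul] at h h'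
    simp only [nsmul_eq_mul, hdu, map_zero] at h h'
    have : 2 * ((i : K) - j) * d3 * (c - c') = 0 := by linear_combination h - h'
    simpa [h2, hij', hd3, sub_eq_zero] using this
  · have hθd : θ du ≠ 0 := fun h => hdu (hθ (by rw [h, map_zero]))
    refine card_filter_le_of_unique_middle _ fun u a b b' c h h' => ?_
    simp only [hashPoint, Prod.snd_add, Prod.fst_add, Prod.smul_fst, Prod.smul_snd, map_add,
      map_nsmul] at h h'
    simp only [nsmul_eq_mul] at h h'
    have : ((i : K) - j) * θ du * (b - b') = 0 := by linear_combination h - h'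
    simpa [hij', hθd, sub_eq_zero] using this

-- The relation is a polynomial in e and b. Its coefficient of e is c₀ + c₁ + c₂; if that vanishes,
-- its coefficient of b is 2d₂(c₁ + 2c₂); if both vanish, the constant is 2c₂d₂². Not all three are
-- zero, and the last being alone nonzero leaves no solutions.
omit [Module (ZMod p) U] in
theorem card_sum_smul_hashScale_le (hp : Odd p) {d : U × K × K × K} (hd3 : d.2.2.2 = 0)
    (hd2 : d.2.2.1 ≠ 0) {c : Fin 3 → ZMod p} (hc : c ≠ 0) :
    (univ.filter fun x : U × K × K × K =>
      ∑ j : Fin 3, c j • hashScale (x + (j : ℕ) • d) = 0).card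
      ≤ Fintype.card U * Fintype.card K ^ 2 := by
  obtain ⟨du, d1, d2, d3⟩ := d
  simp only at hd3 hd2
  subst hd3
  have h2 : (2 : K) ≠ 0 := two_ne_zero_of_algebra hp
  have hC : ¬ (algebraMap (ZMod p) K (c 0) = 0 ∧ algebraMap (ZMod p) K (c 1) = 0 ∧
      algebraMap (ZMod p) K (c 2) = 0) := by
    rintro ⟨h0, h1, h2⟩
    rw [map_eq_zero] at h0 h1 h2
    apply hc
    ext j
    fin_cases j <;> simpa
  have hexp : ∀ (u : U) (a b e : K),
      ∑ j : Fin 3, c j • hashScale ((u, a, b, e) + (j : ℕ) • (du, d1, d2, (0 : K)))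
      = algebraMap (ZMod p) K (c 0) * (e + b ^ 2) + algebraMap (ZMod p) K (c 1) * (e + (b + d2) ^ 2)
        + algebraMap (ZMod p) K (c 2) * (e + (b + 2 * d2) ^ 2) := by
    intro u a b e
    rw [Fin.sum_univ_three]
    simp [hashScale, Algebra.smul_def]
  generalize algebraMap (ZMod p) K (c 0) = c0 at *
  generalize algebraMap (ZMod p) K (c 1) = c1 at *
  generalize algebraMap (ZMod p) K (c 2) = c2 at *
  by_cases hs : c0 + c1 + c2 = 0
  · refine card_filter_le_of_unique_middle _ fun u a b b' e h h' => ?_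
    rw [hexp] at h h'
    by_cases ht : c1 + 2 * c2 = 0
    · exfalso
      have h3 : 2 * c2 * d2 ^ 2 = 0 := by
        linear_combination h - (e + b ^ 2) * hs - (2 * b * d2 + d2 ^ 2) * ht
      have h4 : c2 = 0 := by simpa [h2, hd2] using h3
      rw [h4] at ht hs
      have h5 : c1 = 0 := by simpa using ht
      rw [h5] at hs
      exact hC ⟨by simpa using hs, h5, h4⟩
    · have h3 : 2 * (c1 + 2 * c2) * d2 * (b - b') = 0 := by
        linear_combination h - h' - (b ^ 2 - b' ^ 2) * hs
      simpa [h2, hd2, ht, sub_eq_zero] using h3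
  · refine card_filter_le_of_unique_last _ fun u a b e e' h h' => ?_
    rw [hexp] at h h'
    have h3 : (c0 + c1 + c2) * (e - e') = 0 := by linear_combination h - h'
    simpa [hs, sub_eq_zero] using h3

/-- Distinct evaluation points with nonzero multipliers give independence. If `d` moves only the
first two coordinates of K³, the points are either distinct or all equal; when they are equal,
independence means that the multipliers are independent over 𝔽_p. The union bound runs over p³
coefficient vectors, 3 vanishing multipliers and 3 coincidences. -/
theorem card_not_indepAlong_hash_le (hp : Odd p) (hτ : τ ≠ 0) (hn : 3 ≤ n)
    (hθ : Function.Injective θ) (X : Finset (U × K × K × K)) {d : U × K × K × K} (hd : d ≠ 0) :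
    (univ.filter fun x => ¬ IndepAlong X (hashFunctional τ θ n) d x).card
      ≤ (p ^ 3 + 6) * (Fintype.card U * Fintype.card K ^ 2) := by
  have h2 : (2 : K) ≠ 0 := two_ne_zero_of_algebra hp
  have hcard : Fintype.card ((Fin 3 → ZMod p) ⊕ Fin 3 ⊕ Fin 3) = p ^ 3 + 6 := by
    simp [ZMod.card]
  rw [← hcard]
  by_cases hcase : d.1 ≠ 0 ∨ d.2.2.2 ≠ 0
  · refine card_filter_le_of_forall_exists
      (ι := (Fin 3 → ZMod p) ⊕ Fin 3 ⊕ Fin 3) (E := Sum.elim (fun _ _ => False) (Sum.elim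
        (fun (j : Fin 3) x => hashScale (x + (j : ℕ) • d) = 0)
        (fun (j : Fin 3) x => hashPoint θ (x + (j : ℕ) • d) = hashPoint θ (x + ((j + 1 : Fin 3) : ℕ) • d))))
      ?_ ?_
    · rintro (c | j | j) s hs
      · rw [Finset.eq_empty_of_forall_notMem hs, card_empty]
        exact Nat.zero_le _
      · refine (Finset.card_le_card fun x hx => mem_filter.2 ⟨mem_univ _, hs x hx⟩).trans ?_
        exact card_hashScale_eq_zero_le d j
      · refine (Finset.card_le_card fun x hx => mem_filter.2 ⟨mem_univ _, hs x hx⟩).trans ?_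
        refine card_hashPoint_eq_le hp hθ hcase ?_
        fin_cases j <;> simp [h2]
        intro h
        have : (1 : K) = 0 := by linear_combination -h
        exact one_ne_zero this
    · intro x hx
      by_contra hne
      push Not at hne
      apply hx
      refine indepAlong_hash_of_injective hτ hn (injective_fin_three ?_ ?_ ?_) ?_
      · exact hne (Sum.inr (Sum.inr 0))
      · exact hne (Sum.inr (Sum.inr 1))
      · exact hne (Sum.inr (Sum.inr 2))
      · exact fun j => hne (Sum.inr (Sum.inl j))
  · push Not at hcase
    obtain ⟨hdu, hd3⟩ := hcase
    have hpt : ∀ x (j : ℕ), hashPoint θ (x + j • d)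
        = hashPoint θ x + j * (d.2.1 + d.2.2.1 * θ x.1) := by
      intro x j
      simp only [hashPoint, Prod.snd_add, Prod.fst_add, Prod.smul_fst, Prod.smul_snd, map_add,
        map_nsmul]
      simp only [nsmul_eq_mul, hdu, hd3, map_zero]
      ring
    refine card_filter_le_of_forall_exists
      (ι := (Fin 3 → ZMod p) ⊕ Fin 3 ⊕ Fin 3) (E := Sum.elim (fun (c : Fin 3 → ZMod p) x => c ≠ 0 ∧ d.2.2.1 ≠ 0 ∧
          ∑ j : Fin 3, c j • hashScale (x + (j : ℕ) • d) = 0) (Sum.elim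
        (fun (j : Fin 3) x => hashScale (x + (j : ℕ) • d) = 0) (fun _ _ => False)))
      ?_ ?_
    · rintro (c | j | j) s hs
      · by_cases h : c ≠ 0 ∧ d.2.2.1 ≠ 0
        · refine (Finset.card_le_card fun x hx =>
            mem_filter.2 ⟨mem_univ _, (hs x hx).2.2⟩).trans ?_
          exact card_sum_smul_hashScale_le hp hd3 h.2 h.1
        · rw [Finset.eq_empty_of_forall_notMem fun x hx => h ⟨(hs x hx).1, (hs x hx).2.1⟩,
            card_empty]
          exact Nat.zero_le _
      · refine (Finset.card_le_card fun x hx => mem_filter.2 ⟨mem_univ _, hs x hx⟩).trans ?_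
        exact card_hashScale_eq_zero_le d j
      · rw [Finset.eq_empty_of_forall_notMem hs, card_empty]
        exact Nat.zero_le _
    · intro x hx
      by_contra hne
      push Not at hne
      apply hx
      by_cases hΔ : d.2.1 + d.2.2.1 * θ x.1 = 0
      · have hd2 : d.2.2.1 ≠ 0 := by
          intro h
          apply hd
          rw [h, zero_mul, add_zero] at hΔ
          exact Prod.ext hdu (Prod.ext hΔ (Prod.ext h hd3))
        refine indepAlong_hash_of_const (y := hashPoint θ x) hτ (by omega) ?_ ?_
        · intro j
          rw [hpt, hΔ, mul_zero, add_zero]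
        · intro c hc h
          exact hne (Sum.inl c) ⟨hc, hd2, h⟩
      · refine indepAlong_hash_of_injective hτ hn ?_ fun j => hne (Sum.inr (Sum.inl j))
        refine injective_fin_three ?_ ?_ ?_ <;> simp only [hpt] <;> intro h <;> apply hΔ
        · simp at h
          simpa using h
        · have h1 : (d.2.1 + d.2.2.1 * θ x.1) = 0 := by
            simp at h
            linear_combination -h
          exact h1
        · simp at h
          simpa [h2] using h

/-- Up to the loss from the zeros of the polynomial and of the multiplier, the values of the
attached functionals at a nonzero `w` are equidistributed over the fibres. -/
theorem sum_gapCorrelation_hash_le (hp : Odd p) (hτ : τ ≠ 0) (hn : 1 ≤ n) (S : Finset U)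
    {w : Fin n → K} (hw : w ≠ 0) :
    ∑ x with x.1 ∈ S, gapCorrelation p (hashFunctional τ θ n x w)
        + 4 * ((univ.filter fun x : U × K × K × K => x.1 ∈ S).filter
          fun x => hashFunctional τ θ n x = 0).card
      ≤ S.card * ((Fintype.card K : ℝ) ^ 3 * (1 - 1 / 150)
        + 4 * (n + 1) * (Fintype.card K : ℝ) ^ 2) := by
  let Φ : K → K → ℝ := fun y l =>
    gapCorrelation p (τ (l * evalAt n y w)) + if l = 0 then 4 else 0
  have hq : (0 : ℝ) ≤ Fintype.card K := by positivity
  -- For fixed u and b, the map from (a, c) to (point, multiplier) is a bijection of K², so the two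
  -- are jointly uniform.
  have hΦ : ∀ t : K, ∑ a, ∑ b, ∑ c, Φ (a + b * t + c ^ 2) (c + b ^ 2)
      = Fintype.card K * ∑ y, ∑ l, Φ y l := by
    intro t
    rw [Finset.sum_comm]
    have h1 : ∀ b : K, ∑ a, ∑ c, Φ (a + b * t + c ^ 2) (c + b ^ 2) = ∑ y, ∑ l, Φ y l := by
      intro b
      rw [Finset.sum_comm, Finset.sum_comm (f := fun y l => Φ y l)]
      rw [← Equiv.sum_comp (Equiv.addRight (b ^ 2)) fun l => ∑ y, Φ y l]
      refine Finset.sum_congr rfl fun c _ => ?_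
      have := Equiv.sum_comp (Equiv.addRight (b * t + c ^ 2)) fun y => Φ y (c + b ^ 2)
      simpa [add_assoc] using this
    simp_rw [h1]
    simp
  have hb : ∑ y, ∑ l, Φ y l ≤ (Fintype.card K : ℝ) ^ 2 * (1 - 1 / 150)
      + 4 * (n + 1) * Fintype.card K := by
    -- Unless `y` is a root of `w`, the product of a uniform `l` with w(y) is uniform in K, and
    -- hence its image under τ is uniform in 𝔽_p.
    have hy : ∀ y : K, ∑ l, Φ y l ≤ (Fintype.card K : ℝ) * (1 - 1 / 150) + 4
        + if evalAt n y w = 0 then 4 * (Fintype.card K : ℝ) else 0 := by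
      intro y
      simp only [Φ]
      rw [Finset.sum_add_distrib, Finset.sum_ite_eq' univ (0 : K), if_pos (mem_univ _)]
      split_ifs with h
      · have : ∑ l : K, gapCorrelation p (τ (l * evalAt n y w)) ≤ ∑ _l : K, (4 : ℝ) :=
          Finset.sum_le_sum fun l _ => gapCorrelation_le hp _
        simp only [sum_const, card_univ, nsmul_eq_mul] at this
        nlinarith
      · have := sum_comp_affine hτ 0 h (gapCorrelation p)
        simp only [zero_add] at this
        rw [this]
        have := mul_le_mul_of_nonneg_left (sum_gapCorrelation_div_le (p := p) hp) hq
        linarith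
    refine (Finset.sum_le_sum fun y _ => hy y).trans ?_
    rw [Finset.sum_add_distrib, ← Finset.sum_filter]
    simp only [sum_const, card_univ, nsmul_eq_mul]
    have hr : ((univ.filter fun y => evalAt n y w = 0).card : ℝ) ≤ n := by
      exact_mod_cast card_roots_evalAt_le hw
    nlinarith
  have he : ∑ x with x.1 ∈ S, gapCorrelation p (hashFunctional τ θ n x w)
        + 4 * ((univ.filter fun x : U × K × K × K => x.1 ∈ S).filter
          fun x => hashFunctional τ θ n x = 0).card
      = ∑ u ∈ S, ∑ a, ∑ b, ∑ c, Φ (a + b * θ u + c ^ 2) (c + b ^ 2) := by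
    have hcard : (4 : ℝ) * ((univ.filter fun x : U × K × K × K => x.1 ∈ S).filter
          fun x => hashFunctional τ θ n x = 0).card
        = ∑ x : U × K × K × K with x.1 ∈ S, if hashScale x = 0 then (4 : ℝ) else 0 := by
      rw [← Finset.sum_filter]
      simp only [hashFunctional, evalFunctional_eq_zero_iff hτ hn, sum_const, nsmul_eq_mul]
      ring
    rw [hcard, ← Finset.sum_add_distrib]
    have : (univ.filter fun x : U × K × K × K => x.1 ∈ S) = S ×ˢ univ := by
      ext x
      simp
    rw [this, Finset.sum_product]
    refine Finset.sum_congr rfl fun u _ => ?_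
    rw [Fintype.sum_prod_type]
    refine Finset.sum_congr rfl fun a _ => ?_
    rw [Fintype.sum_prod_type]
    rfl
  rw [he]
  simp_rw [hΦ]
  rw [sum_const, nsmul_eq_mul]
  refine mul_le_mul_of_nonneg_left ?_ (by positivity)
  calc _ ≤ (Fintype.card K : ℝ) * ((Fintype.card K : ℝ) ^ 2 * (1 - 1 / 150)
      + 4 * (n + 1) * Fintype.card K) := mul_le_mul_of_nonneg_left hb hq
    _ = _ := by ring

end Hash

/-! ### One step of the lower-bound construction -/

section GapFunction

/-- A function on `U × Z` of mean at least one, all of whose progression counts with nonzero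
common difference fall short of one by `ε`, whose mean cube is at most `1 + δ`, which is still
constant over the set `R` and takes only two values elsewhere. -/
structure GapFunction (p : ℕ) {U Z : Type*} [AddCommGroup U] [Fintype U] [AddCommGroup Z]
    [Fintype Z] (f : U × Z → ℝ) (R : Finset U) (c δ ε : ℝ) : Prop where
  nonneg : ∀ x, 0 ≤ f x
  le_two : ∀ x, f x ≤ 2
  mass : (Fintype.card (U × Z) : ℝ) ≤ ∑ x, f x
  cube : ∑ x, f x ^ 3 ≤ (1 + δ) * Fintype.card (U × Z)
  progressions : ∀ d, d ≠ 0 → apSumAt f d ≤ (1 - ε) * Fintype.card (U × Z)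
  core : ∀ x : U × Z, x.1 ∈ R → f x = c
  rest : ∀ x : U × Z, x.1 ∉ R → f x = 0 ∨ f x = c * gapHeight p
  size : (1 - δ) * Fintype.card U ≤ R.card

variable {p : ℕ} [Fact p.Prime]

omit [Fact p.Prime] in
theorem GapFunction.transport {U Z Z' : Type*} [AddCommGroup U] [Fintype U] [AddCommGroup Z]
    [Fintype Z] [AddCommGroup Z'] [Fintype Z'] {f : U × Z → ℝ} {R : Finset U} {c δ ε : ℝ}
    (hf : GapFunction p f R c δ ε) (e : Z' ≃+ Z) :
    GapFunction p (fun x : U × Z' => f (x.1, e x.2)) R c δ ε := by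
  have hcard : Fintype.card (U × Z') = Fintype.card (U × Z) := by
    rw [Fintype.card_prod, Fintype.card_prod, Fintype.card_congr e.toEquiv]
  have hsum : ∀ F : U × Z → ℝ, ∑ x : U × Z', F (x.1, e x.2) = ∑ x, F x := fun F =>
    Equiv.sum_comp (Equiv.prodCongr (Equiv.refl U) e.toEquiv) F
  refine ⟨fun x => hf.nonneg _, fun x => hf.le_two _, ?_, ?_, ?_, fun x hx => hf.core _ hx,
    fun x hx => hf.rest _ hx, hf.size⟩
  · rw [hcard, hsum]
    exact hf.mass
  · rw [hcard, hsum fun x => f x ^ 3]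
    exact hf.cube
  · rintro ⟨a, b⟩ hd
    rw [hcard]
    have h := hf.progressions (a, e b) (by simpa [Prod.ext_iff] using hd)
    refine le_trans (le_of_eq ?_) h
    unfold apSumAt
    rw [← hsum fun x => f x * f (x + (a, e b)) * f (x + 2 • (a, e b))]
    refine Finset.sum_congr rfl fun x _ => ?_
    simp

/-- `hq` makes the loss from roots and zero multipliers at most 1/600, so the vertical gain is at
least 1/150 - 1/600 = 1/200 of the perturbed set; `hS` makes this exceed δ + ε'. `hδ'` pays for
cubes of size at most 8 on the perturbed fibres, and `hε` pays for the progressions with dependent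
functionals. -/
theorem GapFunction.step {U K : Type*} [AddCommGroup U] [Module (ZMod p) U] [Fintype U] [Field K]
    [Fintype K] [Algebra (ZMod p) K] {f : U × K × K × K → ℝ} {R : Finset U} {c δ ε ε' δ' : ℝ}
    (hf : GapFunction p f R c δ ε) (hp : Odd p) (hc : 1 ≤ c) (hc' : c ≤ 4 / 3)
    {τ : Module.Dual (ZMod p) K} (hτ : τ ≠ 0) {θ : U →ₗ[ZMod p] K} (hθ : Function.Injective θ)
    {n : ℕ} (hn : 3 ≤ n) (hq : 2400 * (n + 1) ≤ Fintype.card K) {S : Finset U} (hSR : S ⊆ R)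
    (hS : 200 * (δ + ε') * Fintype.card U ≤ S.card)
    (hδ' : δ * Fintype.card U + 8 * S.card ≤ δ' * Fintype.card U)
    (hε : 16 * (p : ℝ) ^ 3 ≤ (ε - ε') * Fintype.card K) :
    GapFunction p (perturb f (univ.filter fun x : U × K × K × K => x.1 ∈ S)
      (hashFunctional τ θ n)) ((R \ S) ×ˢ univ) c δ' ε' := by
  set X : Finset (U × K × K × K) := univ.filter fun x => x.1 ∈ S with hXdef
  have hX : ∀ x ∈ X, f x = c := fun x hx => hf.core x (hSR (mem_filter.1 hx).2)
  have hc0 : 0 ≤ c := by linarith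
  set q : ℝ := (Fintype.card K : ℝ) with hqdef
  have hq0 : 0 ≤ q := by positivity
  have hV : (Fintype.card (U × K × K × K) : ℝ) = Fintype.card U * q ^ 3 := by
    simp only [Fintype.card_prod, Nat.cast_mul]
    ring
  have hXc : (X.card : ℝ) = S.card * q ^ 3 := by
    have : X = S ×ˢ univ := by
      ext x
      simp [X]
    rw [this, card_product, card_univ]
    simp only [Fintype.card_prod, Nat.cast_mul]
    ring
  have hU : (0 : ℝ) ≤ Fintype.card U := by positivity
  have hW : (0 : ℝ) ≤ Fintype.card (Fin n → K) := by positivity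
  refine ⟨perturb_nonneg hp hf.nonneg, perturb_le_two hp hf.le_two hc0 hc' hX,
    card_le_sum_perturb hp hf.nonneg hf.mass, ?_, ?_, ?_, ?_, ?_⟩
  · refine (sum_perturb_cube_le hp hf.nonneg hf.le_two hc0 hc' hX).trans ?_
    rw [Fintype.card_prod, Nat.cast_mul, ← mul_assoc]
    refine mul_le_mul_of_nonneg_right ?_ hW
    have := hf.cube
    rw [hV] at this ⊢
    rw [hXc]
    have := mul_le_mul_of_nonneg_right hδ' (pow_nonneg hq0 3)
    linarith
  · rintro ⟨a, e⟩ hd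
    rw [Fintype.card_prod, Nat.cast_mul, ← mul_assoc]
    by_cases ha : a = 0
    · subst ha
      have he : e ≠ 0 := fun h => hd (by rw [h]; rfl)
      refine (apSumAt_perturb_vertical_le hp hc hX (g := X.card / 200) (by positivity) ?_).trans ?_
      · refine (sum_gapCorrelation_hash_le hp hτ (by omega) S he).trans ?_
        rw [hXc]
        have : 4 * ((n : ℝ) + 1) * q ^ 2 ≤ q ^ 3 / 600 := by
          have : (2400 * (n + 1) : ℝ) ≤ q := by
            rw [hqdef]
            exact_mod_cast hq
          nlinarith [mul_le_mul_of_nonneg_right this (sq_nonneg q)]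
        have := mul_le_mul_of_nonneg_left this (Nat.cast_nonneg (α := ℝ) S.card)
        linarith
      · refine mul_le_mul_of_nonneg_right ?_ hW
        have := hf.cube
        rw [hV] at this ⊢
        rw [hXc]
        have := mul_le_mul_of_nonneg_right hS (pow_nonneg hq0 3)
        linarith
    · refine (apSumAt_perturb_le hp hf.nonneg hf.le_two hc0 hc' hX a e).trans ?_
      refine mul_le_mul_of_nonneg_right ?_ hW
      have h1 := hf.progressions a ha
      have h2 : ((univ.filter fun x => ¬ IndepAlong X (hashFunctional τ θ n) a x).card : ℝ)
          ≤ (p ^ 3 + 6) * (Fintype.card U * q ^ 2) := by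
        rw [hqdef]
        exact_mod_cast card_not_indepAlong_hash_le hp hτ hn hθ X ha
      have h3 : (6 : ℝ) ≤ (p : ℝ) ^ 3 := by
        have : (2 : ℝ) ≤ p := by exact_mod_cast (Fact.out : p.Prime).two_le
        calc (6 : ℝ) ≤ 2 ^ 3 := by norm_num
          _ ≤ _ := by gcongr
      have h4 : (0 : ℝ) ≤ Fintype.card U * q ^ 2 := by positivity
      rw [hV] at h1 ⊢
      have h5 := mul_le_mul_of_nonneg_right hε h4
      have h6 := mul_le_mul_of_nonneg_right h3 h4
      linarith
  · rintro ⟨x, w⟩ hx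
    simp only [mem_product, mem_univ, and_true, mem_sdiff] at hx
    have hxX : x ∉ X := fun h => hx.2 (mem_filter.1 h).2
    simp only [perturb, hxX, if_false, mul_one]
    exact hf.core x hx.1
  · rintro ⟨x, w⟩ hx
    simp only [mem_product, mem_univ, and_true, mem_sdiff] at hx
    by_cases hxS : x.1 ∈ S
    · have hxX : x ∈ X := mem_filter.2 ⟨mem_univ _, hxS⟩
      simp only [perturb, hxX, if_true]
      rw [hX x hxX]
      rcases gapWeight_eq_or (hashFunctional τ θ n x w) with h | h <;> simp [h]
    · have hxX : x ∉ X := fun h => hxS (mem_filter.1 h).2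
      simp only [perturb, hxX, if_false, mul_one]
      exact hf.rest x fun h => hx ⟨h, hxS⟩
  · rw [hV, card_product, card_univ, Nat.cast_mul, card_sdiff_of_subset hSR,
      Nat.cast_sub (card_le_card hSR)]
    have hcK : (Fintype.card (K × K × K) : ℝ) = q ^ 3 := by
      simp only [Fintype.card_prod, Nat.cast_mul]
      ring
    rw [hcK, ← mul_assoc]
    refine mul_le_mul_of_nonneg_right ?_ (pow_nonneg hq0 3)
    have := hf.size
    have : (0 : ℝ) ≤ S.card := by positivity
    linarith

/-- The existence of a gap function on some space of the form `U × Z` with `dim Z = 3 k` and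
`dim U ≤ k`. -/
def HasGapFunction (p k : ℕ) [Fact p.Prime] (c δ ε : ℝ) : Prop :=
  ∃ (U Z : Type) (_ : AddCommGroup U) (_ : Module (ZMod p) U) (_ : Fintype U)
    (_ : AddCommGroup Z) (_ : Module (ZMod p) Z) (_ : Fintype Z) (f : U × Z → ℝ) (R : Finset U),
    Module.finrank (ZMod p) U ≤ k ∧ Module.finrank (ZMod p) Z = 3 * k ∧
      1 ≤ δ * Fintype.card U ∧ GapFunction p f R c δ ε

/-- One iteration, for any choice `S` of the set of fibres that are perturbed. -/
theorem GapFunction.exists_step {U Z : Type} [AddCommGroup U] [Module (ZMod p) U] [Fintype U]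
    [AddCommGroup Z] [Module (ZMod p) Z] [Fintype Z] {f : U × Z → ℝ} {R : Finset U}
    {c δ ε ε' δ' : ℝ} (hf : GapFunction p f R c δ ε) {k D : ℕ} (hk : 1 ≤ k)
    (hU : Module.finrank (ZMod p) U ≤ k) (hZ : Module.finrank (ZMod p) Z = 3 * k)
    (hp : Odd p) (hc : 1 ≤ c) (hc' : c ≤ 4 / 3) (hD : 1 ≤ D)
    (hq : 2400 * (3 * D + 1) ≤ p ^ k) {S : Finset U} (hSR : S ⊆ R)
    (hS : 200 * (δ + ε') * Fintype.card U ≤ S.card)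
    (hδ' : δ * Fintype.card U + 8 * S.card ≤ δ' * Fintype.card U)
    (hε : 16 * (p : ℝ) ^ 3 ≤ (ε - ε') * (p : ℝ) ^ k) :
    ∃ (U' Z' : Type) (_ : AddCommGroup U') (_ : Module (ZMod p) U') (_ : Fintype U')
      (_ : AddCommGroup Z') (_ : Module (ZMod p) Z') (_ : Fintype Z') (f' : U' × Z' → ℝ)
      (g : U' → U), Module.finrank (ZMod p) U' ≤ 4 * k ∧
      Module.finrank (ZMod p) Z' = 3 * (D * k) ∧ Fintype.card U ≤ Fintype.card U' ∧
      GapFunction p f' (univ.filter fun x => g x ∈ R \ S) c δ' ε' := by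
  let K := GaloisField p k
  let _ : Fintype K := Fintype.ofFinite K
  have hk0 : k ≠ 0 := by omega
  have hKf : Module.finrank (ZMod p) K = k := GaloisField.finrank p hk0
  have hKc : Fintype.card K = p ^ k := by
    rw [← Nat.card_eq_fintype_card]
    exact GaloisField.card p k hk0
  have hK3 : Module.finrank (ZMod p) (K × K × K) = 3 * k := by
    rw [Module.finrank_prod, Module.finrank_prod, hKf]
    ring
  let e : (K × K × K) ≃ₗ[ZMod p] Z := LinearEquiv.ofFinrankEq _ _ (by rw [hK3, hZ])
  obtain ⟨θ, hθ⟩ : ∃ θ : U →ₗ[ZMod p] K, Function.Injective θ :=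
    finrank_le_iff_exists_linearMap.1 (by rw [hKf]; exact hU)
  obtain ⟨τ, hτ⟩ : ∃ τ : Module.Dual (ZMod p) K, τ ≠ 0 := exists_ne 0
  -- Taking 3D coefficients gives the new second factor dimension 3(Dk), so that at the next step it
  -- can be identified with the cube of the field of degree Dk.
  have hn : 3 ≤ 3 * D := by omega
  have h := (hf.transport e.toAddEquiv).step hp hc hc' hτ hθ hn
    (by rw [hKc]; exact hq) hSR hS hδ' (by rw [hKc]; exact_mod_cast hε)
  have hR : (R \ S) ×ˢ univ = univ.filter fun x : U × K × K × K => x.1 ∈ R \ S := by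
    ext x
    simp
  rw [hR] at h
  refine ⟨U × K × K × K, Fin (3 * D) → K, inferInstance, inferInstance, inferInstance,
    inferInstance, inferInstance, inferInstance,
    perturb (fun x => f (x.1, e.toAddEquiv x.2)) (univ.filter fun x => x.1 ∈ S)
      (hashFunctional τ θ (3 * D)), Prod.fst, ?_, ?_, ?_, h⟩
  · rw [Module.finrank_prod, hK3]
    omega
  · rw [Module.finrank_pi_fintype]
    simp [hKf]
    ring
  · rw [Fintype.card_prod]
    exact Nat.le_mul_of_pos_right _ Fintype.card_pos

theorem HasGapFunction.step {k D : ℕ} {c δ ε ε' : ℝ} (h : HasGapFunction p k c δ ε) (hp : Odd p)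
    (hk : 1 ≤ k) (hc : 1 ≤ c) (hc' : c ≤ 4 / 3) (hD : 4 ≤ D) (hq : 2400 * (3 * D + 1) ≤ p ^ k)
    (hδ : 0 ≤ δ) (hδ1 : δ ≤ 1 / 1024) (hε' : ε' ≤ δ)
    (hε : 16 * (p : ℝ) ^ 3 ≤ (ε - ε') * (p : ℝ) ^ k) :
    HasGapFunction p (D * k) c (8192 * δ) ε' := by
  obtain ⟨U, Z, _, _, _, _, _, _, f, R, hU, hZ, hδU, hf⟩ := h
  have hU0 : (0 : ℝ) < Fintype.card U := by exact_mod_cast Fintype.card_pos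
  -- As ε' ≤ δ, a set of density 400δ suffices for the vertical gain. Rounding up is harmless
  -- because 1 ≤ δ|U|, and 1 + 8 · 800 ≤ 8192 gives the new δ.
  have hle : ⌈400 * δ * Fintype.card U⌉₊ ≤ R.card := by
    rw [Nat.ceil_le]
    refine le_trans ?_ hf.size
    refine mul_le_mul_of_nonneg_right ?_ hU0.le
    linarith
  obtain ⟨S, hSR, hSc⟩ := Finset.exists_subset_card_eq hle
  have hS1 : 400 * δ * Fintype.card U ≤ S.card := by
    rw [hSc]
    exact Nat.le_ceil _
  have hS2 : (S.card : ℝ) ≤ 800 * δ * Fintype.card U := by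
    rw [hSc]
    have := (Nat.ceil_lt_add_one (a := 400 * δ * (Fintype.card U : ℝ)) (by positivity)).le
    linarith
  obtain ⟨U', Z', _, _, _, _, _, _, f', g, hU', hZ', hcard, hf'⟩ :=
    hf.exists_step hk hU hZ hp hc hc' (by omega) hq hSR (ε' := ε') (δ' := 8192 * δ)
      (by nlinarith) (by nlinarith) hε
  refine ⟨U', Z', inferInstance, inferInstance, inferInstance, inferInstance, inferInstance,
    inferInstance, f', _, ?_, hZ', ?_, hf'⟩
  · exact hU'.trans (Nat.mul_le_mul_right _ hD)
  · have : (Fintype.card U : ℝ) ≤ Fintype.card U' := by exact_mod_cast hcard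
    nlinarith

/-- Perturbing all the remaining fibres gives a multiple of the indicator function of a set. -/
theorem HasGapFunction.exists_dim_not_hasPopularDifferences {k D : ℕ} {c δ ε ε' η : ℝ}
    (h : HasGapFunction p k c δ ε) (hp : Odd p) (hk : 1 ≤ k) (hc : 1 ≤ c) (hc' : c ≤ 4 / 3)
    (hD : 1 ≤ D) (hq : 2400 * (3 * D + 1) ≤ p ^ k) (hδ1 : δ ≤ 1 / 1024) (hε' : ε' ≤ δ)
    (hε : 16 * (p : ℝ) ^ 3 ≤ (ε - ε') * (p : ℝ) ^ k) (hη : 8 * η < ε') (hη0 : 0 ≤ η) :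
    ∃ n, D * k ≤ n ∧ ¬ HasPopularDifferences p η n := by
  obtain ⟨U, Z, _, _, _, _, _, _, f, R, hU, hZ, hδU, hf⟩ := h
  have hU0 : (0 : ℝ) < Fintype.card U := by exact_mod_cast Fintype.card_pos
  have hRU : (R.card : ℝ) ≤ Fintype.card U := by exact_mod_cast Finset.card_le_univ R
  obtain ⟨U', Z', _, _, _, _, _, _, f', g, hU', hZ', hcard, hf'⟩ :=
    hf.exists_step hk hU hZ hp hc hc' (by omega) hq (Finset.Subset.refl R) (ε' := ε')
      (δ' := δ + 8) (by
        refine le_trans ?_ hf.size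
        refine mul_le_mul_of_nonneg_right ?_ hU0.le
        linarith) (by linarith) hε
  simp only [sdiff_self, Finset.bot_eq_empty, notMem_empty, filter_false] at hf'
  set C := c * gapHeight p with hC
  obtain ⟨hg1, hg2, -, -, -⟩ := gapHeight_bounds (p := p) hp
  have hC1 : 1 ≤ C := by nlinarith
  have hC2 : C ≤ 2 := by nlinarith
  -- No unperturbed fibre remains, so the function is `C` times the indicator of a set.
  have hval : ∀ x, f' x = 0 ∨ f' x = C := fun x => hf'.rest x (notMem_empty _)
  let N := Module.finrank (ZMod p) (U' × Z')
  let e : (Fin N → ZMod p) ≃ₗ[ZMod p] U' × Z' := LinearEquiv.ofFinrankEq _ _ (by simp [N])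
  refine ⟨N, ?_, ?_⟩
  · simp only [N, Module.finrank_prod, hZ']
    omega
  intro hpop
  let A : Finset (Fin N → ZMod p) := univ.filter fun x => f' (e x) = C
  have hfA : ∀ x, f' (e x) = C * if x ∈ A then 1 else 0 := by
    intro x
    rcases hval (e x) with h | h
    · have : x ∉ A := fun hx => by
        have := (mem_filter.1 hx).2
        linarith
      simp [this, h]
    · have : x ∈ A := mem_filter.2 ⟨mem_univ _, h⟩
      simp [this, h]
  have hp0 : (0 : ℝ) < p := by exact_mod_cast (Fact.out : p.Prime).pos
  have hpN : (0 : ℝ) < (p : ℝ) ^ N := by positivity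
  have hcardV : (Fintype.card (U' × Z') : ℝ) = (p : ℝ) ^ N := by
    rw [← Fintype.card_congr e.toEquiv, card_fun_zmod]
    push_cast
    rfl
  have hmass : 1 ≤ C * setDensity p N A := by
    have h1 := hf'.mass
    rw [hcardV, ← Equiv.sum_comp e.toEquiv] at h1
    simp only [LinearEquiv.coe_toEquiv, hfA] at h1
    rw [← Finset.mul_sum, Finset.sum_boole, Finset.filter_mem_eq_inter, Finset.univ_inter] at h1
    rw [setDensity, ← mul_div_assoc, le_div_iff₀ hpN, one_mul]
    exact h1
  obtain ⟨d, hd, hle⟩ := hpop A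
  have hap : C ^ 3 * apDensity p N A d ≤ 1 - ε' := by
    have h1 := hf'.progressions (e d) (by simpa using hd)
    unfold apSumAt at h1
    rw [hcardV, ← Equiv.sum_comp e.toEquiv] at h1
    simp only [LinearEquiv.coe_toEquiv, ← map_nsmul, ← map_add, hfA] at h1
    rw [apDensity, ← mul_div_assoc, div_le_iff₀ hpN]
    refine le_trans (le_of_eq ?_) h1
    rw [Finset.card_filter, ← Finset.sum_filter_add_sum_filter_not univ (· ∈ A)]
    have e1 : ∑ x with x ∉ A, C * (if x ∈ A then (1 : ℝ) else 0)
        * (C * if x + d ∈ A then 1 else 0) * (C * if x + 2 • d ∈ A then 1 else 0) = 0 :=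
      Finset.sum_eq_zero fun x hx => by simp [(Finset.mem_filter.1 hx).2]
    rw [e1, add_zero, Finset.filter_mem_eq_inter, Finset.univ_inter]
    push_cast
    rw [Finset.mul_sum]
    refine Finset.sum_congr rfl fun x hx => ?_
    simp only [hx, if_true, ite_and]
    split_ifs <;> simp
    ring
  have hC3 : 0 < C ^ 3 := by positivity
  -- Undoing the normalisation scales the deficit by C³, hence the hypothesis 8η < ε'.
  have hC8 : C ^ 3 ≤ 8 := by
    calc C ^ 3 ≤ 2 ^ 3 := by gcongr
      _ = 8 := by norm_num
  have h1 : 1 ≤ C ^ 3 * setDensity p N A ^ 3 := by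
    rw [← mul_pow]
    exact one_le_pow₀ hmass
  have h2 := mul_le_mul_of_nonneg_left hle hC3.le
  have h3 := mul_le_mul_of_nonneg_right hC8 hη0
  linarith

end GapFunction

/-! ### The space with the origin removed -/

section Puncture

variable {p : ℕ} [Fact p.Prime] {V : Type*} [AddCommGroup V] [Module (ZMod p) V] [Fintype V]

/-- The value of the normalised indicator function of the nonzero elements of a set of size `N`. -/
noncomputable def punctureHeight (N : ℕ) : ℝ := N / (N - 1)

/-- The normalised indicator function of the set of nonzero elements. -/
noncomputable def puncture (V : Type*) [AddCommGroup V] [Fintype V] (x : V) : ℝ :=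
  if x = 0 then 0 else punctureHeight (Fintype.card V)

theorem punctureHeight_bounds {N : ℕ} (hN : 5 ≤ N) :
    1 ≤ punctureHeight N ∧ punctureHeight N ≤ 4 / 3 := by
  have h : (5 : ℝ) ≤ N := by exact_mod_cast hN
  have h1 : (0 : ℝ) < N - 1 := by linarith
  unfold punctureHeight
  rw [le_div_iff₀ h1, div_le_iff₀ h1]
  constructor <;> linarith

omit [Module (ZMod p) V] [Fact p.Prime] in
theorem sum_comp_puncture (F : ℝ → ℝ) (h0 : F 0 = 0) :
    ∑ x, F (puncture V x) = (Fintype.card V - 1) * F (punctureHeight (Fintype.card V)) := by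
  have h : ∀ x : V, F (puncture V x)
      = F (punctureHeight (Fintype.card V)) - if x = 0 then F (punctureHeight (Fintype.card V))
        else 0 := by
    intro x
    unfold puncture
    split_ifs <;> simp [h0]
  simp_rw [h, Finset.sum_sub_distrib, Finset.sum_ite_eq' univ (0 : V)]
  simp
  ring

theorem sum_puncture (hN : 5 ≤ Fintype.card V) : ∑ x, puncture V x = Fintype.card V := by
  have h : (5 : ℝ) ≤ Fintype.card V := by exact_mod_cast hN
  have h1 : (Fintype.card V : ℝ) - 1 ≠ 0 := by linarith
  have := sum_comp_puncture (V := V) (fun t => t) rfl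
  rw [this, punctureHeight]
  field_simp

theorem sum_puncture_cube_le (hN : 5 ≤ Fintype.card V) :
    ∑ x, puncture V x ^ 3 ≤ Fintype.card V + 3 := by
  have h : (5 : ℝ) ≤ Fintype.card V := by exact_mod_cast hN
  have h1 : 0 < (Fintype.card V : ℝ) - 1 := by linarith
  rw [sum_comp_puncture (V := V) (fun t => t ^ 3) (by norm_num), punctureHeight]
  set N : ℝ := (Fintype.card V : ℝ)
  have : (N - 1) * (N / (N - 1)) ^ 3 = N ^ 3 / (N - 1) ^ 2 := by field_simp
  rw [this, div_le_iff₀ (by positivity)]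
  nlinarith

/-- Removing the origin kills exactly three base points for each difference. Normalising by (N/(N -
1))³ cancels the first-order effect and leaves a deficit (3N - 1)/(N - 1)³ ≥ 2/N². -/
theorem apSumAt_puncture_le (hp : Odd p) (hN : 5 ≤ Fintype.card V) {d : V} (hd : d ≠ 0) :
    apSumAt (puncture V) d ≤ (1 - 2 / (Fintype.card V : ℝ) ^ 2) * Fintype.card V := by
  have h : (5 : ℝ) ≤ Fintype.card V := by exact_mod_cast hN
  have h1 : 0 < (Fintype.card V : ℝ) - 1 := by linarith
  have h2 : 2 • d ≠ 0 := by
    rw [two_nsmul_eq (p := p)]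
    exact smul_ne_zero (two_ne_zero_zmod hp) hd
  have hE : ({0, -d, -(2 • d)} : Finset V).card = 3 := by
    rw [Finset.card_eq_three]
    refine ⟨0, -d, -(2 • d), ?_, ?_, ?_, rfl⟩
    · simpa [eq_comm] using hd
    · intro h
      exact h2 (by simpa using h.symm)
    · intro h
      rw [neg_inj, two_smul] at h
      exact hd (by simpa using h.symm)
  have hterm : ∀ x : V, puncture V x * puncture V (x + d) * puncture V (x + 2 • d)
      = if x ∈ ({0, -d, -(2 • d)} : Finset V) then 0
        else punctureHeight (Fintype.card V) ^ 3 := by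
    intro x
    unfold puncture
    simp only [mem_insert, mem_singleton, add_eq_zero_iff_eq_neg]
    split_ifs <;> simp_all
    ring
  unfold apSumAt
  simp_rw [hterm]
  have hsplit : ∀ x : V, (if x ∈ ({0, -d, -(2 • d)} : Finset V) then 0
      else punctureHeight (Fintype.card V) ^ 3) = punctureHeight (Fintype.card V) ^ 3
      - if x ∈ ({0, -d, -(2 • d)} : Finset V) then punctureHeight (Fintype.card V) ^ 3 else 0 := by
    intro x
    split_ifs <;> simp
  rw [Finset.sum_congr rfl fun x _ => hsplit x, Finset.sum_sub_distrib, Finset.sum_ite_mem,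
    Finset.univ_inter, sum_const, sum_const, hE, card_univ, punctureHeight]
  simp only [nsmul_eq_mul]
  set N : ℝ := (Fintype.card V : ℝ)
  have e1 : N * (N / (N - 1)) ^ 3 - ((3 : ℕ) : ℝ) * (N / (N - 1)) ^ 3
      = N ^ 3 * (N - 3) / (N - 1) ^ 3 := by
    push_cast
    field_simp
  have e2 : (1 - 2 / N ^ 2) * N = (N ^ 2 - 2) / N := by
    have : N ≠ 0 := by linarith
    field_simp
  rw [e1, e2, div_le_div_iff₀ (by positivity) (by linarith)]
  have : 0 ≤ N ^ 2 * (N - 5) := by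
    have : 0 ≤ N - 5 := by linarith
    positivity
  nlinarith

end Puncture

/-! ### The initial function over K⁴ -/

section FirstLevel

variable {p : ℕ} [Fact p.Prime] {K : Type*} [Field K] [Fintype K] [Algebra (ZMod p) K]

/-- The points of a cone over the graph of an anisotropic quadratic form, away from the
coordinate hyperplanes. -/
noncomputable def coneSet (ω : K) : Finset (K × K × K × K) :=
  univ.filter fun x => x.2.1 ≠ 0 ∧ x.2.2.1 ≠ 0 ∧ x.2.2.2 = x.2.1 ^ 2 - ω * x.2.2.1 ^ 2

/-- The functional attached to a point of `K⁴`: the two coordinates and their product are used as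
multipliers for three polynomials. -/
noncomputable def coneFunctional (τ : Module.Dual (ZMod p) K) (n : ℕ) (x : K × K × K × K) :
    Module.Dual (ZMod p) ((Fin n → K) × (Fin n → K) × (Fin n → K)) :=
  (evalFunctional τ n x.2.1 x.1).coprod ((evalFunctional τ n x.2.2.1 x.1).coprod
    (evalFunctional τ n (x.2.1 * x.2.2.1) x.1))

variable {τ : Module.Dual (ZMod p) K} {n : ℕ} {ω : K}

omit [Fintype K] in
theorem coneFunctional_apply (x : K × K × K × K) (w : (Fin n → K) × (Fin n → K) × (Fin n → K)) :
    coneFunctional τ n x w = τ (x.2.1 * evalAt n x.1 w.1 + x.2.2.1 * evalAt n x.1 w.2.1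
      + x.2.1 * x.2.2.1 * evalAt n x.1 w.2.2) := by
  simp [coneFunctional, evalFunctional_apply, add_assoc]

-- Two vectors (l, m, lm) with nonzero entries are proportional only if they are equal: combining
-- the three relations gives a l m (a + b) = 0.
omit [Fintype K] [Algebra (ZMod p) K] [Fact p.Prime] in
theorem eq_zero_or_eq_of_two_term {a b l l' m m' : K} (h : a ≠ 0 → l ≠ 0 ∧ m ≠ 0)
    (h' : b ≠ 0 → l' ≠ 0 ∧ m' ≠ 0) (hl : a * l + b * l' = 0) (hm : a * m + b * m' = 0)
    (hlm : a * (l * m) + b * (l' * m') = 0) :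
    a = 0 ∧ b = 0 ∨ a ≠ 0 ∧ b ≠ 0 ∧ l = l' ∧ m = m' := by
  by_cases ha : a = 0
  · left
    refine ⟨ha, ?_⟩
    by_contra hb
    rw [ha, zero_mul, zero_add] at hl
    exact (mul_ne_zero hb (h' hb).1) hl
  by_cases hb : b = 0
  · exfalso
    rw [hb, zero_mul, add_zero] at hl
    exact (mul_ne_zero ha (h ha).1) hl
  right
  obtain ⟨h1, h2⟩ := h ha
  have h3 : a * l * m * (a + b) = 0 := by
    linear_combination a * m * hl - b * l' * hm + b * hlm
  have h4 : a + b = 0 := by simpa [ha, h1, h2] using h3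
  refine ⟨ha, hb, ?_, ?_⟩
  · refine mul_left_cancel₀ ha ?_
    linear_combination hl - l' * h4
  · refine mul_left_cancel₀ ha ?_
    linear_combination hm - m' * h4

-- Three points of the quadric in progression would give a² = ω b² by second differences, forcing a
-- = b = 0 since ω is not a square, and then e = 0. So at most two coefficients survive, and the
-- two-term case forces the corresponding points to coincide.
omit [Fintype K] in
theorem eq_zero_of_cone_relations (h2 : (2 : K) ≠ 0) (hω : ¬ IsSquare ω) {l m s a b e : K}
    (hd : a ≠ 0 ∨ b ≠ 0 ∨ e ≠ 0) {c : Fin 3 → K}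
    (hX : ∀ j : Fin 3, c j ≠ 0 → l + (j : ℕ) * a ≠ 0 ∧ m + (j : ℕ) * b ≠ 0 ∧
      s + (j : ℕ) * e = (l + (j : ℕ) * a) ^ 2 - ω * (m + (j : ℕ) * b) ^ 2)
    (hl : ∑ j, c j * (l + (j : ℕ) * a) = 0) (hm : ∑ j, c j * (m + (j : ℕ) * b) = 0)
    (hlm : ∑ j, c j * ((l + (j : ℕ) * a) * (m + (j : ℕ) * b)) = 0) : c = 0 := by
  have hpair : ∀ {i j : Fin 3}, ((j : ℕ) : K) - (i : ℕ) ≠ 0 → c i ≠ 0 → c j ≠ 0 →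
      l + (i : ℕ) * a = l + (j : ℕ) * a → m + (i : ℕ) * b = m + (j : ℕ) * b → False := by
    intro i j hij hi hj hlij hmij
    have ha : a = 0 := by
      refine (mul_eq_zero.1 ?_).resolve_left hij
      linear_combination -hlij
    have hb : b = 0 := by
      refine (mul_eq_zero.1 ?_).resolve_left hij
      linear_combination -hmij
    have he : e = 0 := by
      refine (mul_eq_zero.1 ?_).resolve_left hij
      have h1 := (hX i hi).2.2
      have h3 := (hX j hj).2.2
      rw [← hlij, ← hmij, ← h1] at h3
      linear_combination h3
    simp [ha, hb, he] at hd
  rw [Fin.sum_univ_three] at hl hm hlm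
  have x0 := hX 0
  have x1 := hX 1
  have x2 := hX 2
  have p01 := @hpair 0 1
  have p02 := @hpair 0 2
  have p12 := @hpair 1 2
  simp only [Fin.val_zero, Fin.val_one, Fin.val_two, Nat.cast_zero, Nat.cast_one, Nat.cast_ofNat,
    zero_mul, one_mul, add_zero, sub_zero] at *
  have hz : c 0 = 0 ∨ c 1 = 0 ∨ c 2 = 0 := by
    by_contra! hne
    obtain ⟨n0, n1, n2⟩ := hne
    have hab : a ^ 2 = ω * b ^ 2 := by
      refine mul_left_cancel₀ h2 ?_
      linear_combination 2 * (x1 n1).2.2 - (x0 n0).2.2 - (x2 n2).2.2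
    have hb : b = 0 := by
      by_contra hb
      refine hω ⟨a / b, ?_⟩
      field_simp
      exact hab.symm
    have ha : a = 0 := by simpa [hb] using hab
    exact p01 one_ne_zero n0 n1 (by simp [ha]) (by simp [hb])
  have hfin : c 0 = 0 ∧ c 1 = 0 ∧ c 2 = 0 := by
    rcases hz with h | h | h
    · rw [h] at hl hm hlm
      simp only [zero_mul, zero_add] at hl hm hlm
      rcases eq_zero_or_eq_of_two_term (fun h => ⟨(x1 h).1, (x1 h).2.1⟩)
        (fun h => ⟨(x2 h).1, (x2 h).2.1⟩) hl hm hlm with ⟨h3, h4⟩ | ⟨h3, h4, h5, h6⟩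
      · exact ⟨h, h3, h4⟩
      · exact (p12 (by norm_num) h3 h4 h5 h6).elim
    · rw [h] at hl hm hlm
      simp only [zero_mul, add_zero] at hl hm hlm
      rcases eq_zero_or_eq_of_two_term (fun h => ⟨(x0 h).1, (x0 h).2.1⟩)
        (fun h => ⟨(x2 h).1, (x2 h).2.1⟩) hl hm hlm with ⟨h3, h4⟩ | ⟨h3, h4, h5, h6⟩
      · exact ⟨h3, h, h4⟩
      · exact (p02 h2 h3 h4 h5 h6).elim
    · rw [h] at hl hm hlm
      simp only [zero_mul, add_zero] at hl hm hlm
      rcases eq_zero_or_eq_of_two_term (fun h => ⟨(x0 h).1, (x0 h).2.1⟩)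
        (fun h => ⟨(x1 h).1, (x1 h).2.1⟩) hl hm hlm with ⟨h3, h4⟩ | ⟨h3, h4, h5, h6⟩
      · exact ⟨h3, h4, h⟩
      · exact (p01 one_ne_zero h3 h4 h5 h6).elim
  ext j
  fin_cases j
  exacts [hfin.1, hfin.2.1, hfin.2.2]

/-- The initial deficit is too small to tolerate exceptional points, so independence is needed at
every `x`. If the first coordinate moves, the evaluation points are distinct; otherwise the problem
reduces to the relations among l, m and lm on the quadric. -/
theorem indepAlong_cone (hp : Odd p) (hτ : τ ≠ 0) (hn : 3 ≤ n) (hω : ¬ IsSquare ω)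
    {d : K × K × K × K} (hd : d ≠ 0) (x : K × K × K × K) :
    IndepAlong (coneSet ω) (coneFunctional τ n) d x := by
  have h2 : (2 : K) ≠ 0 := two_ne_zero_of_algebra hp
  refine indepAlong_of_forall fun c hc0 hsum => ?_
  have hmem : ∀ j : Fin 3, c j ≠ 0 → x + (j : ℕ) • d ∈ coneSet ω := fun j hj => by
    by_contra h
    exact hj (hc0 j h)
  have hl : ∑ j : Fin 3, evalFunctional τ n (c j • (x + (j : ℕ) • d).2.1) (x + (j : ℕ) • d).1
      = 0 := by
    refine LinearMap.ext fun w => ?_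
    have := LinearMap.congr_fun hsum (w, 0, 0)
    simp only [LinearMap.sum_apply, LinearMap.smul_apply, coneFunctional_apply, map_zero, mul_zero,
      add_zero, LinearMap.zero_apply] at this
    refine Eq.trans ?_ this
    rw [LinearMap.sum_apply]
    simp only [← smul_evalFunctional]
    rfl
  have hm : ∑ j : Fin 3, evalFunctional τ n (c j • (x + (j : ℕ) • d).2.2.1) (x + (j : ℕ) • d).1
      = 0 := by
    refine LinearMap.ext fun w => ?_
    have := LinearMap.congr_fun hsum (0, w, 0)
    simp only [LinearMap.sum_apply, LinearMap.smul_apply, coneFunctional_apply, map_zero, mul_zero,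
      add_zero, zero_add, LinearMap.zero_apply] at this
    refine Eq.trans ?_ this
    rw [LinearMap.sum_apply]
    simp only [← smul_evalFunctional]
    rfl
  have hlm : ∑ j : Fin 3, evalFunctional τ n
      (c j • ((x + (j : ℕ) • d).2.1 * (x + (j : ℕ) • d).2.2.1)) (x + (j : ℕ) • d).1 = 0 := by
    refine LinearMap.ext fun w => ?_
    have := LinearMap.congr_fun hsum (0, 0, w)
    simp only [LinearMap.sum_apply, LinearMap.smul_apply, coneFunctional_apply, map_zero, mul_zero,
      add_zero, zero_add, LinearMap.zero_apply] at this
    refine Eq.trans ?_ this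
    rw [LinearMap.sum_apply]
    simp only [← smul_evalFunctional]
    rfl
  by_cases hy : d.1 = 0
  · have hy' : ∀ j : Fin 3, (x + (j : ℕ) • d).1 = x.1 := by simp [hy]
    simp only [hy', sum_evalFunctional] at hl hm hlm
    rw [evalFunctional_eq_zero_iff hτ (by omega)] at hl hm hlm
    simp only [Prod.snd_add, Prod.fst_add, Prod.smul_fst, Prod.smul_snd] at hl hm hlm
    simp only [nsmul_eq_mul] at hl hm hlm
    simp only [Algebra.smul_def] at hl hm hlm
    have := eq_zero_of_cone_relations (c := fun j => algebraMap (ZMod p) K (c j)) (s := x.2.2.2)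
      (e := d.2.2.2) h2 hω ?_ ?_ hl hm hlm
    · ext j
      have := congrFun this j
      simpa using this
    · by_contra! h
      exact hd (Prod.ext hy (Prod.ext h.1 (Prod.ext h.2.1 h.2.2)))
    · intro j hj
      have := (mem_filter.1 (hmem j fun h => hj (by simp [h]))).2
      simp only [Prod.snd_add, Prod.fst_add, Prod.smul_fst, Prod.smul_snd] at this
      simpa only [nsmul_eq_mul] using this
  · have hinj : Function.Injective fun j : Fin 3 => (x + (j : ℕ) • d).1 := by
      refine injective_fin_three ?_ ?_ ?_ <;> simp only [Prod.fst_add, Prod.smul_fst] <;> intro h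
        <;> apply hy
      · simpa using h
      · have h := add_left_cancel h
        simp at h
        linear_combination -h
      · simpa [h2] using h
    have := eq_zero_of_sum_evalFunctional_eq_zero hτ (by simpa using hn) hinj hl
    ext j
    by_contra hj
    exact (smul_ne_zero hj (mem_filter.1 (hmem j hj)).2.1) (this j)

theorem sum_coneSet (F : K × K × K × K → ℝ) :
    ∑ x ∈ coneSet ω, F x = ∑ y, ∑ l ∈ univ.erase (0 : K), ∑ m ∈ univ.erase (0 : K),
      F (y, l, m, l ^ 2 - ω * m ^ 2) := by
  simp only [coneSet, Finset.sum_filter, Fintype.sum_prod_type, ite_and]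
  refine Finset.sum_congr rfl fun y _ => ?_
  rw [← Finset.sum_filter_add_sum_filter_not univ (· = (0 : K)), Finset.sum_eq_zero, zero_add,
    ← Finset.filter_ne' univ (0 : K)]
  · refine Finset.sum_congr rfl fun l hl => ?_
    rw [← Finset.sum_filter_add_sum_filter_not univ (· = (0 : K)), Finset.sum_eq_zero, zero_add]
    · refine Finset.sum_congr rfl fun m hm => ?_
      simp only [(mem_filter.1 hl).2, (mem_filter.1 hm).2, ne_eq, not_false_eq_true, if_true]
      simp
    · intro m hm
      simp [(mem_filter.1 hm).2]
  · intro l hl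
    simp [(mem_filter.1 hl).2]

theorem card_coneSet : ((coneSet ω).card : ℝ) = Fintype.card K * (Fintype.card K - 1) ^ 2 := by
  have h1 : 1 ≤ Fintype.card K := Fintype.card_pos
  have := sum_coneSet (ω := ω) fun _ => 1
  simp only [sum_const, nsmul_eq_mul, mul_one, card_erase_of_mem (mem_univ _), card_univ,
    Nat.cast_sub h1] at this
  rw [this]
  push_cast
  ring

/-- Averages over a bilinear family of arguments. -/
theorem sum_sum_gapCorrelation_bilinear_le (hp : Odd p) (hτ : τ ≠ 0) {A B C : K}
    (h : A ≠ 0 ∨ B ≠ 0 ∨ C ≠ 0) :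
    ∑ l, ∑ m, gapCorrelation p (τ (l * A + m * B + l * m * C))
      ≤ (Fintype.card K : ℝ) ^ 2 * (1 - 1 / 150) + 4 * Fintype.card K := by
  have hq : (0 : ℝ) ≤ Fintype.card K := by positivity
  have haff : ∀ s : K, ∀ e : K, e ≠ 0 → ∑ m, gapCorrelation p (τ (s + m * e))
      ≤ (Fintype.card K : ℝ) * (1 - 1 / 150) := by
    intro s e he
    rw [sum_comp_affine hτ s he]
    exact mul_le_mul_of_nonneg_left (sum_gapCorrelation_div_le hp) hq
  by_cases hBC : B = 0 ∧ C = 0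
  · obtain ⟨rfl, rfl⟩ := hBC
    have hA : A ≠ 0 := by simpa using h
    rw [Finset.sum_comm]
    have : ∀ m : K, ∑ l, gapCorrelation p (τ (l * A + m * 0 + l * m * 0))
        ≤ (Fintype.card K : ℝ) * (1 - 1 / 150) := by
      intro m
      simpa using haff 0 A hA
    refine (Finset.sum_le_sum fun m _ => this m).trans ?_
    simp only [sum_const, card_univ, nsmul_eq_mul]
    nlinarith
  · have : ∀ l : K, ∑ m, gapCorrelation p (τ (l * A + m * B + l * m * C))
        ≤ (Fintype.card K : ℝ) * (1 - 1 / 150)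
          + if B + l * C = 0 then 4 * (Fintype.card K : ℝ) else 0 := by
      intro l
      split_ifs with h0
      · have : ∑ m : K, gapCorrelation p (τ (l * A + m * B + l * m * C)) ≤ ∑ _m : K, (4 : ℝ) :=
          Finset.sum_le_sum fun l _ => gapCorrelation_le hp _
        simp only [sum_const, card_univ, nsmul_eq_mul] at this
        nlinarith
      · rw [add_zero]
        refine le_trans (le_of_eq ?_) (haff (l * A) _ h0)
        refine Finset.sum_congr rfl fun m _ => ?_
        congr 2
        ring
    refine (Finset.sum_le_sum fun l _ => this l).trans ?_
    rw [Finset.sum_add_distrib, ← Finset.sum_filter]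
    simp only [sum_const, card_univ, nsmul_eq_mul]
    -- For all other `l` the argument is a nonconstant affine function of `m`, hence
    -- equidistributed.
    have h1 : ((univ.filter fun l : K => B + l * C = 0).card : ℝ) ≤ 1 := by
      rw [← Nat.cast_one, Nat.cast_le, Finset.card_le_one]
      intro a ha b hb
      have ha := (mem_filter.1 ha).2
      have hb := (mem_filter.1 hb).2
      have hab : (a - b) * C = 0 := by linear_combination ha - hb
      rcases mul_eq_zero.1 hab with h | h
      · exact sub_eq_zero.1 h
      · rw [h, mul_zero, add_zero] at ha
        exact absurd ⟨ha, h⟩ hBC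
    nlinarith

theorem sum_gapCorrelation_cone_le (hp : Odd p) (hτ : τ ≠ 0)
    {w : (Fin n → K) × (Fin n → K) × (Fin n → K)} (hw : w ≠ 0) :
    ∑ x ∈ coneSet ω, gapCorrelation p (coneFunctional τ n x w)
      ≤ (Fintype.card K : ℝ) ^ 3 * (1 - 1 / 150) + 4 * (n + 1) * (Fintype.card K : ℝ) ^ 2 := by
  have hq : (0 : ℝ) ≤ Fintype.card K := by positivity
  let Z : K → Prop := fun y => evalAt n y w.1 = 0 ∧ evalAt n y w.2.1 = 0 ∧ evalAt n y w.2.2 = 0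
  have hZ : ((univ.filter Z).card : ℝ) ≤ n := by
    rw [Nat.cast_le]
    have hcases : w.1 ≠ 0 ∨ w.2.1 ≠ 0 ∨ w.2.2 ≠ 0 := by
      by_contra! h
      exact hw (Prod.ext h.1 (Prod.ext h.2.1 h.2.2))
    rcases hcases with h | h | h
    · refine le_trans (Finset.card_le_card fun y hy => ?_) (card_roots_evalAt_le h)
      exact mem_filter.2 ⟨mem_univ _, (mem_filter.1 hy).2.1⟩
    · refine le_trans (Finset.card_le_card fun y hy => ?_) (card_roots_evalAt_le h)
      exact mem_filter.2 ⟨mem_univ _, (mem_filter.1 hy).2.2.1⟩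
    · refine le_trans (Finset.card_le_card fun y hy => ?_) (card_roots_evalAt_le h)
      exact mem_filter.2 ⟨mem_univ _, (mem_filter.1 hy).2.2.2⟩
  have hy : ∀ y : K, ∑ l, ∑ m, gapCorrelation p (τ (l * evalAt n y w.1 + m * evalAt n y w.2.1
      + l * m * evalAt n y w.2.2)) ≤ (Fintype.card K : ℝ) ^ 2 * (1 - 1 / 150) + 4 * Fintype.card K
        + if Z y then 4 * (Fintype.card K : ℝ) ^ 2 else 0 := by
    intro y
    split_ifs with h
    · have : ∑ l, ∑ m, gapCorrelation p (τ (l * evalAt n y w.1 + m * evalAt n y w.2.1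
          + l * m * evalAt n y w.2.2)) ≤ ∑ _l : K, ∑ _m : K, (4 : ℝ) :=
        Finset.sum_le_sum fun l _ => Finset.sum_le_sum fun m _ => gapCorrelation_le hp _
      simp only [sum_const, card_univ, nsmul_eq_mul] at this
      nlinarith
    · rw [add_zero]
      refine sum_sum_gapCorrelation_bilinear_le hp hτ ?_
      by_contra! h'
      exact h h'
  rw [sum_coneSet]
  have hle : ∀ y : K, ∑ l ∈ univ.erase (0 : K), ∑ m ∈ univ.erase (0 : K),
      gapCorrelation p (coneFunctional τ n (y, l, m, l ^ 2 - ω * m ^ 2) w)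
      ≤ ∑ l, ∑ m, gapCorrelation p (τ (l * evalAt n y w.1 + m * evalAt n y w.2.1
      + l * m * evalAt n y w.2.2)) := by
    intro y
    simp only [coneFunctional_apply]
    refine le_trans (Finset.sum_le_sum fun l _ => Finset.sum_le_sum_of_subset_of_nonneg
      (Finset.subset_univ _) fun _ _ _ => gapCorrelation_nonneg hp _)
      (Finset.sum_le_sum_of_subset_of_nonneg (Finset.subset_univ _) fun _ _ _ =>
        Finset.sum_nonneg fun _ _ => gapCorrelation_nonneg hp _)
  refine (Finset.sum_le_sum fun y _ => (hle y).trans (hy y)).trans ?_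
  rw [Finset.sum_add_distrib, ← Finset.sum_filter]
  simp only [sum_const, card_univ, nsmul_eq_mul]
  nlinarith [mul_le_mul_of_nonneg_right hZ (sq_nonneg (Fintype.card K : ℝ))]

omit [Fintype K] in
theorem coneFunctional_ne_zero (hτ : τ ≠ 0) (hn : 1 ≤ n) {x : K × K × K × K} (hx : x.2.1 ≠ 0) :
    coneFunctional τ n x ≠ 0 := by
  intro h
  apply hx
  rw [← evalFunctional_eq_zero_iff hτ hn x.2.1 x.1]
  refine LinearMap.ext fun w => ?_
  have := LinearMap.congr_fun h (w, 0, 0)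
  simpa [coneFunctional_apply, evalFunctional_apply] using this

/-- The cone has about q³ of the q⁴ points: sparse enough that δ = 9/q, and large enough that its
vertical gain q³/200 exceeds the cube excess 3 of the puncture. For other differences the puncture
deficit 2/(q⁴)² is inherited without loss. -/
theorem gapFunction_cone (hp : Odd p) (hτ : τ ≠ 0) (hn : 3 ≤ n) (hω : ¬ IsSquare ω)
    (hq : 600 * (4 * n + 6) ≤ Fintype.card K) :
    GapFunction p (perturb (puncture (K × K × K × K)) (coneSet ω) (coneFunctional τ n))
      (univ \ insert 0 (coneSet ω)) (punctureHeight (Fintype.card K ^ 4))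
      (9 / Fintype.card K) (2 / (Fintype.card K : ℝ) ^ 8) := by
  set q : ℝ := (Fintype.card K : ℝ) with hqdef
  have hqn : (600 * (4 * n + 6) : ℝ) ≤ q := by
    rw [hqdef]
    exact_mod_cast hq
  have hn3 : (3 : ℝ) ≤ n := by exact_mod_cast hn
  have hq0 : 0 < q := by linarith
  have hVn : Fintype.card (K × K × K × K) = Fintype.card K ^ 4 := by
    simp only [Fintype.card_prod]
    ring
  have hV : (Fintype.card (K × K × K × K) : ℝ) = q ^ 4 := by
    rw [hVn]
    push_cast
    rfl
  have hN : 5 ≤ Fintype.card K ^ 4 :=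
    le_trans (by omega) (Nat.le_self_pow (by norm_num) (Fintype.card K))
  have hN' : 5 ≤ Fintype.card (K × K × K × K) := by rwa [hVn]
  obtain ⟨hc, hc'⟩ := punctureHeight_bounds hN
  set c := punctureHeight (Fintype.card K ^ 4) with hcdef
  have hval : ∀ x : K × K × K × K, x ≠ 0 → puncture _ x = c := by
    intro x hx
    rw [puncture, if_neg hx, hVn]
  have hX : ∀ x ∈ coneSet ω, puncture _ x = c := by
    intro x hx
    refine hval x ?_
    rintro rfl
    exact (mem_filter.1 hx).2.1 rfl
  have h0 : ∀ x : K × K × K × K, 0 ≤ puncture _ x := by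
    intro x
    by_cases hx : x = 0
    · simp [puncture, hx]
    · rw [hval x hx]
      linarith
  have h2 : ∀ x : K × K × K × K, puncture _ x ≤ 2 := by
    intro x
    by_cases hx : x = 0
    · simp [puncture, hx]
    · rw [hval x hx]
      linarith
  have hW : (0 : ℝ) ≤ Fintype.card ((Fin n → K) × (Fin n → K) × (Fin n → K)) := by positivity
  have hcube := sum_puncture_cube_le hN'
  rw [hV] at hcube
  have hXc : ((coneSet ω).card : ℝ) = q * (q - 1) ^ 2 := card_coneSet
  have h3 : 9 / q * q ^ 4 = 9 * q ^ 3 := by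
    field_simp
  have h4 : 2 / q ^ 8 * q ^ 4 ≤ 1 := by
    rw [div_mul_eq_mul_div, div_le_one (by positivity)]
    have : (2 : ℝ) ≤ q ^ 4 := by
      rw [← hV]
      exact_mod_cast (by omega : 2 ≤ Fintype.card (K × K × K × K))
    calc 2 * q ^ 4 ≤ q ^ 4 * q ^ 4 := by gcongr
      _ = q ^ 8 := by ring
  have h5 : q ^ 2 * 1 ≤ q ^ 2 * q := by
    have : (1 : ℝ) ≤ q := by linarith
    gcongr
  have h6 : q * 1 ≤ q * q := by
    have : (1 : ℝ) ≤ q := by linarith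
    gcongr
  refine ⟨perturb_nonneg hp h0, perturb_le_two hp h2 (by linarith) hc' hX,
    card_le_sum_perturb hp h0 (sum_puncture hN').ge, ?_, ?_, ?_, ?_, ?_⟩
  · refine (sum_perturb_cube_le hp h0 h2 (by linarith) hc' hX).trans ?_
    rw [Fintype.card_prod (K × K × K × K), Nat.cast_mul, ← mul_assoc]
    refine mul_le_mul_of_nonneg_right ?_ hW
    rw [hXc, hV]
    nlinarith
  · rintro ⟨a, e⟩ hd
    rw [Fintype.card_prod (K × K × K × K), Nat.cast_mul, ← mul_assoc]
    by_cases ha : a = 0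
    · subst ha
      have he : e ≠ 0 := fun h => hd (by rw [h]; rfl)
      have hfil : (coneSet ω).filter (fun x => coneFunctional τ n x = 0) = ∅ := by
        refine Finset.filter_false_of_mem fun x hx => ?_
        exact coneFunctional_ne_zero hτ (by omega) (mem_filter.1 hx).2.1
      refine (apSumAt_perturb_vertical_le hp hc hX (g := q ^ 3 / 200) (by positivity) ?_).trans ?_
      · rw [hfil, card_empty, Nat.cast_zero, mul_zero, add_zero, hXc]
        refine (sum_gapCorrelation_cone_le hp hτ he).trans ?_
        have := mul_le_mul_of_nonneg_right hqn (sq_nonneg q)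
        rw [← hqdef]
        nlinarith
      · refine mul_le_mul_of_nonneg_right ?_ hW
        rw [hV]
        have h7 : (10800 : ℝ) ≤ q := by linarith
        have h8 : (4 : ℝ) ≤ q ^ 3 / 200 := by
          have : (10800 : ℝ) ^ 3 ≤ q ^ 3 := by gcongr
          linarith
        linarith
    · refine (apSumAt_perturb_le hp h0 h2 (by linarith) hc' hX a e).trans ?_
      refine mul_le_mul_of_nonneg_right ?_ hW
      have hind : (univ.filter fun x => ¬ IndepAlong (coneSet ω) (coneFunctional τ n) a x) = ∅ :=
        Finset.filter_false_of_mem fun x _ => not_not.2 (indepAlong_cone hp hτ hn hω ha x)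
      rw [hind, card_empty, Nat.cast_zero, mul_zero, add_zero]
      refine (apSumAt_puncture_le hp hN' ha).trans (le_of_eq ?_)
      rw [hV]
      ring
  · rintro ⟨x, w⟩ hx
    simp only [mem_sdiff, mem_univ, true_and, mem_insert, not_or] at hx
    simp only [perturb, hx.2, if_false, mul_one]
    exact hval x hx.1
  · rintro ⟨x, w⟩ hx
    simp only [mem_sdiff, mem_univ, true_and, mem_insert, not_not] at hx
    by_cases hxX : x ∈ coneSet ω
    · simp only [perturb, hxX, if_true]
      rw [hX x hxX]
      rcases gapWeight_eq_or (coneFunctional τ n x w) with h | h <;> simp [h]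
    · left
      simp [perturb, puncture, hx.resolve_right hxX]
  · have hsub : ((insert 0 (coneSet ω)).card : ℝ) ≤ q * (q - 1) ^ 2 + 1 := by
      rw [← hXc]
      exact_mod_cast Finset.card_insert_le _ _
    rw [card_sdiff_of_subset (Finset.subset_univ _), Nat.cast_sub (card_le_card (Finset.subset_univ _)), card_univ, hV]
    nlinarith

end FirstLevel

theorem hasGapFunction_cone {p : ℕ} [Fact p.Prime] (hp : Odd p) {k D : ℕ} (hk : 1 ≤ k)
    (hD : 4 ≤ D) (hq : 600 * (4 * D + 6) ≤ p ^ k) :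
    HasGapFunction p (D * k) (punctureHeight ((p ^ k) ^ 4)) (9 / (p : ℝ) ^ k)
      (2 / ((p : ℝ) ^ k) ^ 8) := by
  let K := GaloisField p k
  let _ : Fintype K := Fintype.ofFinite K
  have hk0 : k ≠ 0 := by omega
  have hKf : Module.finrank (ZMod p) K = k := GaloisField.finrank p hk0
  have hKc : Fintype.card K = p ^ k := by
    rw [← Nat.card_eq_fintype_card]
    exact GaloisField.card p k hk0
  obtain ⟨τ, hτ⟩ : ∃ τ : Module.Dual (ZMod p) K, τ ≠ 0 := exists_ne 0
  obtain ⟨ω, hω⟩ : ∃ ω : K, ¬ IsSquare ω := by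
    refine FiniteField.exists_nonsquare fun h => ?_
    rw [ringChar.eq K p] at h
    subst h
    exact absurd hp (by decide)
  have h := gapFunction_cone hp hτ (n := D) (by omega) hω (by rw [hKc]; exact hq)
  have hKr : (Fintype.card K : ℝ) = (p : ℝ) ^ k := by
    rw [hKc]
    push_cast
    rfl
  rw [hKc, Nat.cast_pow] at h
  refine ⟨K × K × K × K, (Fin D → K) × (Fin D → K) × (Fin D → K), inferInstance, inferInstance,
    inferInstance, inferInstance, inferInstance, inferInstance, _, _, ?_, ?_, ?_, h⟩
  · simp only [Module.finrank_prod, hKf]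
    nlinarith
  · simp only [Module.finrank_prod, Module.finrank_pi_fintype, hKf]
    simp
    ring
  · have h1 : (1 : ℝ) ≤ (p : ℝ) ^ k := by
      rw [← hKr]
      exact_mod_cast Fintype.card_pos
    have : (Fintype.card (K × K × K × K) : ℝ) = ((p : ℝ) ^ k) ^ 4 := by
      simp only [Fintype.card_prod, Nat.cast_mul, hKr]
      ring
    rw [this]
    have h2 : 9 / (p : ℝ) ^ k * ((p : ℝ) ^ k) ^ 4 = 9 * ((p : ℝ) ^ k) ^ 3 := by
      field_simp
    rw [h2]
    have := one_le_pow₀ (n := 3) h1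
    linarith

/-! ### Lower bound: iterating the construction -/

section Iteration

/-- The degrees of the fields used in the iterated construction. -/
def blockDim (p k : ℕ) : ℕ → ℕ
  | 0 => k
  | i + 1 => p ^ blockDim p k i / 2 ^ 13 * blockDim p k i

variable {p k : ℕ}

theorem blockDim_bounds (hp : 2 ≤ p) (hk : 1 ≤ k) (hq : 2 ^ 19 ≤ p ^ k) (i : ℕ) :
    1 ≤ blockDim p k i ∧ 2 ^ 19 ≤ p ^ blockDim p k i ∧
      64 ≤ p ^ blockDim p k i / 2 ^ 13 ∧ 64 * blockDim p k i ≤ blockDim p k (i + 1) := by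
  induction i with
  | zero =>
    have h : 64 ≤ p ^ k / 2 ^ 13 := by
      rw [Nat.le_div_iff_mul_le (by positivity)]
      exact le_trans (by norm_num) hq
    exact ⟨hk, hq, h, Nat.mul_le_mul_right _ h⟩
  | succ i ih =>
    obtain ⟨h1, h2, h3, h4⟩ := ih
    have h5 : 2 ^ 19 ≤ p ^ blockDim p k (i + 1) :=
      h2.trans (Nat.pow_le_pow_right (by omega) (by omega))
    have h : 64 ≤ p ^ blockDim p k (i + 1) / 2 ^ 13 := by
      rw [Nat.le_div_iff_mul_le (by positivity)]
      exact le_trans (by norm_num) h5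
    exact ⟨by omega, h5, h, Nat.mul_le_mul_right _ h⟩

/-- The factor 2 makes the induction close: a block dimension that is at least 64 and at least 2T is
at least 32 + T, and p³² absorbs the division by 2¹³. -/
theorem two_mul_expTower_le_blockDim (hp : 2 ≤ p) (hk : 1 ≤ k) (hq : 2 ^ 19 ≤ p ^ k) (i : ℕ) :
    2 * expTower p i ≤ blockDim p k (i + 1) := by
  induction i with
  | zero =>
    have := blockDim_bounds hp hk hq 0
    simp only [expTower]
    omega
  | succ i ih =>
    have h0 := blockDim_bounds hp hk hq 0
    have hb : ∀ j, 64 ≤ blockDim p k (j + 1) := by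
      intro j
      have := blockDim_bounds hp hk hq j
      omega
    have h64 := hb i
    have h1 := blockDim_bounds hp hk hq (i + 1)
    have hD : 2 * expTower p (i + 1) ≤ p ^ blockDim p k (i + 1) / 2 ^ 13 := by
      rw [Nat.le_div_iff_mul_le (by positivity), expTower]
      calc 2 * p ^ expTower p i * 2 ^ 13 = 2 ^ 14 * p ^ expTower p i := by ring
        _ ≤ 2 ^ 32 * p ^ expTower p i := by gcongr <;> norm_num
        _ ≤ p ^ 32 * p ^ expTower p i := by gcongr
        _ = p ^ (32 + expTower p i) := (pow_add _ _ _).symm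
        _ ≤ _ := Nat.pow_le_pow_right (by omega) (by omega)
    calc 2 * expTower p (i + 1) ≤ p ^ blockDim p k (i + 1) / 2 ^ 13 * 1 := by simpa using hD
      _ ≤ _ := Nat.mul_le_mul_left _ h1.1

variable [Fact p.Prime]

theorem mul_pow_le_pow_blockDim (hk : 1 ≤ k) (hq : 2 ^ 19 ≤ p ^ k) (i : ℕ) :
    32 * (p : ℝ) ^ 3 * ((p : ℝ) ^ k) ^ 8 ≤ (p : ℝ) ^ blockDim p k (i + 1) := by
  have hp : 2 ≤ p := (Fact.out : p.Prime).two_le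
  have hle : 64 * k ≤ blockDim p k (i + 1) := by
    induction i with
    | zero => exact (blockDim_bounds hp hk hq 0).2.2.2
    | succ i ih =>
      have := (blockDim_bounds hp hk hq (i + 1)).2.2.2
      omega
  have h : 32 * p ^ 3 * (p ^ k) ^ 8 ≤ p ^ blockDim p k (i + 1) := by
    calc 32 * p ^ 3 * (p ^ k) ^ 8 ≤ p ^ k * (p ^ k) ^ 3 * (p ^ k) ^ 8 := by
          gcongr
          · exact le_trans (by norm_num) hq
          · exact Nat.le_self_pow (by omega) p
      _ = p ^ (12 * k) := by ring
      _ ≤ _ := Nat.pow_le_pow_right (by omega) (by omega)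
  exact_mod_cast h

/-- The lower bound for ε carries a reserve 32p³/Q, with Q the size of the next field. The next step
spends 16p³/Q, and the other half covers the following reserve because Q at least doubles. Thus 1/q⁸
is never touched. -/
theorem exists_hasGapFunction_blockDim (hp : Odd p) (hk : 1 ≤ k) (hq : 2 ^ 19 ≤ p ^ k) {c : ℝ}
    (hc : c = punctureHeight ((p ^ k) ^ 4)) (i : ℕ) (hi : 8192 ^ i * (9 / (p : ℝ) ^ k) ≤ 8) :
    ∃ ε, 1 / ((p : ℝ) ^ k) ^ 8 + 32 * (p : ℝ) ^ 3 / (p : ℝ) ^ blockDim p k (i + 1) ≤ ε ∧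
      HasGapFunction p (blockDim p k (i + 1)) c (8192 ^ i * (9 / (p : ℝ) ^ k)) ε := by
  have hp2 : 2 ≤ p := (Fact.out : p.Prime).two_le
  have hp0 : (0 : ℝ) < p := by exact_mod_cast (by omega : 0 < p)
  set q : ℝ := (p : ℝ) ^ k with hqdef
  have hq0 : 0 < q := by positivity
  have hq1 : 2 ^ 19 ≤ q := by
    rw [hqdef]
    exact_mod_cast hq
  have hsmall : ∀ j, 32 * (p : ℝ) ^ 3 / (p : ℝ) ^ blockDim p k (j + 1) ≤ 1 / q ^ 8 := by
    intro j
    rw [div_le_div_iff₀ (by positivity) (by positivity), one_mul]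
    exact mul_pow_le_pow_blockDim hk hq j
  have hN : 5 ≤ (p ^ k) ^ 4 :=
    le_trans (le_trans (by norm_num) hq) (Nat.le_self_pow (by norm_num) (p ^ k))
  obtain ⟨hc1, hc2⟩ := punctureHeight_bounds hN
  rw [← hc] at hc1 hc2
  have hdiv : ∀ m, p ^ m / 2 ^ 13 * 2 ^ 13 ≤ p ^ m := fun m => Nat.div_mul_le_self _ _
  induction i with
  | zero =>
    refine ⟨2 / q ^ 8, ?_, ?_⟩
    · have := hsmall 0
      have e : 2 / q ^ 8 = 1 / q ^ 8 + 1 / q ^ 8 := by ring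
      rw [e]
      linarith
    · rw [pow_zero, one_mul, hc]
      have hd := hdiv k
      have h64 : 4 ≤ p ^ k / 2 ^ 13 := (blockDim_bounds hp2 hk hq 0).2.2.1.trans' (by norm_num)
      have hD : 600 * (4 * (p ^ k / 2 ^ 13) + 6) ≤ p ^ k := by omega
      exact hasGapFunction_cone (D := p ^ k / 2 ^ 13) hp hk h64 hD
  | succ i ih =>
    have hprev : 8192 ^ i * (9 / q) ≤ 1 / 1024 := by
      rw [pow_succ] at hi
      linarith
    obtain ⟨ε, hε, hf⟩ := ih (by linarith)
    obtain ⟨b1, b2, b3, b4⟩ := blockDim_bounds hp2 hk hq (i + 1)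
    refine ⟨1 / q ^ 8 + 32 * (p : ℝ) ^ 3 / (p : ℝ) ^ blockDim p k (i + 1 + 1), le_rfl, ?_⟩
    have hd := hdiv (blockDim p k (i + 1))
    have e : (8192 : ℝ) ^ (i + 1) * (9 / q) = 8192 * (8192 ^ i * (9 / q)) := by ring
    rw [e]
    refine hf.step hp b1 hc1 hc2 (b3.trans' (by norm_num)) (by omega) (by positivity) hprev ?_ ?_
    · have h1 := hsmall (i + 1)
      have h2 : 1 / q ^ 8 ≤ 1 / q := by
        apply one_div_le_one_div_of_le hq0
        exact le_self_pow₀ (by linarith) (by norm_num)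
      have h3 : 1 * (9 / q) ≤ 8192 ^ i * (9 / q) := by
        gcongr
        exact one_le_pow₀ (by norm_num)
      have h4 : 9 / q = 9 * (1 / q) := by ring
      have h5 : 0 < 1 / q := by positivity
      linarith
    · set Q := (p : ℝ) ^ blockDim p k (i + 1) with hQ
      have hQ0 : 0 < Q := by positivity
      have hQ2 : 2 * Q ≤ (p : ℝ) ^ blockDim p k (i + 1 + 1) := by
        have : 2 * p ^ blockDim p k (i + 1) ≤ p ^ blockDim p k (i + 1 + 1) := by
          calc 2 * p ^ blockDim p k (i + 1) ≤ p * p ^ blockDim p k (i + 1) := by gcongr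
            _ = p ^ (blockDim p k (i + 1) + 1) := by ring
            _ ≤ _ := Nat.pow_le_pow_right (by omega) (by omega)
        rw [hQ]
        exact_mod_cast this
      have h1 : 32 * (p : ℝ) ^ 3 / (p : ℝ) ^ blockDim p k (i + 1 + 1)
          ≤ 32 * (p : ℝ) ^ 3 / (2 * Q) := by gcongr
      have h2 : 16 * (p : ℝ) ^ 3 / Q ≤ ε - (1 / q ^ 8
          + 32 * (p : ℝ) ^ 3 / (p : ℝ) ^ blockDim p k (i + 1 + 1)) := by
        have e1 : 32 * (p : ℝ) ^ 3 / (2 * Q) = 16 * (p : ℝ) ^ 3 / Q := by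
          field_simp
          norm_num
        have e2 : 32 * (p : ℝ) ^ 3 / Q = 2 * (16 * (p : ℝ) ^ 3 / Q) := by ring
        rw [e1] at h1
        rw [e2] at hε
        linarith
      exact (div_le_iff₀ hQ0).1 h2

/-- Tower-type lower bound: there are failures in dimension at least a tower of height
`L + 1`, where `L` is proportional to `k * log p`. -/
theorem exists_dim_ge_expTower (hp : Odd p) (hk : 1 ≤ k) (hq : 2 ^ 19 ≤ p ^ k) {L : ℕ}
    (hL : 2 ^ (13 * L + 14) ≤ p ^ k) {η : ℝ} (hη0 : 0 ≤ η) (hη : 8 * η * ((p : ℝ) ^ k) ^ 8 < 1) :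
    ∃ n, 2 * expTower p (L + 1) ≤ n ∧ ¬ HasPopularDifferences p η n := by
  have hp2 : 2 ≤ p := (Fact.out : p.Prime).two_le
  have hp0 : (0 : ℝ) < p := by exact_mod_cast (by omega : 0 < p)
  have hLr : (8192 : ℝ) ^ L * 16384 ≤ (p : ℝ) ^ k := by
    have e : (8192 : ℝ) ^ L * 16384 = 2 ^ (13 * L + 14) := by
      rw [pow_add, pow_mul]
      norm_num
    rw [e]
    exact_mod_cast hL
  have hN : 5 ≤ (p ^ k) ^ 4 :=
    le_trans (le_trans (by norm_num) hq) (Nat.le_self_pow (by norm_num) (p ^ k))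
  obtain ⟨hc1, hc2⟩ := punctureHeight_bounds hN
  have hq1 : (2 : ℝ) ^ 19 ≤ (p : ℝ) ^ k := by exact_mod_cast hq
  have hpk : (0 : ℝ) < (p : ℝ) ^ k := by positivity
  have hδ : 8192 ^ L * (9 / (p : ℝ) ^ k) ≤ 1 / 1024 := by
    rw [← mul_div_assoc, div_le_div_iff₀ hpk (by norm_num)]
    have : (0 : ℝ) < 8192 ^ L := by positivity
    linarith
  obtain ⟨ε, hε, hf⟩ := exists_hasGapFunction_blockDim hp hk hq rfl L (by linarith)
  obtain ⟨b1, b2, b3, b4⟩ := blockDim_bounds hp2 hk hq (L + 1)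
  have hd := Nat.div_mul_le_self (p ^ blockDim p k (L + 1)) (2 ^ 13)
  have hfin : ∃ n, p ^ blockDim p k (L + 1) / 2 ^ 13 * blockDim p k (L + 1) ≤ n ∧
      ¬ HasPopularDifferences p η n := by
    refine hf.exists_dim_not_hasPopularDifferences (ε' := 1 / ((p : ℝ) ^ k) ^ 8) hp b1 hc1 hc2
      (by omega) (by omega) hδ ?_ ?_ ?_ hη0
    · have h2 : 1 / ((p : ℝ) ^ k) ^ 8 ≤ 1 / (p : ℝ) ^ k := by
        apply one_div_le_one_div_of_le hpk
        exact le_self_pow₀ (by linarith) (by norm_num)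
      have h3 : 1 * (9 / (p : ℝ) ^ k) ≤ 8192 ^ L * (9 / (p : ℝ) ^ k) := by
        gcongr
        exact one_le_pow₀ (by norm_num)
      have h4 : 9 / (p : ℝ) ^ k = 9 * (1 / (p : ℝ) ^ k) := by ring
      have h5 : 0 < 1 / (p : ℝ) ^ k := by positivity
      linarith
    · have hQ0 : (0 : ℝ) < (p : ℝ) ^ blockDim p k (L + 1) := by positivity
      rw [← div_le_iff₀ hQ0]
      have e2 : 32 * (p : ℝ) ^ 3 / (p : ℝ) ^ blockDim p k (L + 1)
          = 2 * (16 * (p : ℝ) ^ 3 / (p : ℝ) ^ blockDim p k (L + 1)) := by ring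
      have : 0 < 16 * (p : ℝ) ^ 3 / (p : ℝ) ^ blockDim p k (L + 1) := by positivity
      linarith
    · rwa [lt_div_iff₀ (by positivity)]
  obtain ⟨n, hn, hfail⟩ := hfin
  exact ⟨n, (two_mul_expTower_le_blockDim hp2 hk hq (L + 1)).trans hn, hfail⟩

end Iteration

/-! ### Choice of parameters and conclusion -/

theorem two_pow_log_bounds {q : ℕ} (hq : q ≠ 0) :
    (Nat.log 2 q : ℝ) ≤ Real.logb 2 q ∧ Real.logb 2 q ≤ Nat.log 2 q + 1 := by
  have hq0 : (0 : ℝ) < q := by exact_mod_cast Nat.pos_of_ne_zero hq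
  constructor
  · rw [Real.le_logb_iff_rpow_le (by norm_num) hq0, Real.rpow_natCast]
    exact_mod_cast Nat.pow_log_le_self 2 hq
  · rw [Real.logb_le_iff_le_rpow (by norm_num) hq0]
    have : ((Nat.log 2 q : ℝ) + 1) = ((Nat.log 2 q + 1 : ℕ) : ℝ) := by push_cast; ring
    rw [this, Real.rpow_natCast]
    exact_mod_cast (Nat.lt_pow_succ_log_self (by norm_num) q).le

theorem eight_le_two_pow_mul {ε : ℝ} (hε : 0 < ε) :
    8 ≤ 2 ^ (⌈Real.logb 2 (1 / ε)⌉₊ + 3) * ε := by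
  have h : 1 / ε ≤ 2 ^ ⌈Real.logb 2 (1 / ε)⌉₊ := by
    rw [← Real.rpow_natCast, ← Real.logb_le_iff_le_rpow (by norm_num) (by positivity)]
    exact Nat.le_ceil _
  rw [div_le_iff₀ hε] at h
  rw [pow_add]
  linarith

/-- Take the largest `k` with 16 q⁸ ≤ E, where q = p^k. Maximality gives E < 16 p⁸ q⁸, so the factor
p⁸ in the hypothesis cancels and 2¹⁶¹ leaves q > 2¹⁹; p ≤ q gives the upper bound. -/
theorem exists_fieldDegree {p : ℕ} (hp : 2 ≤ p) {E : ℝ} (hE : 2 ^ 161 * (p : ℝ) ^ 8 ≤ E) :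
    ∃ k : ℕ, 1 ≤ k ∧ 2 ^ 19 ≤ p ^ k ∧ 16 * ((p : ℝ) ^ k) ^ 8 ≤ E ∧
      E ≤ 16 * ((p : ℝ) ^ k) ^ 16 := by
  have hp1 : (2 : ℝ) ≤ p := by exact_mod_cast hp
  have hp8 : (0 : ℝ) < (p : ℝ) ^ 8 := by positivity
  have hex : ∃ k : ℕ, E < 16 * ((p : ℝ) ^ k) ^ 8 := by
    obtain ⟨k, hk⟩ := pow_unbounded_of_one_lt E (by linarith : (1 : ℝ) < p)
    refine ⟨k, hk.trans_le ?_⟩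
    have h1 : (1 : ℝ) ≤ (p : ℝ) ^ k := one_le_pow₀ (by linarith)
    have := le_self_pow₀ h1 (n := 8) (by norm_num)
    linarith
  classical
  set m := Nat.find hex with hm
  have hspec : E < 16 * ((p : ℝ) ^ m) ^ 8 := Nat.find_spec hex
  have hm2 : 2 ≤ m := by
    by_contra! h
    have : ((p : ℝ) ^ m) ^ 8 ≤ p ^ 8 := by
      gcongr
      calc (p : ℝ) ^ m ≤ p ^ 1 := pow_le_pow_right₀ (by linarith) (by omega)
        _ = p := pow_one _
    linarith
  obtain ⟨k, hk⟩ : ∃ k, m = k + 1 := ⟨m - 1, by omega⟩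
  have hmin : 16 * ((p : ℝ) ^ k) ^ 8 ≤ E := not_lt.1 (Nat.find_min hex (m := k) (by omega))
  rw [hk] at hspec
  have e : 16 * ((p : ℝ) ^ (k + 1)) ^ 8 = p ^ 8 * (16 * ((p : ℝ) ^ k) ^ 8) := by ring
  rw [e] at hspec
  have hk1 : 1 ≤ k := by omega
  refine ⟨k, hk1, ?_, hmin, ?_⟩
  · have h1 : (p : ℝ) ^ 8 * 2 ^ 161 < p ^ 8 * (16 * ((p : ℝ) ^ k) ^ 8) := by linarith
    have h2 := lt_of_mul_lt_mul_left h1 hp8.le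
    have h3 : ((2 : ℝ) ^ 19) ^ 8 < ((p : ℝ) ^ k) ^ 8 := by
      norm_num at h2 ⊢
      linarith
    have h4 := lt_of_pow_lt_pow_left₀ 8 (by positivity) h3
    exact_mod_cast h4.le
  · have hpk : (p : ℝ) ≤ p ^ k := le_self_pow₀ (by linarith) (by omega)
    calc E ≤ p ^ 8 * (16 * ((p : ℝ) ^ k) ^ 8) := hspec.le
      _ ≤ (p ^ k) ^ 8 * (16 * ((p : ℝ) ^ k) ^ 8) := by gcongr
      _ = _ := by ring

end Auxiliary

theorem theorem2 :
    ∃ c C : ℝ, 0 < c ∧ 0 < C ∧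
      ∀ (p : ℕ), p.Prime → Odd p →
      ∀ ε : ℝ, 0 < ε → ε ≤ 1 / (2 ^ 161 * (p : ℝ) ^ 8) →
        IsLeast (admissibleDimensions p ε) (popularDim p ε) ∧
        ∃ h₁ h₂ : ℕ,
          (c * Real.logb 2 (1 / ε) ≤ (h₁ : ℝ) ∧ (h₁ : ℝ) ≤ C * Real.logb 2 (1 / ε)) ∧
          (c * Real.logb 2 (1 / ε) ≤ (h₂ : ℝ) ∧ (h₂ : ℝ) ≤ C * Real.logb 2 (1 / ε)) ∧
          expTower p h₁ ≤ popularDim p ε ∧ popularDim p ε ≤ expTower p h₂ := by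
  refine ⟨1 / 1000, 7, by norm_num, by norm_num, fun p hp hodd ε hε hεle => ?_⟩
  have : Fact p.Prime := ⟨hp⟩
  have hp2 : (2 : ℝ) ≤ p := by exact_mod_cast hp.two_le
  have hE : 2 ^ 161 * (p : ℝ) ^ 8 ≤ 1 / ε := by
    rw [le_div_iff₀ hε]
    rw [le_div_iff₀ (by positivity)] at hεle
    linarith
  have hp8 : (1 : ℝ) ≤ (p : ℝ) ^ 8 := one_le_pow₀ (by linarith)
  have hE0 : 0 < 1 / ε := by positivity
  have hlog : 161 ≤ Real.logb 2 (1 / ε) := by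
    rw [Real.le_logb_iff_rpow_le (by norm_num) hE0]
    refine le_trans ?_ hE
    have : (2 : ℝ) ^ (161 : ℝ) = 2 ^ 161 := by exact_mod_cast Real.rpow_natCast 2 161
    rw [this]
    exact le_mul_of_one_le_right (by positivity) hp8
  have hε1 : ε ≤ 1 := by
    have : 1 ≤ 1 / ε := by
      refine le_trans ?_ hE
      exact one_le_mul_of_one_le_of_one_le (one_le_pow₀ (by norm_num)) hp8
    rwa [le_div_iff₀ hε, one_mul] at this
  set K := ⌈Real.logb 2 (1 / ε)⌉₊ + 3 with hK
  have hmem : expTower p (6 * K + 1) ∈ admissibleDimensions p ε :=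
    ⟨one_le_expTower hp.two_le _, fun n hn =>
      hasPopularDifferences_of_expTower_le hp hodd hε hε1 (eight_le_two_pow_mul hε) hn⟩
  have hleast : IsLeast (admissibleDimensions p ε) (popularDim p ε) :=
    ⟨Nat.sInf_mem ⟨_, hmem⟩, fun N hN => Nat.sInf_le hN⟩
  refine ⟨hleast, ?_⟩
  obtain ⟨k, hk1, hq, hqE, hEq⟩ := exists_fieldDegree hp.two_le hE
  have hpk : (0 : ℝ) < (p : ℝ) ^ k := by positivity
  have hq0 : p ^ k ≠ 0 := by positivity
  have hL19 : 19 ≤ Nat.log 2 (p ^ k) := Nat.le_log_of_pow_le (by norm_num) hq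
  obtain ⟨hlo, hhi⟩ := two_pow_log_bounds hq0
  push_cast at hlo hhi
  set M := Nat.log 2 (p ^ k) with hM
  have hdm := Nat.div_add_mod (M - 14) 13
  have hmod := Nat.mod_lt (M - 14) (by norm_num : 13 > 0)
  set L := (M - 14) / 13 with hL
  have hLM : 13 * L + 14 ≤ M := by omega
  have hML : M ≤ 13 * L + 26 := by omega
  have hpow : 2 ^ (13 * L + 14) ≤ p ^ k :=
    (Nat.pow_le_pow_right (by norm_num) hLM).trans (Nat.pow_log_le_self 2 hq0)
  obtain ⟨n, hn, hfail⟩ := exists_dim_ge_expTower hodd hk1 hq hpow hε.le (by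
    rw [le_div_iff₀ hε] at hqE
    linarith)
  -- Admissibility of N concerns all dimensions from N on, so a single failure at `n` suffices.
  have hlt : n < popularDim p ε := by
    by_contra! h
    exact hfail (hleast.1.2 n h)
  have hlog16 : Real.logb 2 16 = 4 := by
    rw [show (16 : ℝ) = 2 ^ (4 : ℕ) by norm_num, Real.logb_pow, Real.logb_self_eq_one] <;> norm_num
  have h1 : 4 + 8 * Real.logb 2 ((p : ℝ) ^ k) ≤ Real.logb 2 (1 / ε) := by
    have := Real.logb_le_logb_of_le (b := 2) (by norm_num) (by positivity) hqE
    rw [Real.logb_mul (by norm_num) (by positivity), hlog16, Real.logb_pow 2 ((p : ℝ) ^ k) 8] at this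
    exact_mod_cast this
  have h2 : Real.logb 2 (1 / ε) ≤ 4 + 16 * Real.logb 2 ((p : ℝ) ^ k) := by
    have := Real.logb_le_logb_of_le (b := 2) (by norm_num) hE0 hEq
    rw [Real.logb_mul (by norm_num) (by positivity), hlog16,
      Real.logb_pow 2 ((p : ℝ) ^ k) 16] at this
    exact_mod_cast this
  have hLMr : (13 * L + 14 : ℝ) ≤ M := by exact_mod_cast hLM
  have hMLr : (M : ℝ) ≤ 13 * L + 26 := by exact_mod_cast hML
  have hc1 := Nat.le_ceil (Real.logb 2 (1 / ε))
  have hc2 := (Nat.ceil_lt_add_one (by linarith : 0 ≤ Real.logb 2 (1 / ε))).le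
  have hL0 : (0 : ℝ) ≤ L := Nat.cast_nonneg L
  -- Both heights are linear in log₂(1/ε): 13L is log₂ q up to a constant, and log₂(1/ε) lies
  -- between 8 log₂ q and 16 log₂ q up to 4. The additive constants are absorbed by log₂(1/ε) ≥ 161.
  refine ⟨L + 1, 6 * K + 1, ⟨?_, ?_⟩, ⟨?_, ?_⟩, ?_, hleast.2 hmem⟩
  · push_cast
    linarith
  · push_cast
    linarith
  · rw [hK]
    push_cast
    linarith
  · rw [hK]
    push_cast
    linarith
  · have := Nat.le_mul_of_pos_left (expTower p (L + 1)) (by norm_num : 0 < 2)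
    omega
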